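/- **Model.** Base stations (BSs) of two tiers, macro ($j=m$) and small ($j=s$), form independent homogeneous Poisson point processes in $\mathbb R^2$ with densities $\lambda_j>0$; the typical user is at the origin. Tier $j$ has transmit power $p_j>0$, bias $B_j>0$, $M_j$ antennas and $\Psi_j$ served users with $1\le\Psi_j\le M_j$, and $\Delta_j=M_j-\Psi_j+1$. Both tiers have the path-loss exponent $\alpha>2$ and noise power $N\ge 0$. The channel power of the $i$th BS of tier $j$, at $x_{i,j}$, is $h_{i,j}\sim\Gamma(\Delta_j,1)$ if it serves the user and $g_{i,j}\sim\Gamma(\Psi_j,1)$ if it interferes; the fading of distinct BSs is independent, and independent of the positions. The user is served by the BS, among both tiers, with the largest biased mean received power $B_j\Delta_jp_j\|x_{i,j}\|^{-\alpha}$; let $A_j$ be the event that this BS is in tier $j$. If it is the $i$th BS of tier $j$, the SINR is $$\gamma=\frac{p_jh_{i,j}\|x_{i,j}\|^{-\alpha}}{\sum_{(l,k)\ne(j,i)}p_lg_{k,l}\|x_{k,l}\|^{-\alpha}+N}.$$ **Notation.** Let $\beta=\left(\frac{p_s}{p_m}\frac{\Delta_s}{\Delta_m}\frac{B_s}{B_m}\right)^{-1}$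 and $\mathcal A_{\mathrm{SBS}}=\left(1+\frac{\lambda_m}{\lambda_s}\beta^{2/\alpha}\right)^{-1}$. For $r>0$ put $$f_m(r)=\frac{2\pi\lambda_m r\,e^{-\pi r^2(\lambda_m+\lambda_s\beta^{-2/\alpha})}}{1-\mathcal A_{\mathrm{SBS}}},\qquad f_s(r)=\frac{2\pi\lambda_s r\,e^{-\pi r^2(\lambda_s+\lambda_m\beta^{2/\alpha})}}{\mathcal A_{\mathrm{SBS}}}.$$ If tier $m$ serves from distance $r$, put $r_m=r$ and $r_s=\beta^{-1/\alpha}r$; if tier $s$ serves from distance $r$, put $r_s=r$ and $r_m=\beta^{1/\alpha}r$. With these radii let $\mathcal I=\sum_{l\in\{m,s\}}\sum_{k:\|x_{k,l}\|>r_l}p_lg_{k,l}\|x_{k,l}\|^{-\alpha}$, $\mathcal L_{\mathcal I}(s)=\mathbb E[e^{-s\mathcal I}]$, $w_l=\frac1{1+sp_lr_l^{-\alpha}}$ and $B'(a,b,x)=\int_x^1t^{a-1}(1-t)^{b-1}\,dt$. **Theorem.** For every threshold $\mathcal T>0$ and for each serving tier $j\in\{m,s\}$, $$P_{c,A_j}:=\mathbb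 P(\gamma>\mathcal T\mid A_j)=\int_0^\infty\left[\sum_{k=0}^{\Delta_j-1}\frac{(-s)^k}{k!}\frac{d^k}{ds^k}\left(e^{-sN}\mathcal L_{\mathcal I}(s)\right)\right]_{s=p_j^{-1}\mathcal T r^\alpha}f_j(r)\,dr ,$$ where the integral converges absolutely, $r$ is held fixed in the derivatives, and $r_m,r_s$ in $\mathcal L_{\mathcal I}$ are those for serving tier $j$. The overall coverage probability is $$\mathbb P(\gamma>\mathcal T)=(1-\mathcal A_{\mathrm{SBS}})P_{c,A_m}+\mathcal A_{\mathrm{SBS}}P_{c,A_s}.$$ Here $\mathbb P(A_s)=\mathcal A_{\mathrm{SBS}}$ and $\mathbb P(A_m)=1-\mathcal A_{\mathrm{SBS}}$; $f_j$ is the probability density of the serving distance conditioned on $A_j$; and for $r,s>0$ $$\mathcal L_{\mathcal I}(s)=\exp\left\{-s^{2/\alpha}\sum_{l\in\{m,s\}}\lambda_lp_l^{2/\alpha}\,\frac{2\pi}{\alpha}\sum_{i=1}^{\Psi_l}\binom{\Psi_l}{i}B'\left(\Psi_l-i+\tfrac2\alpha,\;i-\tfrac2\alpha,\;w_l\right)\right\}.$$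 For fixed $r>0$ the function $s\mapsto e^{-sN}\mathcal L_{\mathcal I}(s)$ is smooth on $(0,\infty)$, with, for all $k\ge0$, $$\frac{d^k}{ds^k}\left(e^{-sN}\mathcal L_{\mathcal I}(s)\right)=e^{-sN}\mathcal L_{\mathcal I}(s)\sum_{i_1+2i_2+\dots+ki_k=k}\frac{k!}{\prod_{n=1}^k(n!)^{i_n}\,i_n!}\prod_{n=1}^kE(n)^{i_n},$$ $$E(n)=-N\mathbf 1_{n=1}+2\pi\sum_{l\in\{m,s\}}D_l(n)\,p_l^n(sp_l)^{\frac2\alpha-n},\quad D_l(n)=\frac{\lambda_l}{\alpha}(-1)^n\frac{(\Psi_l+n-1)!}{(\Psi_l-1)!}B'\left(\Psi_l+\tfrac2\alpha,\;n-\tfrac2\alpha,\;w_l\right).$$ -/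

import Mathlib

open MeasureTheory ProbabilityTheory
open scoped ENNReal NNReal

noncomputable section

/-- The two tiers of the network: macro base stations (MBS) and small base stations (SBS). -/
inductive Tier where
  | mbs
  | sbs
  deriving DecidableEq

instance : Fintype Tier :=
  ⟨{Tier.mbs, Tier.sbs}, fun j => by cases j <;> simp⟩

/-- The parameters of a two-tier multi-user MIMO network, with a common path-loss exponent `α`
and a common noise power `N = σ²`. -/
structure NetParams where
  /-- density of the base stations of the tier -/
  lam : Tier → ℝ
  /-- cell-selection bias -/
  bias : Tier → ℝ
  /-- number of antennas per base station -/
  antennas : Tier → ℕ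
  /-- number of users served by one base station in a resource block -/
  users : Tier → ℕ
  /-- transmit power per user -/
  power : Tier → ℝ
  /-- path-loss exponent -/
  α : ℝ
  /-- noise power -/
  noise : ℝ
  lam_pos : ∀ j, 0 < lam j
  bias_pos : ∀ j, 0 < bias j
  users_pos : ∀ j, 1 ≤ users j
  users_le : ∀ j, users j ≤ antennas j
  power_pos : ∀ j, 0 < power j
  two_lt_α : 2 < α
  noise_nonneg : 0 ≤ noise

/-- The points `X 0 ω, X 1 ω, …` (listed in some measurable way, with multiplicity) form a
homogeneous Poisson point process of intensity `lam` in the plane: the numbers of points in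
finitely many disjoint measurable sets of finite area are independent and Poisson distributed,
with mean `lam` times the area. -/
structure IsHomogeneousPPP {Ω : Type*} [MeasurableSpace Ω] (lam : ℝ)
    (X : ℕ → Ω → EuclideanSpace ℝ (Fin 2)) (μ : Measure Ω) : Prop where
  measurable : ∀ n, Measurable (X n)
  counts : ∀ (m : ℕ) (A : Fin m → Set (EuclideanSpace ℝ (Fin 2))) (k : Fin m → ℕ),
    (∀ i, MeasurableSet (A i)) → (∀ i, volume (A i) ≠ ∞) →
    Pairwise (fun i i' => Disjoint (A i) (A i')) →
    μ {ω | ∀ i, {n : ℕ | X n ω ∈ A i}.encard = (k i : ℕ∞)} =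
      ∏ i, poissonMeasure (lam.toNNReal * (volume (A i)).toNNReal) {k i}

/-- Complementary incomplete Beta function `∫_x^1 t^(p-1) (1-t)^(q-1) dt`. -/
def compIncBeta (p q x : ℝ) : ℝ :=
  ∫ t in x..1, t ^ (p - 1) * (1 - t) ^ (q - 1)

namespace NetParams

variable (q : NetParams)

/-- `Δ_j = M_j - Ψ_j + 1`. -/
def Δ (j : Tier) : ℕ := q.antennas j - q.users j + 1

/-- `β = (p̂ Δ̂ B̂)⁻¹`, where hats denote the ratios of the SBS to the MBS parameters. -/
def β : ℝ :=
  ((q.power .sbs / q.power .mbs) * ((q.Δ .sbs : ℝ) / (q.Δ .mbs : ℝ)) *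
    (q.bias .sbs / q.bias .mbs))⁻¹

/-- Closed form of the probability of association with the SBS tier. -/
def assocSBS : ℝ :=
  1 / (1 + (1 / (q.lam .sbs / q.lam .mbs)) *
    (1 / ((q.power .sbs / q.power .mbs) * ((q.Δ .sbs : ℝ) / (q.Δ .mbs : ℝ)) *
      (q.bias .sbs / q.bias .mbs)) ^ (2 / q.α)))

/-- Density of the distance from the typical user to its serving base station, given that this
base station belongs to tier `j`. -/
def servingPdf (j : Tier) (r : ℝ) : ℝ :=
  match j with
  | .mbs =>
    2 * Real.pi * q.lam .mbs * r *
      Real.exp (-Real.pi * r ^ 2 * (q.lam .mbs + q.lam .sbs * q.β ^ (-(2 / q.α)))) /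
      (1 - q.assocSBS)
  | .sbs =>
    2 * Real.pi * q.lam .sbs * r *
      Real.exp (-Real.pi * r ^ 2 * (q.lam .sbs + q.lam .mbs * q.β ^ (2 / q.α))) /
      q.assocSBS

/-- If the user is served by tier `j` from distance `r`, the interfering base stations of
tier `l` lie outside the disc of this radius around the user. -/
def exclusionRadius (j l : Tier) (r : ℝ) : ℝ :=
  match j, l with
  | .mbs, .mbs => r
  | .sbs, .sbs => r
  | .mbs, .sbs => q.β⁻¹ ^ (1 / q.α) * r
  | .sbs, .mbs => q.β ^ (1 / q.α) * r

/-- `w_l = 1 / (1 + s p_l r_l^{-α})`, with `r_l` the exclusion radius of tier `l`. -/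
def w (j l : Tier) (r s : ℝ) : ℝ :=
  1 / (1 + s * q.power l * q.exclusionRadius j l r ^ (-q.α))

/-- `C(α, Ψ, w) = (2π/α) ∑_{i=1}^Ψ binom(Ψ, i) B'(Ψ - i + 2/α, i - 2/α, w)`. -/
def laplaceC (Ψ : ℕ) (x : ℝ) : ℝ :=
  2 * Real.pi / q.α * ∑ i ∈ Finset.Icc 1 Ψ, (Ψ.choose i : ℝ) *
    compIncBeta ((Ψ : ℝ) - i + 2 / q.α) ((i : ℝ) - 2 / q.α) x

/-- Closed form of the Laplace transform of the interference. -/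
def laplaceFormula (j : Tier) (r s : ℝ) : ℝ :=
  Real.exp (-s ^ (2 / q.α) *
    ∑ l : Tier, q.lam l * q.power l ^ (2 / q.α) * q.laplaceC (q.users l) (q.w j l r s))

/-- `D_l(n)`, the contribution of tier `l` to the `n`-th derivative of the exponent. -/
def derivD (j l : Tier) (r s : ℝ) (n : ℕ) : ℝ :=
  q.lam l / q.α * (-1) ^ n *
    ((q.users l + n - 1).factorial / (q.users l - 1).factorial : ℝ) *
    compIncBeta ((q.users l : ℝ) + 2 / q.α) ((n : ℝ) - 2 / q.α) (q.w j l r s)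

/-- `E(n)`, the `n`-th derivative of the exponent `log (e^{-sN} L(s))`, for `n ≥ 1`. -/
def derivE (j : Tier) (r s : ℝ) (n : ℕ) : ℝ :=
  -(if n = 1 then q.noise else 0) +
    2 * Real.pi * ∑ l : Tier,
      q.derivD j l r s n * q.power l ^ n * (s * q.power l) ^ (2 / q.α - n)

/-- The Faà di Bruno sum over all `(i_1, …, i_k)` with `i_1 + 2 i_2 + ⋯ + k i_k = k`
(in the code, `i n` stands for `i_{n+1}`; the bound `i n ≤ k` is implied). -/
def faaDiBrunoSum (j : Tier) (r s : ℝ) (k : ℕ) : ℝ :=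
  ∑ i ∈ (Fintype.piFinset fun _ : Fin k => Finset.range (k + 1)).filter
      (fun i => ∑ n : Fin k, ((n : ℕ) + 1) * i n = k),
    (k.factorial : ℝ) /
        (∏ n : Fin k, (((n : ℕ) + 1).factorial : ℝ) ^ i n * ((i n).factorial : ℝ)) *
      ∏ n : Fin k, q.derivE j r s ((n : ℕ) + 1) ^ i n

end NetParams

/-- A two-tier network around the typical user at the origin. The base stations of the tiers form
independent homogeneous Poisson processes; base station `i` of tier `j` sits at `pos j i`, and its
channel power is `h j i ∼ Γ(Δ_j, 1)` if it serves the user and `g j i ∼ Γ(Ψ_j, 1)` if it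
interferes. The fading of distinct base stations is independent, and independent of the positions
(no assumption is made on the joint law of `h j i` and `g j i` for the same base station). -/
structure TwoTierNetwork (q : NetParams) {Ω : Type*} [MeasurableSpace Ω] (μ : Measure Ω) where
  pos : Tier → ℕ → Ω → EuclideanSpace ℝ (Fin 2)
  h : Tier → ℕ → Ω → ℝ
  g : Tier → ℕ → Ω → ℝ
  measurable_h : ∀ j i, Measurable (h j i)
  measurable_g : ∀ j i, Measurable (g j i)
  isPPP : ∀ j, IsHomogeneousPPP (q.lam j) (pos j) μ
  h_law : ∀ j i, μ.map (h j i) = gammaMeasure (q.Δ j) 1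
  g_law : ∀ j i, μ.map (g j i) = gammaMeasure (q.users j) 1
  indep_tiers : IndepFun (fun ω i => pos .mbs i ω) (fun ω i => pos .sbs i ω) μ
  indep_fading : iIndepFun (fun (b : Tier × ℕ) ω => (h b.1 b.2 ω, g b.1 b.2 ω)) μ
  indep_pos_fading : IndepFun (fun ω (b : Tier × ℕ) => pos b.1 b.2 ω)
    (fun ω (b : Tier × ℕ) => (h b.1 b.2 ω, g b.1 b.2 ω)) μ

namespace TwoTierNetwork

variable {q : NetParams} {Ω : Type*} [MeasurableSpace Ω] {μ : Measure Ω}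
  (net : TwoTierNetwork q μ)

/-- Biased average received power `B_j Δ_j p_j ‖x‖^{-α}`. -/
def biasedPower (j : Tier) (i : ℕ) (ω : Ω) : ℝ :=
  q.bias j * q.Δ j * q.power j * ‖net.pos j i ω‖ ^ (-q.α)

/-- Base station `i` of tier `j` serves the typical user: it has the largest biased average
received power among all base stations of both tiers. -/
def IsServing (j : Tier) (i : ℕ) (ω : Ω) : Prop :=
  ∀ (l : Tier) (k : ℕ), net.biasedPower l k ω ≤ net.biasedPower j i ω

/-- Interfering power received from base station `i` of tier `j`. -/
def interferingPower (j : Tier) (i : ℕ) (ω : Ω) : ℝ≥0∞ :=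
  ENNReal.ofReal (q.power j * net.g j i ω * ‖net.pos j i ω‖ ^ (-q.α))

/-- SINR of the typical user if it is served by base station `i` of tier `j`. -/
def sinr (j : Tier) (i : ℕ) (ω : Ω) : ℝ≥0∞ :=
  ENNReal.ofReal (q.power j * net.h j i ω * ‖net.pos j i ω‖ ^ (-q.α)) /
    ((∑' b : {b : Tier × ℕ // b ≠ (j, i)}, net.interferingPower b.1.1 b.1.2 ω) +
      ENNReal.ofReal q.noise)

/-- The typical user is associated with a base station of tier `j`. -/
def assocEvent (j : Tier) : Set Ω := {ω | ∃ i, net.IsServing j i ω}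

/-- The serving base station belongs to tier `j` and is at distance greater than `r`. -/
def servedBeyond (j : Tier) (r : ℝ) : Set Ω :=
  {ω | ∃ i, net.IsServing j i ω ∧ r < ‖net.pos j i ω‖}

/-- The serving base station belongs to tier `j` and the SINR exceeds the threshold `T`. -/
def coverEvent (j : Tier) (T : ℝ) : Set Ω :=
  {ω | ∃ i, net.IsServing j i ω ∧ ENNReal.ofReal T < net.sinr j i ω}

/-- Coverage probability of a user associated with tier `j`. -/
def coverageProb (j : Tier) (T : ℝ) : ℝ := (μ[|net.assocEvent j]).real (net.coverEvent j T)

/-- Overall coverage probability: the SINR from the serving base station, whatever its tier,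
exceeds `T`. -/
def overallCoverageProb (T : ℝ) : ℝ :=
  μ.real {ω | ∃ j i, net.IsServing j i ω ∧ ENNReal.ofReal T < net.sinr j i ω}

/-- Aggregate interference when tier `j` serves from distance `r`: all base stations of both
tiers outside the exclusion discs contribute. -/
def interference (j : Tier) (r : ℝ) (ω : Ω) : ℝ≥0∞ :=
  ∑' b : Tier × ℕ, if q.exclusionRadius j b.1 r < ‖net.pos b.1 b.2 ω‖ then
    net.interferingPower b.1 b.2 ω else 0

/-- Laplace transform of the aggregate interference. -/
def laplace (j : Tier) (r s : ℝ) : ℝ :=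
  ∫ ω, Real.exp (-s * (net.interference j r ω).toReal) ∂μ

/-- `e^{-sN}` times the Laplace transform of the interference. -/
def laplaceIN (j : Tier) (r s : ℝ) : ℝ :=
  Real.exp (-s * q.noise) * net.laplace j r s

/-- `∑_{k=0}^{Δ_j - 1} (1/k!) (-s)^k (d^k/ds^k) (e^{-sN} L(s))` at `s = T r^α / p_j`; the
derivatives are taken with `r` fixed. -/
def conditionalCoverage (j : Tier) (T r : ℝ) : ℝ :=
  ∑ k ∈ Finset.range (q.Δ j), 1 / (k.factorial : ℝ) *
    (-((q.power j)⁻¹ * T * r ^ q.α)) ^ k *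
    iteratedDeriv k (net.laplaceIN j r) ((q.power j)⁻¹ * T * r ^ q.α)

end TwoTierNetwork

end

/-! Fix the serving tier $j$, the serving distance $r$, all positions and the interfering channels.
The serving channel $h$ is still $\Gamma(\Delta_j,1)$, and coverage says $h>s(I+N)$ with
$s=Tr^\alpha/p_j$. Since $\Delta_j$ is an integer, this has probability
$e^{-s(I+N)}\sum_{k<\Delta_j}(s(I+N))^k/k!$. In expectation the $k$-th summand is $(-s)^k/k!$ times
the $k$-th derivative of $\mathbb E[e^{-s(I+N)}]$ (`integral_gammaTail`). What remains is the joint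
law of tier and serving distance, the transform of $I$, and the fact that fixing $j$ and $r$ does
not alter the law of the interference from beyond the exclusion radii.

All of this rests on the Laplace functional of the Poisson process, derived from the counts in
`IsHomogeneousPPP.laplaceFunctional` and joined with the fading in
`TwoTierNetwork.laplaceFunctional`. It is proved for functions with values in $[0,\infty]$: the
value $\infty$ on a disc encodes that the disc is empty. Hence `setLIntegral_voidEvent` computes
$\mathbb E[e^{-sI};\text{discs empty}]$ at once, and the answer factors.

The interference must be evaluated at the random distance $R$ of the nearest station. Conditioning
on the null event $R=r$ is avoided: `integral_eval_randomRadius` rounds $R$ up to a grid, uses the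
factorization on each cell, and refines the grid by right-continuity. `integral_farEvent_nearest`
then produces the serving density, and `measureReal_coverEvent` sums over the possible serving
stations.

For the closed forms, the substitution $t=1/(1+sp_lv^{-\alpha})$ turns the radial integrals and
their $s$-derivatives into incomplete Beta integrals (`exponent_eq_laplaceC`,
`exponentDeriv_succ_eq`), and `iteratedDeriv_of_eventuallyEq_exp` passes from the exponent to its
exponential. Ties are null: within a tier by `ae_norm_ne`, across tiers because the probabilities of
strict association already sum to 1. -/

open Filter Topology

/-! ### The extended exponential and the Poisson generating function -/

/-- The function `e^{-x}` on `[0, ∞]`, with `e^{-∞} = 0`. -/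
noncomputable def expNeg (x : ℝ≥0∞) : ℝ≥0∞ := EReal.exp (-(x : EReal))

@[simp] lemma expNeg_zero : expNeg 0 = 1 := by simp [expNeg]

@[simp] lemma expNeg_top : expNeg ∞ = 0 := by simp [expNeg]

lemma expNeg_add (x y : ℝ≥0∞) : expNeg (x + y) = expNeg x * expNeg y := by
  unfold expNeg
  rw [EReal.coe_ennreal_add, EReal.neg_add (.inl (EReal.coe_ennreal_ne_bot _))
    (.inr (EReal.coe_ennreal_ne_bot _)), sub_eq_add_neg, EReal.exp_add]

lemma expNeg_ofReal {x : ℝ} (hx : 0 ≤ x) :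
    expNeg (ENNReal.ofReal x) = ENNReal.ofReal (Real.exp (-x)) := by
  simp only [expNeg, EReal.coe_ennreal_ofReal, max_eq_left hx]
  rw [← EReal.coe_neg, EReal.exp_coe]

lemma expNeg_of_ne_top {x : ℝ≥0∞} (hx : x ≠ ∞) :
    expNeg x = ENNReal.ofReal (Real.exp (-x.toReal)) := by
  rw [← expNeg_ofReal ENNReal.toReal_nonneg, ENNReal.ofReal_toReal hx]

lemma continuous_expNeg : Continuous expNeg :=
  ENNReal.continuous_exp.comp (continuous_neg.comp continuous_coe_ennreal_ereal)

@[fun_prop] lemma measurable_expNeg : Measurable expNeg := continuous_expNeg.measurable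

lemma antitone_expNeg : Antitone expNeg := fun x y h => by
  unfold expNeg
  rw [EReal.exp_le_exp_iff, EReal.neg_le_neg_iff]
  exact_mod_cast h

lemma expNeg_le_one (x : ℝ≥0∞) : expNeg x ≤ 1 := by
  simpa using antitone_expNeg (zero_le : 0 ≤ x)

lemma expNeg_ne_top (x : ℝ≥0∞) : expNeg x ≠ ∞ := ((expNeg_le_one x).trans_lt (by simp)).ne

lemma expNeg_eq_zero {x : ℝ≥0∞} : expNeg x = 0 ↔ x = ∞ := by
  simp [expNeg, EReal.neg_eq_bot_iff]

lemma expNeg_sum {ι : Type*} (s : Finset ι) (f : ι → ℝ≥0∞) :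
    expNeg (∑ i ∈ s, f i) = ∏ i ∈ s, expNeg (f i) := by
  classical
  induction s using Finset.induction_on with
  | empty => simp
  | insert a s ha ih => rw [Finset.sum_insert ha, Finset.prod_insert ha, expNeg_add, ih]

lemma expNeg_natCast_mul (k : ℕ) (c : ℝ≥0∞) : expNeg (c * k) = expNeg c ^ k := by
  induction k with
  | zero => simp
  | succ k ih => rw [Nat.cast_succ, mul_add, expNeg_add, ih, mul_one, pow_succ]

/-- Dominated convergence with bound 1. The filter is general because the limit is taken along
sequences and also along finite sets of base stations. -/
lemma tendsto_lintegral_expNeg {Ω ι : Type*} [MeasurableSpace Ω] {μ : Measure Ω}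
    [IsFiniteMeasure μ] {l : Filter ι} [l.IsCountablyGenerated] {F : ι → Ω → ℝ≥0∞} {f : Ω → ℝ≥0∞}
    (hF : ∀ i, Measurable (F i)) (h : ∀ ω, Tendsto (fun i => F i ω) l (𝓝 (f ω))) :
    Tendsto (fun i => ∫⁻ ω, expNeg (F i ω) ∂μ) l (𝓝 (∫⁻ ω, expNeg (f ω) ∂μ)) := by
  refine tendsto_lintegral_filter_of_dominated_convergence (fun _ => 1)
    (.of_forall fun i => measurable_expNeg.comp (hF i))
    (.of_forall fun i => .of_forall fun ω => expNeg_le_one _) (by simp)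
    (.of_forall fun ω => (continuous_expNeg.tendsto _).comp (h ω))

/-- The probability generating function of the Poisson distribution. -/
lemma lintegral_expNeg_poissonMeasure (r : ℝ≥0) (c : ℝ≥0∞) :
    ∫⁻ k, expNeg (c * k) ∂poissonMeasure r = expNeg (r * (1 - expNeg c)) := by
  rw [lintegral_countable']
  have hz : expNeg c ≠ ∞ := expNeg_ne_top c
  set z := (expNeg c).toReal with hzdef
  have hz0 : 0 ≤ z := ENNReal.toReal_nonneg
  have hz1 : z ≤ 1 := by
    simpa using ENNReal.toReal_mono (by simp) (expNeg_le_one c)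
  have hzc : expNeg c = ENNReal.ofReal z := (ENNReal.ofReal_toReal hz).symm
  have h1 : ∀ k : ℕ, expNeg (c * k) * poissonMeasure r {k} =
      ENNReal.ofReal (Real.exp (-r) * ((r * z) ^ k / k.factorial)) := fun k => by
    rw [expNeg_natCast_mul, poissonMeasure_singleton, hzc, ← ENNReal.ofReal_pow hz0,
      ← ENNReal.ofReal_mul (by positivity)]
    congr 1
    rw [mul_pow]; ring
  simp_rw [h1]
  have hs : HasSum (fun k : ℕ => (r * z) ^ k / (k.factorial : ℝ)) (Real.exp (r * z)) := by
    rw [Real.exp_eq_exp_ℝ]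
    exact NormedSpace.expSeries_div_hasSum_exp _
  rw [← ENNReal.ofReal_tsum_of_nonneg (fun k => by positivity) (hs.mul_left _).summable,
    (hs.mul_left _).tsum_eq, ← Real.exp_add, hzc, ← ENNReal.ofReal_one, ← ENNReal.ofReal_sub _ hz0,
    ← ENNReal.ofReal_coe_nnreal, ← ENNReal.ofReal_mul (by positivity),
    expNeg_ofReal (mul_nonneg (by positivity) (by linarith))]
  congr 2; ring

/-! ### Point counts and the Laplace functional of a homogeneous Poisson process -/

/-- The plane. -/
abbrev Plane := EuclideanSpace ℝ (Fin 2)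

/-- The number of the points `x n` in the set `A`. -/
noncomputable def count {E : Type*} (x : ℕ → E) (A : Set E) : ℝ≥0∞ :=
  ∑' n, A.indicator (fun _ => 1) (x n)

lemma count_eq_encard {E : Type*} (x : ℕ → E) (A : Set E) :
    count x A = ({n | x n ∈ A}.encard : ℝ≥0∞) := by
  rw [← ENNReal.tsum_set_one, tsum_subtype (f := fun _ => (1 : ℝ≥0∞))]
  rfl

lemma count_eq_natCast {E : Type*} {x : ℕ → E} {A : Set E} {k : ℕ} :
    count x A = k ↔ {n | x n ∈ A}.encard = (k : ℕ∞) := by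
  rw [count_eq_encard]
  norm_cast

lemma measurable_count {Ω E : Type*} [MeasurableSpace Ω] [MeasurableSpace E] {X : ℕ → Ω → E}
    (hX : ∀ n, Measurable (X n)) {A : Set E} (hA : MeasurableSet A) :
    Measurable fun ω => count (fun n => X n ω) A :=
  Measurable.tsum fun n => (measurable_const.indicator hA).comp (hX n)

lemma lintegral_pi_poissonMeasure {ι : Type*} [Fintype ι] (r : ι → ℝ≥0) (c : ι → ℝ≥0∞) :
    ∫⁻ k, expNeg (∑ i, c i * (k i : ℝ≥0∞)) ∂Measure.pi (fun i => poissonMeasure (r i)) =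
      expNeg (∑ i, r i * (1 - expNeg (c i))) := by
  simp_rw [expNeg_sum]
  have hind := iIndepFun_pi (μ := fun i => poissonMeasure (r i))
    (X := fun i (k : ℕ) => expNeg (c i * k)) (fun i => Measurable.of_discrete.aemeasurable)
  have hm : ∀ i, Measurable fun k : ι → ℕ => expNeg (c i * (k i : ℝ≥0∞)) := fun i =>
    (Measurable.of_discrete (f := fun k : ℕ => expNeg (c i * k))).comp (measurable_pi_apply i)
  rw [lintegral_prod_eq_prod_lintegral_of_indepFun Finset.univ _ hind hm]
  refine Finset.prod_congr rfl fun i _ => ?_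
  rw [← lintegral_expNeg_poissonMeasure]
  exact (measurePreserving_eval (fun i => poissonMeasure (r i)) i).lintegral_comp
    (Measurable.of_discrete (f := fun k : ℕ => expNeg (c i * k)))

namespace IsHomogeneousPPP

variable {Ω : Type*} [MeasurableSpace Ω] {μ : Measure Ω} {lam : ℝ} {X : ℕ → Ω → Plane}

/-- Reindexes `counts` by an arbitrary finite type and reads the product of Poisson weights as a
point mass of the product measure. -/
lemma counts_fintype (hX : IsHomogeneousPPP lam X μ) {ι : Type*} [Fintype ι] (A : ι → Set Plane)
    (hA : ∀ i, MeasurableSet (A i)) (hfin : ∀ i, volume (A i) ≠ ∞)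
    (hdisj : Pairwise fun i i' => Disjoint (A i) (A i')) (k : ι → ℕ) :
    μ {ω | ∀ i, count (fun n => X n ω) (A i) = k i} =
      Measure.pi (fun i => poissonMeasure (lam.toNNReal * (volume (A i)).toNNReal)) {k} := by
  classical
  let e := Fintype.equivFin ι
  have h := hX.counts (Fintype.card ι) (A ∘ e.symm) (k ∘ e.symm) (fun i => hA _) (fun i => hfin _)
    (fun i j hij => hdisj (e.symm.injective.ne hij))
  rw [Measure.pi_singleton, ← e.symm.prod_comp]
  refine Eq.trans ?_ h
  congr 1
  ext ω
  simp only [count_eq_natCast, Set.mem_ofPred_eq, Function.comp]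
  exact ⟨fun h i => h _, fun h i => by simpa using h (e i)⟩

/-- Counts take values in $[0,\infty]$, but almost surely they are finite: the events are disjoint
and their probabilities are the point masses of a probability measure on a countable space. -/
lemma ae_exists_count (hX : IsHomogeneousPPP lam X μ) [IsProbabilityMeasure μ]
    {ι : Type*} [Fintype ι] (A : ι → Set Plane)
    (hA : ∀ i, MeasurableSet (A i)) (hfin : ∀ i, volume (A i) ≠ ∞)
    (hdisj : Pairwise fun i i' => Disjoint (A i) (A i')) :
    (∀ k : ι → ℕ, MeasurableSet {ω | ∀ i, count (fun n => X n ω) (A i) = k i}) ∧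
    (Pairwise fun k k' : ι → ℕ => Disjoint {ω | ∀ i, count (fun n => X n ω) (A i) = k i}
      {ω | ∀ i, count (fun n => X n ω) (A i) = k' i}) ∧
    ∀ᵐ ω ∂μ, ω ∈ ⋃ k : ι → ℕ, {ω | ∀ i, count (fun n => X n ω) (A i) = k i} := by
  have hm : ∀ k : ι → ℕ, MeasurableSet {ω | ∀ i, count (fun n => X n ω) (A i) = k i} := fun k => by
    rw [Set.ofPred_forall]
    exact MeasurableSet.iInter fun i =>
      measurable_count hX.measurable (hA i) (measurableSet_singleton _)
  have hd : Pairwise fun k k' : ι → ℕ => Disjoint {ω | ∀ i, count (fun n => X n ω) (A i) = k i}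
      {ω | ∀ i, count (fun n => X n ω) (A i) = k' i} := fun k k' hk => by
    refine Set.disjoint_left.2 fun ω h1 h2 => ?_
    refine hk (funext fun i => ?_)
    exact_mod_cast (h1 i).symm.trans (h2 i)
  refine ⟨hm, hd, ?_⟩
  refine (mem_ae_iff_prob_eq_one (MeasurableSet.iUnion hm)).2 ?_
  rw [measure_iUnion hd hm]
  simp_rw [hX.counts_fintype A hA hfin hdisj]
  -- The total mass 1, written as the sum of the point masses.
  have := lintegral_countable' (μ := Measure.pi
    (fun i => poissonMeasure (lam.toNNReal * (volume (A i)).toNNReal))) (fun _ => 1)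
  simpa using this.symm

/-- Up to a null set, $\Omega$ is a countable union of events on which the counts are constant;
hence `F` need not be measurable. -/
lemma lintegral_counts (hX : IsHomogeneousPPP lam X μ) [IsProbabilityMeasure μ]
    {ι : Type*} [Fintype ι] (A : ι → Set Plane)
    (hA : ∀ i, MeasurableSet (A i)) (hfin : ∀ i, volume (A i) ≠ ∞)
    (hdisj : Pairwise fun i i' => Disjoint (A i) (A i')) (F : (ι → ℝ≥0∞) → ℝ≥0∞) :
    ∫⁻ ω, F (fun i => count (fun n => X n ω) (A i)) ∂μ =
      ∫⁻ k, F (fun i => k i)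
        ∂Measure.pi (fun i => poissonMeasure (lam.toNNReal * (volume (A i)).toNNReal)) := by
  obtain ⟨hm, hd, hae⟩ := hX.ae_exists_count A hA hfin hdisj
  rw [← setLIntegral_univ, ← setLIntegral_congr (s := ⋃ k : ι → ℕ,
    {ω | ∀ i, count (fun n => X n ω) (A i) = k i}) (by
      rw [eventuallyEq_univ]; exact hae), lintegral_iUnion hm hd, lintegral_countable']
  refine tsum_congr fun k => ?_
  rw [← hX.counts_fintype A hA hfin hdisj k, ← setLIntegral_const]
  refine setLIntegral_congr_fun (hm k) fun ω hω => ?_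
  exact congrArg F (funext hω)

/-- The law of the number of points in a set of finite area. -/
lemma lintegral_count (hX : IsHomogeneousPPP lam X μ) [IsProbabilityMeasure μ] {A : Set Plane}
    (hA : MeasurableSet A) (hfin : volume A ≠ ∞) (F : ℝ≥0∞ → ℝ≥0∞) :
    ∫⁻ ω, F (count (fun n => X n ω) A) ∂μ =
      ∫⁻ k, F k ∂poissonMeasure (lam.toNNReal * (volume A).toNNReal) := by
  rw [hX.lintegral_counts (fun _ : Unit => A) (fun _ => hA) (fun _ => hfin)
    (fun i j h => (h rfl).elim) (fun c => F (c ()))]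
  exact (measurePreserving_eval (fun _ : Unit => poissonMeasure
    (lam.toNNReal * (volume A).toNNReal)) ()).lintegral_comp
    (Measurable.of_discrete (f := fun k : ℕ => F k))

/-- The level sets of `f` are disjoint, so the sum over the points is a linear combination of
independent Poisson counts. -/
lemma laplaceFunctional_simpleFunc (hX : IsHomogeneousPPP lam X μ) [IsProbabilityMeasure μ]
    (f : SimpleFunc Plane ℝ≥0∞) (hf : f.FinMeasSupp volume) :
    ∫⁻ ω, expNeg (∑' n, f (X n ω)) ∂μ =
      expNeg (ENNReal.ofReal lam * ∫⁻ x, (1 - expNeg (f x))) := by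
  classical
  -- The level set of 0 has infinite area; it is left out, and contributes nothing to either side.
  set ι := {c // c ∈ f.range.erase 0}
  have hfin : ∀ c : ι, volume (f ⁻¹' {c.1}) ≠ ∞ := fun c =>
    (hf.meas_preimage_singleton_ne_zero (Finset.ne_of_mem_erase c.2)).ne
  have h1 : ∀ x, f x = ∑ c : ι, c.1 * (f ⁻¹' {c.1}).indicator (fun _ => 1) x := fun x => by
    rw [Finset.sum_coe_sort (f.range.erase 0)
      (fun c => c * (f ⁻¹' {c}).indicator (fun _ => (1 : ℝ≥0∞)) x)]
    rw [Finset.sum_erase _ (by simp), Finset.sum_eq_single (f x)]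
    · simp
    · intro c _ hc
      rw [Set.indicator_of_notMem (by simpa using hc.symm), mul_zero]
    · intro h; exact (h (f.mem_range_self x)).elim
  have h2 : ∀ ω, ∑' n, f (X n ω) = ∑ c : ι, c.1 * count (fun n => X n ω) (f ⁻¹' {c.1}) := fun ω => by
    simp_rw [h1, count, ← ENNReal.tsum_mul_left]
    exact Summable.tsum_finsetSum fun _ _ => ENNReal.summable
  simp_rw [h2]
  rw [hX.lintegral_counts (fun c : ι => f ⁻¹' {c.1}) (fun c => f.measurableSet_fiber _) hfin
    (fun c d h => Disjoint.preimage _ (Set.disjoint_singleton.2 fun h' => h (Subtype.ext h')))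
    (fun k => expNeg (∑ c, c.1 * k c)), lintegral_pi_poissonMeasure]
  congr 1
  have h3 : ∫⁻ x, (1 - expNeg (f x)) = ∑ c ∈ f.range, (1 - expNeg c) * volume (f ⁻¹' {c}) := by
    rw [← SimpleFunc.map_lintegral, ← SimpleFunc.lintegral_eq_lintegral]
    rfl
  rw [h3, ← Finset.sum_erase f.range (a := 0) (by simp), ← Finset.sum_coe_sort (f.range.erase 0), Finset.mul_sum]
  refine Finset.sum_congr rfl fun c _ => ?_
  rw [ENNReal.coe_mul, ENNReal.coe_toNNReal (hfin c), ENNReal.ofReal]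
  ring

/-- The Laplace functional of a homogeneous Poisson point process. -/
theorem laplaceFunctional (hX : IsHomogeneousPPP lam X μ) [IsProbabilityMeasure μ]
    {f : Plane → ℝ≥0∞} (hf : Measurable f) :
    ∫⁻ ω, expNeg (∑' n, f (X n ω)) ∂μ =
      expNeg (ENNReal.ofReal lam * ∫⁻ x, (1 - expNeg (f x))) := by
  set B : ℕ → Set Plane := fun n => Metric.ball 0 n
  have hB : ∀ n, MeasurableSet (B n) := fun n => measurableSet_ball
  -- Cutting off to growing balls gives supports of finite area and keeps the monotone convergence
  -- to `f`.
  set F : ℕ → SimpleFunc Plane ℝ≥0∞ := fun n => (SimpleFunc.eapprox f n).restrict (B n)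
  have hFapp : ∀ n x, F n x = (B n).indicator (SimpleFunc.eapprox f n) x := fun n x =>
    SimpleFunc.restrict_apply _ (hB n) x
  have hFs : ∀ n, (F n).FinMeasSupp volume := fun n => by
    rw [SimpleFunc.finMeasSupp_iff_support]
    refine (measure_mono ?_).trans_lt (measure_ball_lt_top (x := (0 : Plane)) (r := n))
    intro x hx
    by_contra h
    exact hx (by rw [hFapp, Set.indicator_of_notMem h])
  have hmono : ∀ x, Monotone fun n => F n x := fun x m n hmn => by
    simp only [hFapp]
    by_cases h : x ∈ B m
    · rw [Set.indicator_of_mem h, Set.indicator_of_mem (Metric.ball_subset_ball (by exact_mod_cast hmn) h)]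
      exact SimpleFunc.monotone_eapprox f hmn x
    · rw [Set.indicator_of_notMem h]; exact zero_le
  have htend : ∀ x, Tendsto (fun n => F n x) atTop (𝓝 (f x)) := fun x => by
    refine (SimpleFunc.tendsto_eapprox hf x).congr' ?_
    obtain ⟨N, hN⟩ := exists_nat_gt ‖x‖
    filter_upwards [eventually_ge_atTop N] with n hn
    rw [hFapp, Set.indicator_of_mem]
    simp only [B, Metric.mem_ball, dist_zero_right]
    exact hN.trans_le (by exact_mod_cast hn)
  have hL : Tendsto (fun n => ∫⁻ ω, expNeg (∑' k, F n (X k ω)) ∂μ) atTop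
      (𝓝 (∫⁻ ω, expNeg (∑' k, f (X k ω)) ∂μ)) := by
    refine tendsto_lintegral_expNeg
      (fun n => Measurable.tsum fun k => (F n).measurable.comp (hX.measurable k))
      fun ω => ?_
    -- Series become integrals over the counting measure, to which monotone convergence applies.
    simp_rw [← MeasureTheory.lintegral_count (fun k => f (X k ω)), ← MeasureTheory.lintegral_count (fun k => F _ (X k ω))]
    exact lintegral_tendsto_of_tendsto_of_monotone (fun n => Measurable.of_discrete.aemeasurable)
      (.of_forall fun k => hmono _) (.of_forall fun k => htend _)
  have hR : Tendsto (fun n => expNeg (ENNReal.ofReal lam * ∫⁻ x, (1 - expNeg (F n x)))) atTop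
      (𝓝 (expNeg (ENNReal.ofReal lam * ∫⁻ x, (1 - expNeg (f x))))) := by
    refine (continuous_expNeg.tendsto _).comp
      (ENNReal.Tendsto.const_mul ?_ (.inr ENNReal.ofReal_ne_top))
    refine lintegral_tendsto_of_tendsto_of_monotone
      (fun n => (measurable_const.sub (measurable_expNeg.comp (F n).measurable)).aemeasurable)
      (.of_forall fun x m n hmn => tsub_le_tsub_left (antitone_expNeg (hmono x hmn)) _)
      (.of_forall fun x => ?_)
    exact ENNReal.Tendsto.sub tendsto_const_nhds ((continuous_expNeg.tendsto _).comp (htend x))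
      (.inl (by simp))
  refine tendsto_nhds_unique hL (hR.congr fun n => ?_)
  exact (hX.laplaceFunctional_simpleFunc (F n) (hFs n)).symm

end IsHomogeneousPPP

/-! ### The gamma distribution with integer shape -/

/-- Exponential tilting: $e^{-xy}$ times the $\Gamma(k,1)$ density is $(1+y)^{-k}$ times the
$\Gamma(k,1+y)$ density. The value is kept in the form `expNeg` of a logarithm, so that products
over the stations become sums over the points. -/
lemma lintegral_expNeg_gammaMeasure {k : ℕ} (hk : 0 < k) {y : ℝ} (hy : 0 ≤ y) :
    ∫⁻ x, expNeg (ENNReal.ofReal (x * y)) ∂gammaMeasure k 1 =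
      expNeg (ENNReal.ofReal (k * Real.log (1 + y))) := by
  have hk' : (0 : ℝ) < k := by exact_mod_cast hk
  have hy1 : 0 < 1 + y := by linarith
  have hm : ∀ a r : ℝ, Measurable (gammaPDF a r) := fun a r =>
    (measurable_gammaPDFReal a r).ennreal_ofReal
  rw [gammaMeasure, lintegral_withDensity_eq_lintegral_mul₀ (hm _ _).aemeasurable (by fun_prop)]
  have h : ∀ x, (gammaPDF k 1 * fun x => expNeg (ENNReal.ofReal (x * y))) x =
      ENNReal.ofReal ((1 + y) ^ (-(k : ℝ))) * gammaPDF k (1 + y) x := fun x => by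
    rcases lt_or_ge x 0 with hx | hx
    · simp [gammaPDF_of_neg hx]
    · simp only [Pi.mul_apply]
      rw [gammaPDF_of_nonneg hx, gammaPDF_of_nonneg hx, expNeg_ofReal (mul_nonneg hx hy),
        ← ENNReal.ofReal_mul (by positivity), ← ENNReal.ofReal_mul (by positivity)]
      congr 1
      rw [Real.rpow_neg hy1.le, show -((1 + y) * x) = -(1 * x) + -(x * y) by ring, Real.exp_add]
      have := (Real.rpow_pos_of_pos hy1 (k : ℝ)).ne'
      simp only [Real.one_rpow]
      field_simp
  simp_rw [h]
  rw [lintegral_const_mul _ (hm _ _),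
    lintegral_gammaPDF_eq_one hk' hy1, mul_one,
    expNeg_ofReal (mul_nonneg hk'.le (Real.log_nonneg (by linarith))), Real.rpow_def_of_pos hy1]
  congr 2; ring

/-- The tail `P(h > x)` of the distribution `Γ(k, 1)`. -/
noncomputable def gammaTail (k : ℕ) (x : ℝ) : ℝ :=
  Real.exp (-x) * ∑ i ∈ Finset.range k, x ^ i / (i.factorial : ℝ)

lemma gammaTail_nonneg (k : ℕ) {x : ℝ} (hx : 0 ≤ x) : 0 ≤ gammaTail k x := by
  unfold gammaTail; positivity

lemma gammaTail_le_one (k : ℕ) {x : ℝ} (hx : 0 ≤ x) : gammaTail k x ≤ 1 := by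
  have h := Real.sum_le_exp_of_nonneg hx k
  calc gammaTail k x ≤ Real.exp (-x) * Real.exp x := by unfold gammaTail; gcongr
    _ = 1 := by rw [← Real.exp_add]; simp

lemma continuous_gammaTail (k : ℕ) : Continuous (gammaTail k) := by
  unfold gammaTail; fun_prop

/-- The product rule telescopes, and only the top term survives: minus the density of
$\Gamma(k+1,1)$. -/
lemma hasDerivAt_gammaTail (k : ℕ) (x : ℝ) :
    HasDerivAt (gammaTail (k + 1)) (-(Real.exp (-x) * (x ^ k / (k.factorial : ℝ)))) x := by
  have he : HasDerivAt (fun x : ℝ => Real.exp (-x)) (-Real.exp (-x)) x := by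
    simpa using (hasDerivAt_neg x).exp
  induction k with
  | zero =>
    have : gammaTail 1 = fun x => Real.exp (-x) := by ext; simp [gammaTail]
    simpa [this] using he
  | succ k ih =>
    have h1 : gammaTail (k + 1 + 1) = fun x => gammaTail (k + 1) x +
        Real.exp (-x) * (x ^ (k + 1) / ((k + 1).factorial : ℝ)) := by
      ext x; simp only [gammaTail]; rw [Finset.sum_range_succ, mul_add]
    rw [h1]
    refine (ih.add (he.mul ((hasDerivAt_pow (k + 1) x).div_const _))).congr_deriv ?_
    rw [Nat.factorial_succ]
    push_cast
    have : (k.factorial : ℝ) ≠ 0 := by positivity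
    field_simp
    ring

lemma tendsto_gammaTail (k : ℕ) : Tendsto (gammaTail k) atTop (𝓝 0) := by
  have : ∀ i : ℕ, Tendsto (fun x : ℝ => x ^ i * Real.exp (-x) / (i.factorial : ℝ)) atTop (𝓝 0) := fun i => by
    simpa using (Real.tendsto_pow_mul_exp_neg_atTop_nhds_zero i).div_const (i.factorial : ℝ)
  have h := tendsto_finsetSum (Finset.range k) fun i _ => this i
  simp only [Finset.sum_const_zero] at h
  refine h.congr fun x => ?_
  rw [gammaTail, Finset.mul_sum]
  exact Finset.sum_congr rfl fun i _ => by ring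

/-- `-gammaTail` is an antiderivative of the density and vanishes at infinity. -/
lemma gammaMeasure_Ioi {k : ℕ} (hk : 0 < k) {x : ℝ} (hx : 0 ≤ x) :
    gammaMeasure k 1 (Set.Ioi x) = ENNReal.ofReal (gammaTail k x) := by
  obtain ⟨k, rfl⟩ : ∃ m, k = m + 1 := ⟨k - 1, by omega⟩
  rw [gammaMeasure, withDensity_apply _ measurableSet_Ioi]
  have h1 : ∀ t ∈ Set.Ioi x, gammaPDF ((k + 1 : ℕ) : ℝ) 1 t =
      ENNReal.ofReal (Real.exp (-t) * (t ^ k / (k.factorial : ℝ))) := fun t ht => by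
    rw [gammaPDF_of_nonneg (hx.trans (le_of_lt ht))]
    congr 1
    push_cast
    rw [add_sub_cancel_right, Real.rpow_natCast, Real.Gamma_nat_eq_factorial, Real.one_rpow, one_mul]
    ring
  rw [setLIntegral_congr_fun measurableSet_Ioi h1]
  have hd : ∀ t ∈ Set.Ici x, HasDerivAt (fun t => -gammaTail (k + 1) t)
      (Real.exp (-t) * (t ^ k / (k.factorial : ℝ))) t := fun t _ => by
    simpa using (hasDerivAt_gammaTail k t).fun_neg
  have hpos : ∀ t ∈ Set.Ioi x, 0 ≤ Real.exp (-t) * (t ^ k / (k.factorial : ℝ)) := fun t ht => by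
    have : 0 ≤ t := hx.trans (le_of_lt ht)
    positivity
  have ht : Tendsto (fun t => -gammaTail (k + 1) t) atTop (𝓝 0) := by
    simpa using (tendsto_gammaTail (k + 1)).neg
  rw [← ofReal_integral_eq_lintegral_ofReal (integrableOn_Ioi_deriv_of_nonneg' hd hpos ht)
    ((ae_restrict_mem measurableSet_Ioi).mono hpos),
    integral_Ioi_of_hasDerivAt_of_nonneg' hd hpos ht]
  simp

/-! ### Independence -/

/-- Tonelli for the product law. This is the form in which one freezes `X` and averages over `Y`. -/
lemma ProbabilityTheory.IndepFun.lintegral_comp {Ω α β : Type*} [MeasurableSpace Ω]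
    [MeasurableSpace α] [MeasurableSpace β] {μ : Measure Ω} [IsProbabilityMeasure μ] {X : Ω → α}
    {Y : Ω → β} (h : IndepFun X Y μ) (hX : Measurable X) (hY : Measurable Y)
    {Φ : α → β → ℝ≥0∞} (hΦ : Measurable (Function.uncurry Φ)) :
    ∫⁻ ω, Φ (X ω) (Y ω) ∂μ = ∫⁻ ω, ∫⁻ ω', Φ (X ω) (Y ω') ∂μ ∂μ := by
  have h1 := (indepFun_iff_map_prod_eq_prod_map_map hX.aemeasurable hY.aemeasurable).1 h
  have : IsProbabilityMeasure (μ.map Y) := Measure.isProbabilityMeasure_map hY.aemeasurable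
  calc ∫⁻ ω, Φ (X ω) (Y ω) ∂μ = ∫⁻ z, Function.uncurry Φ z ∂μ.map (fun ω => (X ω, Y ω)) :=
        (lintegral_map hΦ (hX.prodMk hY)).symm
    _ = ∫⁻ x, ∫⁻ y, Φ x y ∂μ.map Y ∂μ.map X := by
        rw [h1, lintegral_prod _ hΦ.aemeasurable]; rfl
    _ = ∫⁻ ω, ∫⁻ y, Φ (X ω) y ∂μ.map Y ∂μ :=
        lintegral_map hΦ.lintegral_prod_right' hX
    _ = _ := lintegral_congr fun ω => lintegral_map (hΦ.comp measurable_prodMk_left) hY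

/-- If `X` is independent of `(Y, Z)` and `Y` is independent of `Z`, then `Y` is independent of
`(X, Z)`. -/
lemma ProbabilityTheory.IndepFun.prodMk_of_indepFun {Ω α β γ : Type*} [MeasurableSpace Ω]
    [MeasurableSpace α] [MeasurableSpace β] [MeasurableSpace γ] {μ : Measure Ω}
    [IsProbabilityMeasure μ] {X : Ω → α} {Y : Ω → β} {Z : Ω → γ}
    (hX : Measurable X) (hY : Measurable Y) (hZ : Measurable Z)
    (h : IndepFun X (fun ω => (Y ω, Z ω)) μ) (h' : IndepFun Y Z μ) :
    IndepFun Y (fun ω => (X ω, Z ω)) μ := by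
  have hXZ : IndepFun X Z μ := h.comp measurable_id measurable_snd
  have : IsProbabilityMeasure (μ.map X) := Measure.isProbabilityMeasure_map hX.aemeasurable
  have : IsProbabilityMeasure (μ.map Y) := Measure.isProbabilityMeasure_map hY.aemeasurable
  have : IsProbabilityMeasure (μ.map Z) := Measure.isProbabilityMeasure_map hZ.aemeasurable
  rw [indepFun_iff_map_prod_eq_prod_map_map hY.aemeasurable (hX.prodMk hZ).aemeasurable,
    (indepFun_iff_map_prod_eq_prod_map_map hX.aemeasurable hZ.aemeasurable).1 hXZ]
  rw [indepFun_iff_map_prod_eq_prod_map_map hX.aemeasurable (hY.prodMk hZ).aemeasurable,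
    (indepFun_iff_map_prod_eq_prod_map_map hY.aemeasurable hZ.aemeasurable).1 h'] at h
  refine Measure.ext_of_lintegral _ fun f hf => ?_
  have hm : Measurable fun p : α × β × γ => f (p.2.1, p.1, p.2.2) := by fun_prop
  -- The law of $(X,(Y,Z))$ is tested on `f` with its coordinates permuted; the rest is Tonelli.
  have e := congrArg (fun m => ∫⁻ p, f (p.2.1, p.1, p.2.2) ∂m) h
  rw [lintegral_map hm (by fun_prop), lintegral_prod _ hm.aemeasurable] at e
  rw [lintegral_map hf (by fun_prop), e, lintegral_prod _ hf.aemeasurable]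
  have h1 : ∀ x, ∫⁻ p : β × γ, f (p.1, x, p.2) ∂(μ.map Y).prod (μ.map Z) =
      ∫⁻ y, ∫⁻ z, f (y, x, z) ∂μ.map Z ∂μ.map Y := fun x =>
    lintegral_prod _ (by fun_prop)
  have h2 : ∀ y, ∫⁻ p : α × γ, f (y, p) ∂(μ.map X).prod (μ.map Z) =
      ∫⁻ x, ∫⁻ z, f (y, x, z) ∂μ.map Z ∂μ.map X := fun y =>
    lintegral_prod (fun p : α × γ => f (y, p)) (by fun_prop)
  simp_rw [h1, h2]
  refine lintegral_lintegral_swap (f := fun x y => ∫⁻ z, f (y, x, z) ∂μ.map Z) ?_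
  exact (Measurable.lintegral_prod_right' (f := fun q : (α × β) × γ => f (q.1.2, q.1.1, q.2))
    (by fun_prop)).aemeasurable

/-! ### The joint Laplace functional of positions and fading -/

namespace TwoTierNetwork

variable {q : NetParams} {Ω : Type*} [MeasurableSpace Ω] {μ : Measure Ω}
  (net : TwoTierNetwork q μ)

lemma measurable_pos (j : Tier) (i : ℕ) : Measurable (net.pos j i) := (net.isPPP j).measurable i

/-- The positions are frozen in `F` and `y`. For finitely many stations independence factors the
expectation; the infinite sum is the limit along finite sets. -/
lemma lintegral_fading [IsProbabilityMeasure μ] (F : Tier × ℕ → ℝ≥0∞) {y : Tier × ℕ → ℝ}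
    (hy : ∀ b, 0 ≤ y b) :
    ∫⁻ ω, expNeg (∑' b : Tier × ℕ, (F b + ENNReal.ofReal (net.g b.1 b.2 ω * y b))) ∂μ =
      expNeg (∑' b : Tier × ℕ, (F b + ENNReal.ofReal (q.users b.1 * Real.log (1 + y b)))) := by
  have hm : ∀ b : Tier × ℕ, Measurable fun ω => F b + ENNReal.ofReal (net.g b.1 b.2 ω * y b) :=
    fun b => by have := net.measurable_g b.1 b.2; fun_prop
  have h1 : ∀ S : Finset (Tier × ℕ),
      ∫⁻ ω, expNeg (∑ b ∈ S, (F b + ENNReal.ofReal (net.g b.1 b.2 ω * y b))) ∂μ =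
      expNeg (∑ b ∈ S, (F b + ENNReal.ofReal (q.users b.1 * Real.log (1 + y b)))) := fun S => by
    simp_rw [expNeg_sum]
    have hind := net.indep_fading.comp (fun b (z : ℝ × ℝ) => expNeg (F b + ENNReal.ofReal (z.2 * y b)))
      (fun b => by fun_prop)
    rw [lintegral_prod_eq_prod_lintegral_of_indepFun S
      (fun b ω => expNeg (F b + ENNReal.ofReal (net.g b.1 b.2 ω * y b))) hind (fun b => measurable_expNeg.comp (hm b))]
    refine Finset.prod_congr rfl fun b _ => ?_
    rw [expNeg_add, ← lintegral_expNeg_gammaMeasure (q.users_pos b.1) (hy b), ← net.g_law b.1 b.2,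
      lintegral_map (by fun_prop) (net.measurable_g _ _)]
    simp only [expNeg_add]
    rw [lintegral_const_mul _ (by have := net.measurable_g b.1 b.2; fun_prop)]
  refine tendsto_nhds_unique (tendsto_lintegral_expNeg (l := atTop)
    (fun S : Finset (Tier × ℕ) => Finset.measurable_sum S fun b _ => hm b)
    fun ω => ENNReal.summable.hasSum) ?_
  simp_rw [h1]
  exact (continuous_expNeg.tendsto _).comp ENNReal.summable.hasSum

/-- The joint Laplace functional of the positions and the interfering channels. -/
theorem laplaceFunctional [IsProbabilityMeasure μ] {F : Tier → Plane → ℝ≥0∞}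
    (hF : ∀ l, Measurable (F l)) {W : Tier → Plane → ℝ} (hW : ∀ l, Measurable (W l))
    (hW0 : ∀ l x, 0 ≤ W l x) :
    ∫⁻ ω, expNeg (∑' b : Tier × ℕ, (F b.1 (net.pos b.1 b.2 ω) +
        ENNReal.ofReal (net.g b.1 b.2 ω * W b.1 (net.pos b.1 b.2 ω)))) ∂μ =
      ∏ l, expNeg (ENNReal.ofReal (q.lam l) *
        ∫⁻ x, (1 - expNeg (F l x + ENNReal.ofReal (q.users l * Real.log (1 + W l x))))) := by
  have hpm : Measurable fun ω (b : Tier × ℕ) => net.pos b.1 b.2 ω :=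
    measurable_pi_lambda _ fun b => net.measurable_pos _ _
  have hfm : Measurable fun ω (b : Tier × ℕ) => (net.h b.1 b.2 ω, net.g b.1 b.2 ω) :=
    measurable_pi_lambda _ fun b => (net.measurable_h _ _).prodMk (net.measurable_g _ _)
  -- The fading is averaged out with the positions held fixed.
  have h1 := net.indep_pos_fading.lintegral_comp hpm hfm
    (Φ := fun p z => expNeg (∑' b : Tier × ℕ, (F b.1 (p b) + ENNReal.ofReal ((z b).2 * W b.1 (p b)))))
    (by
      refine measurable_expNeg.comp (Measurable.tsum fun b => ?_)
      have := hF b.1; have := hW b.1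
      fun_prop)
  rw [h1]
  simp only
  simp_rw [net.lintegral_fading (fun b => F b.1 (net.pos b.1 b.2 _))
    (y := fun b => W b.1 (net.pos b.1 b.2 _)) (fun b => hW0 _ _)]
  -- After this averaging each station carries a deterministic function of its position, and the
  -- Poisson functional applies to each tier.
  set f : Tier → Plane → ℝ≥0∞ := fun l x => F l x + ENNReal.ofReal (q.users l * Real.log (1 + W l x))
    with hf
  have hfmeas : ∀ l, Measurable (f l) := fun l => by
    have := hF l; have := hW l
    simp only [hf]; fun_prop
  have h2 : ∀ ω, expNeg (∑' b : Tier × ℕ, f b.1 (net.pos b.1 b.2 ω)) =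
      expNeg (∑' i, f .mbs (net.pos .mbs i ω)) * expNeg (∑' i, f .sbs (net.pos .sbs i ω)) := fun ω => by
    rw [ENNReal.summable.tsum_prod' fun _ => ENNReal.summable, tsum_fintype]
    have : (Finset.univ : Finset Tier) = {Tier.mbs, Tier.sbs} := rfl
    rw [this, Finset.sum_pair (by simp), expNeg_add]
  have h3 : (Finset.univ : Finset Tier) = {Tier.mbs, Tier.sbs} := rfl
  rw [h3, Finset.prod_pair (by simp), ← (net.isPPP .mbs).laplaceFunctional (hfmeas _),
    ← (net.isPPP .sbs).laplaceFunctional (hfmeas _), lintegral_congr h2]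
  have hm : ∀ l, Measurable fun x : ℕ → Plane => expNeg (∑' i, f l (x i)) := fun l => by
    refine measurable_expNeg.comp (Measurable.tsum fun b => ?_)
    have := hfmeas l
    fun_prop
  have hp : ∀ l, Measurable fun ω i => net.pos l i ω :=
    fun l => measurable_pi_lambda _ fun i => net.measurable_pos _ _
  exact lintegral_mul_eq_lintegral_mul_lintegral_of_indepFun'' ((hm .mbs).comp (hp .mbs)).aemeasurable
    ((hm .sbs).comp (hp .sbs)).aemeasurable (net.indep_tiers.comp (hm _) (hm _))

end TwoTierNetwork

/-! ### Integrals of radial functions -/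

/-- Polar coordinates; $2\pi$ is the dimension times the area of the unit disc. -/
lemma lintegral_radial {φ : ℝ → ℝ} {ρ : ℝ} (hρ : 0 ≤ ρ) (h0 : ∀ v, ρ < v → 0 ≤ φ v)
    (hi : IntegrableOn (fun v => v * φ v) (Set.Ioi ρ)) :
    ∫⁻ x : Plane, (if ρ < ‖x‖ then ENNReal.ofReal (φ ‖x‖) else 0) =
      ENNReal.ofReal (2 * Real.pi * ∫ v in Set.Ioi ρ, v * φ v) := by
  have hdim : Module.finrank ℝ Plane = 2 := by simp
  have hmul : (fun v => v ^ (Module.finrank ℝ Plane - 1) • (Set.Ioi ρ).indicator φ v) =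
      (Set.Ioi ρ).indicator fun v => v * φ v := by
    ext v
    rw [hdim]
    simp [Set.indicator_apply]
  have hsub : Set.Ioi ρ ∩ Set.Ioi 0 = Set.Ioi ρ := by
    ext v; simp; intro h; linarith
  have hint : Integrable (fun x : Plane => (Set.Ioi ρ).indicator φ ‖x‖) := by
    rw [integrable_fun_norm_addHaar, hmul, IntegrableOn, integrable_indicator_iff measurableSet_Ioi,
      IntegrableOn, Measure.restrict_restrict measurableSet_Ioi, hsub]
    exact hi
  have hnn : ∀ x : Plane, 0 ≤ (Set.Ioi ρ).indicator φ ‖x‖ := fun x =>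
    Set.indicator_nonneg (fun v hv => h0 v hv) _
  have e : ∀ x : Plane, (if ρ < ‖x‖ then ENNReal.ofReal (φ ‖x‖) else 0) =
      ENNReal.ofReal ((Set.Ioi ρ).indicator φ ‖x‖) := fun x => by
    simp only [Set.indicator_apply, Set.mem_Ioi]
    split_ifs <;> simp
  simp_rw [e]
  rw [← ofReal_integral_eq_lintegral_ofReal hint (.of_forall hnn), integral_fun_norm_addHaar, hmul,
    hdim, integral_indicator measurableSet_Ioi, Measure.restrict_restrict measurableSet_Ioi, hsub,
    measureReal_def, EuclideanSpace.volume_ball_fin_two]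
  congr 1
  simp [Real.pi_pos.le]
  ring

/-- Bernoulli's inequality for the $n$-th power of $(1+x)^{-1}$, followed by $1-(1+x)^{-1}\le x$. -/
lemma one_sub_inv_pow_le {x : ℝ} (hx : 0 ≤ x) (n : ℕ) : 1 - ((1 + x) ^ n)⁻¹ ≤ n * x := by
  have h1 : 0 < 1 + x := by linarith
  have h := one_add_mul_le_pow (a := (1 + x)⁻¹ - 1) (by have := inv_pos.2 h1; linarith) n
  rw [add_sub_cancel, inv_pow] at h
  have h2 : 1 - (1 + x)⁻¹ ≤ x := by
    have : 1 - x ≤ (1 + x)⁻¹ := by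
      rw [← one_div, le_div_iff₀ h1]; nlinarith
    linarith
  have := mul_le_mul_of_nonneg_left h2 (Nat.cast_nonneg (α := ℝ) n)
  linarith

/-! ### The Laplace exponent of the interference from outside a disc -/

namespace NetParams

variable (q : NetParams)

/-- The Laplace transform at `s` of the power received from an interferer at distance `v`. -/
noncomputable def fade (l : Tier) (s v : ℝ) : ℝ :=
  ((1 + s * q.power l * v ^ (-q.α)) ^ q.users l)⁻¹

/-- The area, with multiplicity `1 - fade`, of the complement of a disc of radius `ρ`. -/
noncomputable def exponent (l : Tier) (ρ s : ℝ) : ℝ :=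
  2 * Real.pi * ∫ v in Set.Ioi ρ, v * (1 - q.fade l s v)

variable {q}

lemma gain_nonneg (l : Tier) {s v : ℝ} (hs : 0 ≤ s) (hv : 0 ≤ v) :
    0 ≤ s * q.power l * v ^ (-q.α) :=
  mul_nonneg (mul_nonneg hs (q.power_pos l).le) (Real.rpow_nonneg hv _)

lemma one_sub_fade_nonneg (l : Tier) {s v : ℝ} (hs : 0 ≤ s) (hv : 0 ≤ v) :
    0 ≤ 1 - q.fade l s v := by
  have h := gain_nonneg (q := q) l hs hv
  rw [fade, sub_nonneg]
  exact inv_le_one_of_one_le₀ (one_le_pow₀ (by linarith))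

/-- The majorant $v^{1-\alpha}$ is integrable at infinity because $\alpha>2$. -/
lemma mul_one_sub_fade_le (l : Tier) {s v : ℝ} (hs : 0 ≤ s) (hv : 0 < v) :
    v * (1 - q.fade l s v) ≤ q.users l * q.power l * s * v ^ (1 - q.α) := by
  have h := one_sub_inv_pow_le (gain_nonneg (q := q) l hs hv.le) (q.users l)
  calc v * (1 - q.fade l s v) ≤ v * (q.users l * (s * q.power l * v ^ (-q.α))) :=
        mul_le_mul_of_nonneg_left h hv.le
    _ = _ := by rw [sub_eq_add_neg, Real.rpow_add hv, Real.rpow_one]; ring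

lemma integrableOn_rpow_Ioi {ρ : ℝ} (hρ : 0 < ρ) :
    IntegrableOn (fun v : ℝ => v ^ (1 - q.α)) (Set.Ioi ρ) :=
  integrableOn_Ioi_rpow_of_lt (by linarith [q.two_lt_α]) hρ

lemma integrableOn_one_sub_fade (l : Tier) {ρ s : ℝ} (hρ : 0 < ρ) (hs : 0 ≤ s) :
    IntegrableOn (fun v => v * (1 - q.fade l s v)) (Set.Ioi ρ) := by
  refine Integrable.mono' ((integrableOn_rpow_Ioi (q := q) hρ).const_mul
    (q.users l * q.power l * s)) ?_ ?_
  · have : Measurable fun v => v * (1 - q.fade l s v) := by unfold fade; fun_prop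
    exact this.aestronglyMeasurable
  · filter_upwards [ae_restrict_mem measurableSet_Ioi] with v hv
    have hv0 : 0 < v := hρ.trans hv
    rw [Real.norm_of_nonneg (mul_nonneg hv0.le (one_sub_fade_nonneg l hs hv0.le))]
    exact mul_one_sub_fade_le l hs hv0

lemma exponent_nonneg (l : Tier) {ρ s : ℝ} (hρ : 0 < ρ) (hs : 0 ≤ s) : 0 ≤ q.exponent l ρ s := by
  refine mul_nonneg (by positivity) (setIntegral_nonneg measurableSet_Ioi fun v hv => ?_)
  have hv0 : 0 < v := hρ.trans hv
  exact mul_nonneg hv0.le (one_sub_fade_nonneg l hs hv0.le)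

lemma exponent_le (l : Tier) {ρ s : ℝ} (hρ : 0 < ρ) (hs : 0 ≤ s) :
    q.exponent l ρ s ≤ 2 * Real.pi * (q.users l * q.power l * s *
      ∫ v in Set.Ioi ρ, v ^ (1 - q.α)) := by
  unfold exponent
  rw [← integral_const_mul (q.users l * q.power l * s)]
  refine mul_le_mul_of_nonneg_left (setIntegral_mono_on (integrableOn_one_sub_fade l hρ hs)
    ((integrableOn_rpow_Ioi hρ).const_mul _) measurableSet_Ioi fun v hv => ?_) (by positivity)
  exact mul_one_sub_fade_le l hs (hρ.trans hv)

lemma exponent_zero (l : Tier) (ρ : ℝ) : q.exponent l ρ 0 = 0 := by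
  simp [exponent, fade]

/-- Serves to show that the interference is almost surely finite. -/
lemma tendsto_exponent (l : Tier) {ρ : ℝ} (hρ : 0 < ρ) :
    Tendsto (q.exponent l ρ) (𝓝[>] 0) (𝓝 0) := by
  have h : Tendsto (fun s => 2 * Real.pi * (q.users l * q.power l * s *
      ∫ v in Set.Ioi ρ, v ^ (1 - q.α))) (𝓝[>] 0) (𝓝 0) := by
    refine tendsto_nhdsWithin_of_tendsto_nhds ?_
    have : Continuous fun s : ℝ => 2 * Real.pi * (q.users l * q.power l * s *
      ∫ v in Set.Ioi ρ, v ^ (1 - q.α)) := by fun_prop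
    simpa using this.tendsto 0
  refine squeeze_zero' ?_ ?_ h
  · filter_upwards [self_mem_nhdsWithin] with s hs using exponent_nonneg l hρ (le_of_lt hs)
  · filter_upwards [self_mem_nhdsWithin] with s hs using exponent_le l hρ (le_of_lt hs)

end NetParams

/-! ### Void events, interference from outside discs, and almost sure regularity -/

namespace TwoTierNetwork

variable {q : NetParams} {Ω : Type*} [MeasurableSpace Ω] {μ : Measure Ω}
  (net : TwoTierNetwork q μ)

/-- The power received from the base stations of the tiers `l` outside the discs of radii `ρ l`. -/
noncomputable def outside (ρ : Tier → ℝ) (ω : Ω) : ℝ≥0∞ :=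
  ∑' b : Tier × ℕ, if ρ b.1 < ‖net.pos b.1 b.2 ω‖ then net.interferingPower b.1 b.2 ω else 0

/-- The tiers `l` have no base stations in the closed discs of radii `a l`. -/
def voidEvent (a : Tier → ℝ) : Set Ω := {ω | ∀ l i, a l < ‖net.pos l i ω‖}

lemma measurable_norm_pos (l : Tier) (i : ℕ) : Measurable fun ω => ‖net.pos l i ω‖ :=
  (net.measurable_pos l i).norm

lemma measurable_interferingPower (l : Tier) (i : ℕ) : Measurable (net.interferingPower l i) := by
  have := net.measurable_g l i
  have := net.measurable_norm_pos l i
  unfold interferingPower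
  fun_prop

lemma measurable_outside (ρ : Tier → ℝ) : Measurable (net.outside ρ) :=
  Measurable.tsum fun _ => Measurable.ite
    (measurableSet_lt measurable_const (net.measurable_norm_pos _ _))
    (net.measurable_interferingPower _ _) measurable_const

lemma measurableSet_voidEvent (a : Tier → ℝ) : MeasurableSet (net.voidEvent a) := by
  simp only [voidEvent, Set.ofPred_forall]
  exact MeasurableSet.iInter fun l => MeasurableSet.iInter fun i =>
    measurableSet_lt measurable_const (net.measurable_norm_pos _ _)

/-- The weight $\infty$ on the closed discs of radii `a l` kills every configuration with a station
there, so one Laplace functional covers the void event and the interference together. As `a l ≤ ρ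
l`, the empty discs and the interfering region are disjoint; the exponent is therefore a sum, which
means independence. -/
theorem setLIntegral_voidEvent [IsProbabilityMeasure μ] {ρ a : Tier → ℝ} (ha : ∀ l, 0 ≤ a l)
    (haρ : ∀ l, a l ≤ ρ l) (hρ : ∀ l, 0 < ρ l) {s : ℝ} (hs : 0 ≤ s) :
    ∫⁻ ω in net.voidEvent a, expNeg (ENNReal.ofReal s * net.outside ρ ω) ∂μ =
      ∏ l, ENNReal.ofReal
        (Real.exp (-(q.lam l * (Real.pi * a l ^ 2 + q.exponent l (ρ l) s)))) := by
  set F : Tier → Plane → ℝ≥0∞ := fun l x => if a l < ‖x‖ then 0 else ∞ with hF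
  set W : Tier → Plane → ℝ := fun l x => if ρ l < ‖x‖ then s * q.power l * ‖x‖ ^ (-q.α) else 0 with hW
  have hFm : ∀ l, Measurable (F l) := fun l =>
    Measurable.ite (measurableSet_lt measurable_const measurable_norm) measurable_const
      measurable_const
  have hWm : ∀ l, Measurable (W l) := fun l =>
    Measurable.ite (measurableSet_lt measurable_const measurable_norm) (by fun_prop)
      measurable_const
  have hW0 : ∀ l x, 0 ≤ W l x := fun l x => by
    simp only [hW]
    split_ifs
    · exact NetParams.gain_nonneg l hs (norm_nonneg x)
    · exact le_rfl
  have key := net.laplaceFunctional hFm hWm hW0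
  have h1 : ∀ ω, (net.voidEvent a).indicator
      (fun ω => expNeg (ENNReal.ofReal s * net.outside ρ ω)) ω =
      expNeg (∑' b : Tier × ℕ, (F b.1 (net.pos b.1 b.2 ω) +
        ENNReal.ofReal (net.g b.1 b.2 ω * W b.1 (net.pos b.1 b.2 ω)))) := fun ω => by
    by_cases hω : ω ∈ net.voidEvent a
    · rw [Set.indicator_of_mem hω, outside, ← ENNReal.tsum_mul_left]
      congr 1
      refine tsum_congr fun b => ?_
      have hb : a b.1 < ‖net.pos b.1 b.2 ω‖ := hω b.1 b.2
      simp only [hF, hW, if_pos hb, zero_add]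
      split_ifs
      · rw [interferingPower, ← ENNReal.ofReal_mul hs]
        congr 1; ring
      · simp
    · rw [Set.indicator_of_notMem hω]
      symm
      rw [expNeg_eq_zero]
      obtain ⟨l, i, hli⟩ : ∃ l i, ¬ a l < ‖net.pos l i ω‖ := by
        by_contra! h
        exact hω fun l i => h l i
      refine ENNReal.tsum_eq_top_of_eq_top ⟨(l, i), ?_⟩
      simp [hF, hli]
  rw [← lintegral_indicator (net.measurableSet_voidEvent a), lintegral_congr h1, key]
  refine Finset.prod_congr rfl fun l _ => ?_
  -- The integrand is 1 on the empty disc, $1-$`fade` beyond `ρ l`, and 0 in the annulus between.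
  have h2 : ∀ x : Plane, 1 - expNeg (F l x + ENNReal.ofReal (q.users l * Real.log (1 + W l x))) =
      (Metric.closedBall (0 : Plane) (a l)).indicator (fun _ => 1) x +
        if ρ l < ‖x‖ then ENNReal.ofReal (1 - q.fade l s ‖x‖) else 0 := fun x => by
    by_cases hx : a l < ‖x‖
    · have hx' : x ∉ Metric.closedBall (0 : Plane) (a l) := by simpa using hx
      have hpos : 0 < 1 + W l x := by linarith [hW0 l x]
      rw [Set.indicator_of_notMem hx', zero_add]
      simp only [hF, if_pos hx, zero_add]
      rw [expNeg_ofReal (mul_nonneg (Nat.cast_nonneg _) (Real.log_nonneg (by linarith [hW0 l x]))),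
        ← mul_neg, Real.exp_nat_mul, Real.exp_neg, Real.exp_log hpos, ← ENNReal.ofReal_one,
        ← ENNReal.ofReal_sub _ (by positivity), inv_pow]
      simp only [hW]
      split_ifs with h
      · rfl
      · simp
    · have hx' : x ∈ Metric.closedBall (0 : Plane) (a l) := by simpa using hx
      have hx2 : ¬ ρ l < ‖x‖ := fun h => hx ((haρ l).trans_lt h)
      rw [Set.indicator_of_mem hx', if_neg hx2]
      simp [hF, hx]
  have h3 : ∫⁻ x : Plane, (1 - expNeg (F l x + ENNReal.ofReal (q.users l * Real.log (1 + W l x)))) =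
      ENNReal.ofReal (Real.pi * a l ^ 2 + q.exponent l (ρ l) s) := by
    rw [lintegral_congr h2, lintegral_add_left (measurable_const.indicator measurableSet_closedBall),
      lintegral_radial (φ := fun v => 1 - q.fade l s v) (hρ l).le
        (fun v hv => NetParams.one_sub_fade_nonneg l hs ((hρ l).trans hv).le)
        (NetParams.integrableOn_one_sub_fade l (hρ l) hs),
      lintegral_indicator_const measurableSet_closedBall, EuclideanSpace.volume_closedBall_fin_two,
      ENNReal.ofReal_add (by positivity) (NetParams.exponent_nonneg l (hρ l) hs),
      ENNReal.ofReal_mul Real.pi_pos.le, ENNReal.ofReal_pow (ha l), one_mul, mul_comm]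
    rfl
  rw [h3, ← ENNReal.ofReal_mul (q.lam_pos l).le, expNeg_ofReal
    (mul_nonneg (q.lam_pos l).le (add_nonneg (by positivity)
      (NetParams.exponent_nonneg l (hρ l) hs)))]

lemma measure_voidEvent [IsProbabilityMeasure μ] {a : Tier → ℝ} (ha : ∀ l, 0 ≤ a l) :
    μ (net.voidEvent a) = ∏ l, ENNReal.ofReal (Real.exp (-(q.lam l * (Real.pi * a l ^ 2)))) := by
  -- At $s=0$ the interference drops out, so any positive radii above `a` will do.
  have h := net.setLIntegral_voidEvent (ρ := fun l => a l + 1) ha (fun l => by simp)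
    (fun l => by linarith [ha l]) le_rfl
  simpa [NetParams.exponent_zero] using h

/-- The void discs are closed, so radius 0 forbids exactly the origin. -/
lemma ae_pos_norm [IsProbabilityMeasure μ] : ∀ᵐ ω ∂μ, ∀ l i, 0 < ‖net.pos l i ω‖ := by
  refine (mem_ae_iff_prob_eq_one (net.measurableSet_voidEvent fun _ => 0)).2 ?_
  simp [net.measure_voidEvent (a := fun _ => 0) (fun _ => le_rfl)]

/-- Since $e^{-sI}$ vanishes where $I=\infty$, $\mathbb E[e^{-sI}]\le\mathbb P(I<\infty)$; the left
side tends to 1 as $s\downarrow0$. -/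
lemma ae_outside_ne_top_of_pos [IsProbabilityMeasure μ] {ρ : Tier → ℝ} (hρ : ∀ l, 0 < ρ l) :
    ∀ᵐ ω ∂μ, net.outside ρ ω ≠ ∞ := by
  have hms : MeasurableSet {ω | net.outside ρ ω ≠ ∞} :=
    (net.measurable_outside ρ) (measurableSet_singleton ∞).compl
  refine (mem_ae_iff_prob_eq_one hms).2 (le_antisymm prob_le_one ?_)
  have hlim : Tendsto (fun s => ∏ l, ENNReal.ofReal
      (Real.exp (-(q.lam l * (Real.pi * (0 : ℝ) ^ 2 + q.exponent l (ρ l) s))))) (𝓝[>] 0) (𝓝 1) := by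
    have : ∀ l ∈ (Finset.univ : Finset Tier), Tendsto (fun s => Real.exp
        (-(q.lam l * (Real.pi * (0 : ℝ) ^ 2 + q.exponent l (ρ l) s)))) (𝓝[>] 0) (𝓝 1) := fun l _ => by
      have h := (((NetParams.tendsto_exponent (q := q) l (hρ l)).const_add
        (Real.pi * (0 : ℝ) ^ 2)).const_mul (q.lam l)).neg.rexp
      rwa [show -(q.lam l * (Real.pi * (0 : ℝ) ^ 2 + 0)) = 0 by ring, Real.exp_zero] at h
    have h2 := ENNReal.tendsto_ofReal (tendsto_finsetProd _ this)
    simp only [Finset.prod_const_one, ENNReal.ofReal_one] at h2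
    refine h2.congr fun s => ENNReal.ofReal_prod_of_nonneg fun l _ => by positivity
  refine le_of_tendsto hlim ?_
  filter_upwards [self_mem_nhdsWithin] with s hs
  have hs' : 0 < s := hs
  rw [← net.setLIntegral_voidEvent (a := fun _ => 0) (fun _ => le_rfl) (fun l => (hρ l).le) hρ hs'.le,
    ← lintegral_indicator_one hms]
  refine (setLIntegral_le_lintegral _ _).trans (lintegral_mono fun ω => ?_)
  by_cases h : net.outside ρ ω = ∞
  · simp [h, ENNReal.mul_top, hs']
  · rw [Set.indicator_of_mem (by exact h)]
    exact expNeg_le_one _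

lemma outside_anti {ρ ρ' : Tier → ℝ} (h : ∀ l, ρ l ≤ ρ' l) (ω : Ω) :
    net.outside ρ' ω ≤ net.outside ρ ω := by
  refine ENNReal.tsum_le_tsum fun b => ?_
  by_cases hb : ρ' b.1 < ‖net.pos b.1 b.2 ω‖
  · rw [if_pos hb, if_pos ((h _).trans_lt hb)]
  · rw [if_neg hb]; exact zero_le

/-- One null set serves for all radii: the interference decreases in `ρ`, so the radii $1/(n+1)$
suffice. -/
lemma ae_outside_ne_top [IsProbabilityMeasure μ] :
    ∀ᵐ ω ∂μ, ∀ ρ : Tier → ℝ, (∀ l, 0 < ρ l) → net.outside ρ ω ≠ ∞ := by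
  have h : ∀ᵐ ω ∂μ, ∀ n : ℕ, net.outside (fun _ => 1 / ((n : ℝ) + 1)) ω ≠ ∞ :=
    ae_all_iff.2 fun n => net.ae_outside_ne_top_of_pos fun _ => Nat.one_div_pos_of_nat
  filter_upwards [h] with ω hω ρ hρ
  obtain ⟨n, hn⟩ := exists_nat_one_div_lt (lt_min (hρ .mbs) (hρ .sbs))
  refine ne_top_of_le_ne_top (hω n) (net.outside_anti (fun l => ?_) ω)
  rw [lt_min_iff] at hn
  cases l
  exacts [hn.1.le, hn.2.le]

lemma ae_finite_ball [IsProbabilityMeasure μ] :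
    ∀ᵐ ω ∂μ, ∀ (l : Tier) (M : ℝ), {i | ‖net.pos l i ω‖ ≤ M}.Finite := by
  have h : ∀ᵐ ω ∂μ, ∀ (l : Tier) (M : ℕ), {i | ‖net.pos l i ω‖ ≤ M}.Finite := by
    refine ae_all_iff.2 fun l => ae_all_iff.2 fun M => ?_
    filter_upwards [((net.isPPP l).ae_exists_count (fun _ : Unit => Metric.closedBall 0 M)
      (fun _ => measurableSet_closedBall) (fun _ => measure_closedBall_lt_top.ne)
      (fun i j h => (h rfl).elim)).2.2] with ω hω
    obtain ⟨k, hk⟩ := Set.mem_iUnion.1 hω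
    have := count_eq_natCast.1 (hk ())
    refine Set.finite_of_encard_eq_coe (k := k ()) ?_
    simpa using this
  filter_upwards [h] with ω hω l M
  obtain ⟨n, hn⟩ := exists_nat_ge M
  exact (hω l n).subset fun i hi => le_trans hi hn

end TwoTierNetwork

/-! ### Distinct distances -/

/-- $1-e^{-r}(1+r)\le1-(1-r)(1+r)=r^2$. The quadratic order is what lets the union bound in
`ae_norm_ne` tend to 0. -/
lemma poissonMeasure_two_le (r : ℝ≥0) :
    poissonMeasure r {k | 2 ≤ k} ≤ ENNReal.ofReal ((r : ℝ) ^ 2) := by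
  have h1 : {k : ℕ | 2 ≤ k} = ({0, 1} : Set ℕ)ᶜ := by
    ext k; simp; omega
  have h2 : (poissonMeasure r).real {0, 1} = Real.exp (-r) + Real.exp (-r) * r := by
    rw [show ({0, 1} : Set ℕ) = {0} ∪ {1} from rfl, measureReal_union (by simp) (by simp),
      poissonMeasure_real_singleton, poissonMeasure_real_singleton]
    simp
  rw [h1, ← ofReal_measureReal, probReal_compl_eq_one_sub (by simp), h2]
  refine ENNReal.ofReal_le_ofReal ?_
  have := Real.add_one_le_exp (-(r : ℝ))
  have h0 : (0 : ℝ) ≤ r := r.2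
  nlinarith

lemma two_le_count {E : Type*} {x : ℕ → E} {A : Set E} {i k : ℕ} (hik : i ≠ k) (hi : x i ∈ A)
    (hk : x k ∈ A) : 2 ≤ count x A := by
  refine le_trans ?_ (ENNReal.sum_le_tsum {i, k})
  rw [Finset.sum_pair hik, Set.indicator_of_mem hi, Set.indicator_of_mem hk]
  norm_num

/-- With square roots as radii, equal steps of the parameter give annuli of equal area. -/
lemma volume_annulus {a b : ℝ} (ha : 0 ≤ a) (hab : a ≤ b) :
    volume (Metric.ball (0 : Plane) (√b) \ Metric.ball 0 (√a)) =
      ENNReal.ofReal (Real.pi * (b - a)) := by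
  rw [measure_sdiff (Metric.ball_subset_ball (Real.sqrt_le_sqrt hab))
    measurableSet_ball.nullMeasurableSet measure_ball_lt_top.ne,
    EuclideanSpace.volume_ball_fin_two, EuclideanSpace.volume_ball_fin_two]
  have h : ∀ c : ℝ, 0 ≤ c → ENNReal.ofReal (√c) ^ 2 * ENNReal.ofReal Real.pi = ENNReal.ofReal (c * Real.pi) :=
    fun c hc => by
      rw [← ENNReal.ofReal_pow (Real.sqrt_nonneg c), Real.sq_sqrt hc, ENNReal.ofReal_mul hc]
  rw [h b (ha.trans hab), h a ha, ← ENNReal.ofReal_sub _ (by positivity)]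
  congr 1; ring

namespace IsHomogeneousPPP

variable {Ω : Type*} [MeasurableSpace Ω] {μ : Measure Ω} {lam : ℝ} {X : ℕ → Ω → Plane}

lemma measure_two_le_count (hX : IsHomogeneousPPP lam X μ) [IsProbabilityMeasure μ] {A : Set Plane}
    (hA : MeasurableSet A) (hfin : volume A ≠ ∞) :
    μ {ω | 2 ≤ count (fun n => X n ω) A} ≤
      ENNReal.ofReal ((lam.toNNReal * (volume A).toNNReal : ℝ≥0) ^ 2 : ℝ) := by
  refine le_trans (le_of_eq ?_) (poissonMeasure_two_le _)
  have h := hX.lintegral_count hA hfin ((Set.Ici 2).indicator fun _ => 1)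
  have h1 : (fun ω => (Set.Ici 2).indicator (fun _ => (1 : ℝ≥0∞)) (count (fun n => X n ω) A)) =
      {ω | 2 ≤ count (fun n => X n ω) A}.indicator 1 := rfl
  have h2 : (fun k : ℕ => (Set.Ici 2).indicator (fun _ => (1 : ℝ≥0∞)) (k : ℝ≥0∞)) =
      {k : ℕ | 2 ≤ k}.indicator 1 := by
    ext k
    have : (2 : ℝ≥0∞) ≤ k ↔ 2 ≤ k := by norm_cast
    simp [Set.indicator_apply, this]
  have hm : MeasurableSet {ω | 2 ≤ count (fun n => X n ω) A} :=
    measurableSet_le measurable_const (measurable_count hX.measurable hA)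
  rw [h1, h2, lintegral_indicator_one hm,
    lintegral_indicator_one (MeasurableSet.of_discrete)] at h
  exact h

/-- Almost surely, the points have distinct distances from the origin. -/
theorem ae_norm_ne (hX : IsHomogeneousPPP lam X μ) [IsProbabilityMeasure μ] (hlam : 0 ≤ lam) :
    ∀ᵐ ω ∂μ, ∀ i k, i ≠ k → ‖X i ω‖ ≠ ‖X k ω‖ := by
  have key : ∀ V : ℕ, μ {ω | ∃ i k, i ≠ k ∧ ‖X i ω‖ = ‖X k ω‖ ∧ ‖X i ω‖ ^ 2 < V} = 0 := fun V => by
    set C : ℝ := (lam * (Real.pi * V)) ^ 2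
    have hb : ∀ n : ℕ, μ {ω | ∃ i k, i ≠ k ∧ ‖X i ω‖ = ‖X k ω‖ ∧ ‖X i ω‖ ^ 2 < V} ≤
        ENNReal.ofReal (C * (1 / ((n : ℝ) + 1))) := fun n => by
      set m : ℝ := (n : ℝ) + 1
      have hm : 0 < m := by positivity
      -- The disc of squared radius $V$ is cut into $m$ annuli of equal area. Two points at the same
      -- distance share an annulus, which for a given annulus has probability at most $C/m^2$; the
      -- union bound gives $C/m$.
      set A : ℕ → Set Plane := fun k =>
        Metric.ball (0 : Plane) (√(V * ((k : ℝ) + 1) / m)) \ Metric.ball 0 (√(V * k / m))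
      have hvol : ∀ k, volume (A k) = ENNReal.ofReal (Real.pi * (V / m)) := fun k => by
        rw [volume_annulus (by positivity) (by gcongr; linarith)]
        congr 1; field_simp; ring
      have hsub : {ω | ∃ i k, i ≠ k ∧ ‖X i ω‖ = ‖X k ω‖ ∧ ‖X i ω‖ ^ 2 < V} ⊆
          ⋃ k ∈ Finset.range (n + 1), {ω | 2 ≤ count (fun n => X n ω) (A k)} := by
        rintro ω ⟨i, k, hik, he, hV⟩
        have hVpos : (0 : ℝ) < V := lt_of_le_of_lt (by positivity) hV
        -- Squared distance in units of $V/m$; its integer part is the index of the annulus.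
        set t := ‖X i ω‖ ^ 2 * m / V with ht
        have ht0 : 0 ≤ t := by positivity
        have htm : t < m := by rw [ht, div_lt_iff₀ hVpos]; nlinarith
        have hmem : ∀ x : Plane, ‖x‖ = ‖X i ω‖ → x ∈ A ⌊t⌋₊ := fun x hx => by
          have h1 := Nat.floor_le ht0
          have h2 := Nat.lt_floor_add_one t
          have hn : ‖X i ω‖ ^ 2 = V * t / m := by rw [ht]; field_simp
          refine ⟨?_, ?_⟩
          · rw [mem_ball_zero_iff, hx]
            refine Real.lt_sqrt_of_sq_lt ?_
            rw [hn]; gcongr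
          · rw [mem_ball_zero_iff, hx, not_lt]
            refine Real.sqrt_le_iff.2 ⟨norm_nonneg _, ?_⟩
            rw [hn]; gcongr
        refine Set.mem_biUnion (x := ⌊t⌋₊) ?_ (two_le_count hik (hmem _ rfl) (hmem _ he.symm))
        simp only [Finset.coe_range, Set.mem_Iio]
        have : (⌊t⌋₊ : ℝ) < n + 1 := (Nat.floor_le ht0).trans_lt htm
        exact_mod_cast this
      refine (measure_mono hsub).trans ((measure_biUnion_finset_le _ _).trans ?_)
      have hk : ∀ k ∈ Finset.range (n + 1), μ {ω | 2 ≤ count (fun n => X n ω) (A k)} ≤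
          ENNReal.ofReal (C / m ^ 2) := fun k _ => by
        refine (hX.measure_two_le_count (measurableSet_ball.diff measurableSet_ball)
          (by rw [hvol]; exact ENNReal.ofReal_ne_top)).trans (le_of_eq ?_)
        rw [hvol, NNReal.coe_mul, Real.coe_toNNReal _ hlam, ENNReal.coe_toNNReal_eq_toReal,
          ENNReal.toReal_ofReal (by positivity)]
        congr 1
        simp only [C]
        field_simp
      refine (Finset.sum_le_sum hk).trans (le_of_eq ?_)
      rw [Finset.sum_const, Finset.card_range, nsmul_eq_mul, ← ENNReal.ofReal_natCast,
        ← ENNReal.ofReal_mul (by positivity)]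
      congr 1
      push_cast
      field_simp
      exact mul_comm _ _
    have hlim : Tendsto (fun n : ℕ => ENNReal.ofReal (C * (1 / ((n : ℝ) + 1)))) atTop (𝓝 0) := by
      have := ENNReal.tendsto_ofReal ((tendsto_one_div_add_atTop_nhds_zero_nat (𝕜 := ℝ)).const_mul C)
      simpa using this
    exact le_antisymm (ge_of_tendsto' hlim hb) zero_le
  have h0 : ∀ᵐ ω ∂μ, ∀ V : ℕ, ¬ ∃ i k, i ≠ k ∧ ‖X i ω‖ = ‖X k ω‖ ∧ ‖X i ω‖ ^ 2 < V :=
    ae_all_iff.2 fun V => by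
      rw [ae_iff]; simpa only [not_not] using key V
  filter_upwards [h0] with ω hω i k hik he
  obtain ⟨V, hV⟩ := exists_nat_gt (‖X i ω‖ ^ 2)
  exact hω V ⟨i, k, hik, he, hV⟩

end IsHomogeneousPPP

/-! ### Evaluating a random process at a random radius -/

/-- The point of the grid of mesh `1 / (m + 1)` next to the right of `x`. -/
noncomputable def gridCeil (m : ℕ) (x : ℝ) : ℝ := (⌈x * ((m : ℝ) + 1)⌉₊ : ℝ) / ((m : ℝ) + 1)

lemma le_gridCeil (m : ℕ) (x : ℝ) : x ≤ gridCeil m x := by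
  rw [gridCeil, le_div_iff₀ (by positivity)]
  exact Nat.le_ceil _

/-- The approach is from the right, since the processes evaluated at these points are only
right-continuous. -/
lemma tendsto_gridCeil {x : ℝ} (hx : 0 ≤ x) :
    Tendsto (fun m => gridCeil m x) atTop (𝓝[≥] x) := by
  refine tendsto_nhdsWithin_iff.2 ⟨?_, .of_forall fun m => le_gridCeil m x⟩
  have h : Tendsto (fun m : ℕ => x + 1 / ((m : ℝ) + 1)) atTop (𝓝 x) := by
    simpa using (tendsto_one_div_add_atTop_nhds_zero_nat (𝕜 := ℝ)).const_add x
  refine tendsto_of_tendsto_of_tendsto_of_le_of_le tendsto_const_nhds h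
    (fun m => le_gridCeil m x) fun m => ?_
  have hm : (0 : ℝ) < (m : ℝ) + 1 := by positivity
  rw [gridCeil, div_le_iff₀ hm, add_mul, one_div, inv_mul_cancel₀ hm.ne']
  exact (Nat.ceil_lt_add_one (by positivity)).le

/-- The cells of the grid of mesh `1 / (m + 1)`. -/
def gridCell (m k : ℕ) : Set ℝ := Set.Ioc ((k : ℝ) / ((m : ℝ) + 1)) (((k : ℝ) + 1) / ((m : ℝ) + 1))

lemma mem_gridCell_iff {m k : ℕ} {x : ℝ} : x ∈ gridCell m k ↔ ⌈x * ((m : ℝ) + 1)⌉₊ = k + 1 := by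
  have hm : (0 : ℝ) < (m : ℝ) + 1 := by positivity
  rw [Nat.ceil_eq_iff (by simp), gridCell, Set.mem_Ioc, div_lt_iff₀ hm, le_div_iff₀ hm]
  simp

lemma gridCeil_of_mem {m k : ℕ} {x : ℝ} (hx : x ∈ gridCell m k) :
    gridCeil m x = ((k : ℝ) + 1) / ((m : ℝ) + 1) := by
  rw [gridCeil, mem_gridCell_iff.1 hx]
  push_cast
  rfl

lemma pairwise_disjoint_gridCell (m : ℕ) : Pairwise fun k k' => Disjoint (gridCell m k) (gridCell m k') :=
  fun k k' h => Set.disjoint_left.2 fun x hx hx' => h (by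
    have := (mem_gridCell_iff.1 hx).symm.trans (mem_gridCell_iff.1 hx')
    omega)

lemma iUnion_gridCell (m : ℕ) : ⋃ k, gridCell m k = Set.Ioi 0 := by
  ext x
  have hm : (0 : ℝ) < (m : ℝ) + 1 := by positivity
  rw [Set.mem_iUnion, Set.mem_Ioi]
  constructor
  · rintro ⟨k, hk⟩
    exact lt_of_le_of_lt (by positivity) hk.1
  · intro hx
    have : 0 < ⌈x * ((m : ℝ) + 1)⌉₊ := Nat.ceil_pos.2 (by positivity)
    exact ⟨⌈x * ((m : ℝ) + 1)⌉₊ - 1, mem_gridCell_iff.2 (by omega)⟩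

lemma measurableSet_gridCell (m k : ℕ) : MeasurableSet (gridCell m k) := measurableSet_Ioc

lemma hasDerivAt_neg_exp_neg_mul_sq (c x : ℝ) :
    HasDerivAt (fun x => -Real.exp (-(c * x ^ 2))) (2 * c * x * Real.exp (-(c * x ^ 2))) x := by
  refine (((hasDerivAt_pow 2 x).const_mul c).neg.exp.neg).congr_deriv ?_
  simp; ring

lemma tendsto_neg_exp_neg_mul_sq {c : ℝ} (hc : 0 < c) :
    Tendsto (fun x => -Real.exp (-(c * x ^ 2))) atTop (𝓝 0) := by
  have : Tendsto (fun x : ℝ => c * x ^ 2) atTop atTop :=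
    (tendsto_pow_atTop (by norm_num)).const_mul_atTop hc
  simpa using (Real.tendsto_exp_neg_atTop_nhds_zero.comp this).neg

lemma integrableOn_mul_exp_neg_mul_sq {c a : ℝ} (hc : 0 < c) (ha : 0 ≤ a) :
    IntegrableOn (fun x => 2 * c * x * Real.exp (-(c * x ^ 2))) (Set.Ioi a) :=
  integrableOn_Ioi_deriv_of_nonneg' (fun x _ => hasDerivAt_neg_exp_neg_mul_sq c x)
    (fun x hx => by have : 0 < x := ha.trans_lt hx; positivity) (tendsto_neg_exp_neg_mul_sq hc)

lemma integral_Ioi_mul_exp_neg_mul_sq {c a : ℝ} (hc : 0 < c) (ha : 0 ≤ a) :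
    ∫ x in Set.Ioi a, 2 * c * x * Real.exp (-(c * x ^ 2)) = Real.exp (-(c * a ^ 2)) := by
  rw [integral_Ioi_of_hasDerivAt_of_nonneg' (fun x _ => hasDerivAt_neg_exp_neg_mul_sq c x)
    (fun x hx => by have : 0 < x := ha.trans_lt hx; positivity) (tendsto_neg_exp_neg_mul_sq hc)]
  simp

lemma integral_Ioc_mul_exp_neg_mul_sq (c : ℝ) {a b : ℝ} (hab : a ≤ b) :
    ∫ x in Set.Ioc a b, 2 * c * x * Real.exp (-(c * x ^ 2)) =
      Real.exp (-(c * a ^ 2)) - Real.exp (-(c * b ^ 2)) := by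
  rw [← intervalIntegral.integral_of_le hab, intervalIntegral.integral_eq_sub_of_hasDerivAt
    (fun x _ => hasDerivAt_neg_exp_neg_mul_sq c x)
    (Continuous.intervalIntegrable (by fun_prop) _ _)]
  ring

section RandomRadius

variable {Ω : Type*} [MeasurableSpace Ω] {μ : Measure Ω} [IsProbabilityMeasure μ] {R : Ω → ℝ}
  {c : ℝ} {K : ℝ → Ω → ℝ}

/-- Joint measurability of `K` is not assumed; the grid takes countably many values, so
measurability for each radius is enough. -/
lemma measurable_eval_gridCeil (hR : Measurable R) (hK : ∀ r, Measurable (K r)) (m : ℕ) :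
    Measurable fun ω => K (gridCeil m (R ω)) ω := by
  have h1 : Measurable fun p : ℕ × Ω => K ((p.1 : ℝ) / ((m : ℝ) + 1)) p.2 :=
    measurable_from_prod_countable_right fun k => hK ((k : ℝ) / ((m : ℝ) + 1))
  exact h1.comp ((Nat.measurable_ceil.comp (hR.mul_const _)).prodMk measurable_id)

/-- On the cell $(a,r]$ the process is evaluated at the right end $r$. Applying `h` to $\{a<R\}$ and
to $\{r<R\}$ and subtracting gives $(e^{-ca^2}-e^{-cr^2})\,\mathbb E[K_r]$, and the first factor is
the integral of $2cxe^{-cx^2}$ over the cell. -/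
lemma integral_eval_gridCeil (hR : Measurable R) (hR0 : ∀ᵐ ω ∂μ, 0 < R ω) (hc : 0 < c)
    (hK : ∀ r, Measurable (K r)) (hK1 : ∀ r ω, |K r ω| ≤ 1)
    (h : ∀ a r, 0 ≤ a → a ≤ r → 0 < r →
      ∫ ω in {ω | a < R ω}, K r ω ∂μ = Real.exp (-(c * a ^ 2)) * ∫ ω, K r ω ∂μ) (m : ℕ) :
    ∫ ω, K (gridCeil m (R ω)) ω ∂μ =
      ∫ r in Set.Ioi 0, 2 * c * r * Real.exp (-(c * r ^ 2)) * ∫ ω, K (gridCeil m r) ω ∂μ := by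
  have hm : (0 : ℝ) < (m : ℝ) + 1 := by positivity
  have hKi : ∀ r, Integrable (K r) μ := fun r =>
    Integrable.of_bound (hK r).aestronglyMeasurable 1 (.of_forall fun ω => hK1 r ω)
  have hint1 : Integrable (fun ω => K (gridCeil m (R ω)) ω) μ :=
    Integrable.of_bound (measurable_eval_gridCeil hR hK m).aestronglyMeasurable 1
      (.of_forall fun ω => hK1 _ ω)
  have hmeas2 : Measurable fun r => ∫ ω, K (gridCeil m r) ω ∂μ :=
    (Measurable.of_discrete (f := fun k : ℕ => ∫ ω, K ((k : ℝ) / ((m : ℝ) + 1)) ω ∂μ)).comp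
      (Nat.measurable_ceil.comp (measurable_id.mul_const _))
  have hbd : ∀ r, |∫ ω, K r ω ∂μ| ≤ 1 := fun r => by
    simpa using norm_integral_le_of_norm_le_const (μ := μ) (f := K r) (C := 1)
      (.of_forall fun ω => hK1 r ω)
  have hint2 : IntegrableOn (fun r => 2 * c * r * Real.exp (-(c * r ^ 2)) *
      ∫ ω, K (gridCeil m r) ω ∂μ) (Set.Ioi 0) :=
    Integrable.mul_bdd (c := 1) (integrableOn_mul_exp_neg_mul_sq hc le_rfl)
      hmeas2.aestronglyMeasurable (.of_forall fun r => hbd _)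
  have hpre : R ⁻¹' Set.Ioi 0 = ⋃ k, R ⁻¹' gridCell m k := by
    rw [← iUnion_gridCell m, Set.preimage_iUnion]
  have hae : (R ⁻¹' Set.Ioi 0 : Set Ω) =ᵐ[μ] Set.univ := eventuallyEq_univ.2 hR0
  rw [← setIntegral_univ, ← setIntegral_congr_set hae, hpre,
    integral_iUnion (fun k => hR (measurableSet_gridCell m k))
      (fun k k' hk => (pairwise_disjoint_gridCell m hk).preimage R) hint1.integrableOn,
    ← iUnion_gridCell m, integral_iUnion (measurableSet_gridCell m) (pairwise_disjoint_gridCell m)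
      (by rwa [iUnion_gridCell])]
  refine tsum_congr fun k => ?_
  set a : ℝ := (k : ℝ) / ((m : ℝ) + 1)
  set r : ℝ := ((k : ℝ) + 1) / ((m : ℝ) + 1)
  have ha : 0 ≤ a := by positivity
  have har : a ≤ r := by simp only [a, r]; gcongr; linarith
  have hr : 0 < r := by positivity
  have hset : R ⁻¹' gridCell m k = {ω | a < R ω} \ {ω | r < R ω} := by
    ext ω; simp [gridCell, a, r]
  rw [setIntegral_congr_fun (g := K r) (hR (measurableSet_gridCell m k))
    (fun ω hω => by simp only [gridCeil_of_mem (m := m) (k := k) hω]; rfl), hset,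
    setIntegral_sdiff (measurableSet_lt measurable_const hR) (hKi r).integrableOn
      (show {ω | r < R ω} ⊆ {ω | a < R ω} from fun ω (hω : r < R ω) => har.trans_lt hω), h a r ha har hr, h r r hr.le le_rfl hr,
    setIntegral_congr_fun (g := fun x => 2 * c * x * Real.exp (-(c * x ^ 2)) * ∫ ω, K r ω ∂μ)
      (measurableSet_gridCell m k) (fun x hx => by simp only [gridCeil_of_mem (m := m) (k := k) hx]; rfl),
    integral_mul_const, gridCell, integral_Ioc_mul_exp_neg_mul_sq c har]
  ring

/-- If the process `K` is right-continuous and `K r` does not depend on the event `a < R`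
for `a ≤ r`, then `K R` is obtained by integrating out `R`. -/
theorem integral_eval_randomRadius (hR : Measurable R) (hR0 : ∀ᵐ ω ∂μ, 0 < R ω) (hc : 0 < c)
    (hK : ∀ r, Measurable (K r)) (hK1 : ∀ r ω, |K r ω| ≤ 1)
    (hKc : ∀ᵐ ω ∂μ, ∀ r, 0 < r → ContinuousWithinAt (fun r => K r ω) (Set.Ici r) r)
    (h : ∀ a r, 0 ≤ a → a ≤ r → 0 < r →
      ∫ ω in {ω | a < R ω}, K r ω ∂μ = Real.exp (-(c * a ^ 2)) * ∫ ω, K r ω ∂μ) :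
    AEStronglyMeasurable (fun r => ∫ ω, K r ω ∂μ) (volume.restrict (Set.Ioi 0)) ∧
    Integrable (fun ω => K (R ω) ω) μ ∧
    ∫ ω, K (R ω) ω ∂μ =
      ∫ r in Set.Ioi 0, 2 * c * r * Real.exp (-(c * r ^ 2)) * ∫ ω, K r ω ∂μ := by
  have hbd : ∀ r, |∫ ω, K r ω ∂μ| ≤ 1 := fun r => by
    simpa using norm_integral_le_of_norm_le_const (μ := μ) (f := K r) (C := 1)
      (.of_forall fun ω => hK1 r ω)
  have hmeas2 : ∀ m, Measurable fun r => ∫ ω, K (gridCeil m r) ω ∂μ := fun m =>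
    (Measurable.of_discrete (f := fun k : ℕ => ∫ ω, K ((k : ℝ) / ((m : ℝ) + 1)) ω ∂μ)).comp
      (Nat.measurable_ceil.comp (measurable_id.mul_const _))
  -- Right-continuity identifies the limit as the mesh tends to 0; it also yields the measurability
  -- of the evaluated process.
  have hlim1 : ∀ᵐ ω ∂μ, Tendsto (fun m => K (gridCeil m (R ω)) ω) atTop (𝓝 (K (R ω) ω)) := by
    filter_upwards [hR0, hKc] with ω h0 hω
    exact (hω _ h0).tendsto.comp (tendsto_gridCeil h0.le)
  have hlim2 : ∀ r ∈ Set.Ioi (0 : ℝ), Tendsto (fun m => ∫ ω, K (gridCeil m r) ω ∂μ) atTop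
      (𝓝 (∫ ω, K r ω ∂μ)) := fun r hr => by
    refine tendsto_integral_of_dominated_convergence (fun _ => 1)
      (fun m => (hK _).aestronglyMeasurable) (integrable_const _)
      (fun m => .of_forall fun ω => hK1 _ ω) ?_
    filter_upwards [hKc] with ω hω
    exact (hω r hr).tendsto.comp (tendsto_gridCeil (le_of_lt hr))
  have hlim2' : ∀ᵐ r ∂volume.restrict (Set.Ioi 0), Tendsto (fun m => ∫ ω, K (gridCeil m r) ω ∂μ)
      atTop (𝓝 (∫ ω, K r ω ∂μ)) := (ae_restrict_mem measurableSet_Ioi).mono hlim2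
  have hm1 : AEStronglyMeasurable (fun ω => K (R ω) ω) μ :=
    aestronglyMeasurable_of_tendsto_ae atTop
      (fun m => (measurable_eval_gridCeil hR hK m).aestronglyMeasurable) hlim1
  refine ⟨aestronglyMeasurable_of_tendsto_ae atTop
    (fun m => (hmeas2 m).aestronglyMeasurable) hlim2',
    Integrable.of_bound hm1 1 (.of_forall fun ω => hK1 _ ω), ?_⟩
  have hL : Tendsto (fun m => ∫ ω, K (gridCeil m (R ω)) ω ∂μ) atTop (𝓝 (∫ ω, K (R ω) ω ∂μ)) :=
    tendsto_integral_of_dominated_convergence (fun _ => 1)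
      (fun m => (measurable_eval_gridCeil hR hK m).aestronglyMeasurable) (integrable_const _)
      (fun m => .of_forall fun ω => hK1 _ ω) hlim1
  refine tendsto_nhds_unique (hL.congr fun m => integral_eval_gridCeil hR hR0 hc hK hK1 h m) ?_
  refine tendsto_integral_of_dominated_convergence
    (fun r => 2 * c * r * Real.exp (-(c * r ^ 2)))
    (fun m => ((by fun_prop : Measurable fun r : ℝ => 2 * c * r * Real.exp (-(c * r ^ 2))).mul
      (hmeas2 m)).aestronglyMeasurable) (integrableOn_mul_exp_neg_mul_sq hc le_rfl) (fun m => ?_)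
    (hlim2'.mono fun r hr => hr.const_mul _)
  filter_upwards [ae_restrict_mem measurableSet_Ioi] with r hr
  have hr' : (0 : ℝ) < r := hr
  rw [norm_mul, Real.norm_of_nonneg (by positivity : 0 ≤ 2 * c * r * Real.exp (-(c * r ^ 2)))]
  exact mul_le_of_le_one_right (by positivity) (hbd _)

end RandomRadius

/-! ### Complete Bell polynomials -/

/-- The tuples of multiplicities `(i_1, …, i_M)` with `i_1 + 2 i_2 + ⋯ + M i_M = k`. -/
def multiplicities (M k : ℕ) : Finset (Fin M → ℕ) :=
  (Fintype.piFinset fun _ : Fin M => Finset.range (k + 1)).filter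
    (fun i => ∑ n : Fin M, ((n : ℕ) + 1) * i n = k)

lemma mem_multiplicities {M k : ℕ} {i : Fin M → ℕ} :
    i ∈ multiplicities M k ↔ ∑ n : Fin M, ((n : ℕ) + 1) * i n = k := by
  simp only [multiplicities, Finset.mem_filter, Fintype.mem_piFinset, Finset.mem_range,
    and_iff_right_iff_imp]
  rintro rfl n
  have h : ((n : ℕ) + 1) * i n ≤ ∑ n : Fin M, ((n : ℕ) + 1) * i n :=
    Finset.single_le_sum (f := fun n : Fin M => ((n : ℕ) + 1) * i n) (fun _ _ => Nat.zero_le _)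
      (Finset.mem_univ n)
  have h2 : i n ≤ ((n : ℕ) + 1) * i n := Nat.le_mul_of_pos_left _ (Nat.succ_pos _)
  omega

/-- The coefficient of `x ^ k` in `exp (∑ n, e n * x ^ n)`, by partitions of `k` into parts of size
at most `M`. -/
noncomputable def expCoeff (e : ℕ → ℝ) (M k : ℕ) : ℝ :=
  ∑ i ∈ multiplicities M k, ∏ n : Fin M, e ((n : ℕ) + 1) ^ i n / ((i n).factorial : ℝ)

/-- A partition of $k\le M$ has no part of size $M+1$. -/
lemma expCoeff_succ_left (e : ℕ → ℝ) {M k : ℕ} (h : k ≤ M) :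
    expCoeff e (M + 1) k = expCoeff e M k := by
  have hlast : ∀ i ∈ multiplicities (M + 1) k, i (Fin.last M) = 0 := fun i hi => by
    have := mem_multiplicities.1 hi
    rw [Fin.sum_univ_castSucc, Fin.val_last] at this
    by_contra h0
    have h1 : M + 1 ≤ (M + 1) * i (Fin.last M) := Nat.le_mul_of_pos_right _ (Nat.pos_of_ne_zero h0)
    omega
  refine Finset.sum_bij' (fun i _ => fun n => i n.castSucc)
    (fun i _ => Fin.snoc (α := fun _ => ℕ) i 0) ?_ ?_ ?_ ?_ ?_
  · intro i hi
    have h0 := hlast i hi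
    rw [mem_multiplicities] at hi ⊢
    rw [Fin.sum_univ_castSucc, h0] at hi
    simpa using hi
  · intro i hi
    rw [mem_multiplicities] at hi ⊢
    rw [Fin.sum_univ_castSucc]
    simpa using hi
  · intro i hi
    ext n
    refine Fin.lastCases ?_ (fun n => ?_) n
    · simp [hlast i hi]
    · simp
  · intro i _
    ext n
    simp
  · intro i hi
    rw [Fin.prod_univ_castSucc, hlast i hi]
    simp

lemma expCoeff_eq (e : ℕ → ℝ) {M k : ℕ} (h : k ≤ M) : expCoeff e M k = expCoeff e k k := by
  induction M, h using Nat.le_induction with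
  | base => rfl
  | succ M h ih => rw [expCoeff_succ_left e h, ih]

/-- As $i_n/i_n!=1/(i_n-1)!$, the weight $i_n$ amounts to removing one part of size $n+1$, a
bijection onto the partitions of $k-(n+1)$. -/
lemma sum_mul_multiplicity (e : ℕ → ℝ) (M k : ℕ) (n : Fin M) :
    ∑ i ∈ multiplicities M k, (i n : ℝ) * ∏ m : Fin M, e ((m : ℕ) + 1) ^ i m / ((i m).factorial : ℝ) =
      if (n : ℕ) + 1 ≤ k then e ((n : ℕ) + 1) * expCoeff e M (k - ((n : ℕ) + 1)) else 0 := by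
  have hupd : ∀ (i : Fin M → ℕ) (c : ℕ), ∑ m : Fin M, ((m : ℕ) + 1) * Function.update i n c m =
      ((n : ℕ) + 1) * c + ∑ m ∈ Finset.univ.erase n, ((m : ℕ) + 1) * i m := fun i c => by
    rw [← Finset.add_sum_erase _ _ (Finset.mem_univ n), Function.update_self]
    congr 1
    refine Finset.sum_congr rfl fun m hm => ?_
    rw [Function.update_of_ne (Finset.ne_of_mem_erase hm)]
  have hi : ∀ i : Fin M → ℕ, ∑ m : Fin M, ((m : ℕ) + 1) * i m =
      ((n : ℕ) + 1) * i n + ∑ m ∈ Finset.univ.erase n, ((m : ℕ) + 1) * i m := fun i => by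
    rw [← hupd i (i n), Function.update_eq_self]
  split_ifs with hn
  -- Tuples without the part $n+1$ have weight 0 and are dropped, so that the subtraction $i_n-1$ is
  -- a true one.
  · rw [expCoeff, Finset.mul_sum,
      ← Finset.sum_filter_of_ne (p := fun i : Fin M → ℕ => i n ≠ 0) (fun i _ h h0 => h (by simp [h0]))]
    refine Finset.sum_bij' (fun i _ => Function.update i n (i n - 1))
      (fun i _ => Function.update i n (i n + 1)) ?_ ?_ ?_ ?_ ?_
    · intro i h
      rw [Finset.mem_filter, mem_multiplicities, hi] at h
      rw [mem_multiplicities, hupd, Nat.mul_sub]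
      have : (n : ℕ) + 1 ≤ ((n : ℕ) + 1) * i n := Nat.le_mul_of_pos_right _ (Nat.pos_of_ne_zero h.2)
      omega
    · intro i h
      rw [mem_multiplicities, hi] at h
      rw [Finset.mem_filter, mem_multiplicities, hupd, Nat.mul_add]
      refine ⟨by omega, by simp⟩
    · intro i h
      have := (Finset.mem_filter.1 h).2
      simp [Nat.sub_add_cancel (Nat.pos_of_ne_zero this)]
    · intro i h
      simp
    · intro i h
      have h0 := (Finset.mem_filter.1 h).2
      obtain ⟨c, hc⟩ := Nat.exists_eq_succ_of_ne_zero h0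
      have hprod : ∏ m ∈ Finset.univ.erase n, e ((m : ℕ) + 1) ^ Function.update i n (i n - 1) m /
          ((Function.update i n (i n - 1) m).factorial : ℝ) =
          ∏ m ∈ Finset.univ.erase n, e ((m : ℕ) + 1) ^ i m / ((i m).factorial : ℝ) :=
        Finset.prod_congr rfl fun m hm => by rw [Function.update_of_ne (Finset.ne_of_mem_erase hm)]
      rw [← Finset.mul_prod_erase _ _ (Finset.mem_univ n),
        ← Finset.mul_prod_erase _ (fun m : Fin M => e ((m : ℕ) + 1) ^ Function.update i n (i n - 1) m /
          ((Function.update i n (i n - 1) m).factorial : ℝ)) (Finset.mem_univ n), Function.update_self,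
        hprod, ← mul_assoc, ← mul_assoc]
      congr 1
      rw [hc, Nat.succ_sub_one, Nat.succ_eq_add_one, Nat.factorial_succ]
      push_cast
      field_simp
      ring
  · refine Finset.sum_eq_zero fun i h => ?_
    rw [mem_multiplicities, hi] at h
    have : i n = 0 := by
      by_contra h0
      have : (n : ℕ) + 1 ≤ ((n : ℕ) + 1) * i n := Nat.le_mul_of_pos_right _ (Nat.pos_of_ne_zero h0)
      omega
    simp [this]

/-- The coefficients of $f'=g'f$ for $f=\exp g$. Combinatorially, $k+1=\sum_n(n+1)i_n$ distributes
the factor $k+1$ over the part sizes. -/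
lemma succ_mul_expCoeff (e : ℕ → ℝ) (k : ℕ) :
    ((k : ℝ) + 1) * expCoeff e (k + 1) (k + 1) =
      ∑ i ∈ Finset.range (k + 1),
        ((k - i : ℕ) + 1 : ℝ) * e (k - i + 1) * expCoeff e i i := by
  have h1 : ((k : ℝ) + 1) * expCoeff e (k + 1) (k + 1) =
      ∑ n : Fin (k + 1), ((n : ℕ) + 1 : ℝ) * ∑ i ∈ multiplicities (k + 1) (k + 1),
        (i n : ℝ) * ∏ m : Fin (k + 1), e ((m : ℕ) + 1) ^ i m / ((i m).factorial : ℝ) := by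
    simp_rw [Finset.mul_sum]
    rw [Finset.sum_comm, expCoeff, Finset.mul_sum]
    refine Finset.sum_congr rfl fun i hi => ?_
    simp_rw [← mul_assoc]
    rw [← Finset.sum_mul]
    congr 1
    exact_mod_cast (mem_multiplicities.1 hi).symm
  -- After the reflection, index $n$ pairs the removed part of size $n+1$ with a remaining partition
  -- of $k-n$.
  rw [h1, ← Finset.sum_range_reflect, Finset.sum_range]
  refine Finset.sum_congr rfl fun n _ => ?_
  have hn : (n : ℕ) ≤ k := Nat.lt_succ_iff.1 n.2
  rw [sum_mul_multiplicity, if_pos (by omega), Nat.add_sub_add_right, Nat.add_sub_cancel,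
    Nat.sub_sub_self hn, expCoeff_eq e (by omega : k - (n : ℕ) ≤ k + 1), mul_assoc]

/-- The complete Bell polynomial in `E 1, …, E k`, as a sum over the multiplicities of partitions. -/
noncomputable def bell (E : ℕ → ℝ) (k : ℕ) : ℝ :=
  ∑ i ∈ (Fintype.piFinset fun _ : Fin k => Finset.range (k + 1)).filter
      (fun i => ∑ n : Fin k, ((n : ℕ) + 1) * i n = k),
    (k.factorial : ℝ) /
        (∏ n : Fin k, (((n : ℕ) + 1).factorial : ℝ) ^ i n * ((i n).factorial : ℝ)) *
      ∏ n : Fin k, E ((n : ℕ) + 1) ^ i n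

lemma bell_eq (E : ℕ → ℝ) (k : ℕ) :
    bell E k = k.factorial * expCoeff (fun n => E n / n.factorial) k k := by
  rw [bell, expCoeff, Finset.mul_sum]
  refine Finset.sum_congr rfl fun i _ => ?_
  simp_rw [div_pow, div_div]
  rw [Finset.prod_div_distrib]
  ring

lemma bell_congr {E E' : ℕ → ℝ} (h : ∀ n, 1 ≤ n → E n = E' n) (k : ℕ) : bell E k = bell E' k := by
  unfold bell
  refine Finset.sum_congr rfl fun i _ => ?_
  congr 1
  exact Finset.prod_congr rfl fun n _ => by rw [h _ (Nat.succ_pos _)]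

/-- Faà di Bruno's formula for the exponential function. -/
theorem iteratedDeriv_of_eventuallyEq_exp {L u : ℝ → ℝ} {s : ℝ} (hu : ContDiffAt ℝ (⊤ : ℕ∞) u s)
    (h : L =ᶠ[𝓝 s] fun t => Real.exp (u t)) (k : ℕ) :
    iteratedDeriv k L s = L s * bell (fun n => iteratedDeriv n u s) k := by
  have hL : ContDiffAt ℝ (⊤ : ℕ∞) L s := hu.exp.congr_of_eventuallyEq h
  -- The equation $L'=Lu'$ replaces $L'$ in the Leibniz rule and drives the strong induction.
  have hd : deriv L =ᶠ[𝓝 s] fun t => L t * deriv u t := by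
    have hu1 : ∀ᶠ t in 𝓝 s, DifferentiableAt ℝ u t := by
      filter_upwards [(hu.of_le (m := 1) (by exact_mod_cast le_top)).eventually (by simp)] with t ht
      exact ht.differentiableAt (by simp)
    filter_upwards [h.eventuallyEq_nhds, hu1] with t ht hut
    rw [ht.deriv_eq, ht.self_of_nhds]
    exact (hut.hasDerivAt.exp).deriv
  have hdu : ContDiffAt ℝ (⊤ : ℕ∞) (deriv u) s := by
    have h1 : ContDiffAt ℝ (⊤ : ℕ∞) (fun t => fderiv ℝ u t 1) s :=
      (hu.fderiv_right (m := (⊤ : ℕ∞)) (by simp)).clm_apply contDiffAt_const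
    simpa using h1
  simp_rw [bell_eq]
  induction k using Nat.strong_induction_on with
  | _ k ih =>
    cases k with
    | zero => simp [expCoeff, multiplicities]
    | succ k =>
      rw [iteratedDeriv_succ', hd.iteratedDeriv_eq, iteratedDeriv_fun_mul
        (hL.of_le (by exact_mod_cast le_top)) (hdu.of_le (by exact_mod_cast le_top))]
      rw [Nat.factorial_succ]
      push_cast
      -- The recursion agrees with the Leibniz sum term by term, by $\binom ki\,i!\,(k-i)!=k!$.
      rw [mul_comm ((k : ℝ) + 1), mul_assoc, succ_mul_expCoeff, Finset.mul_sum, Finset.mul_sum]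
      refine Finset.sum_congr rfl fun i hi => ?_
      have hik : i ≤ k := Nat.lt_succ_iff.1 (Finset.mem_range.1 hi)
      rw [ih i (by omega), ← iteratedDeriv_succ', ← Nat.choose_mul_factorial_mul_factorial hik,
        Nat.factorial_succ]
      push_cast
      have h1 : ((k - i).factorial : ℝ) ≠ 0 := by positivity
      field_simp

/-! ### The substitution `t = 1 / (1 + c v ^ (-α))` -/

section Substitution

variable {α c ρ : ℝ}

lemma one_div_one_add_mem {x : ℝ} (hx : 0 < x) : 1 / (1 + x) ∈ Set.Ioo (0 : ℝ) 1 :=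
  ⟨by positivity, by rw [div_lt_one (by positivity)]; linarith⟩

lemma hasDerivAt_substitution (hc : 0 ≤ c) {v : ℝ} (hv : 0 < v) :
    HasDerivAt (fun v => 1 / (1 + c * v ^ (-α)))
      (α * c * v ^ (-α - 1) * (1 / (1 + c * v ^ (-α))) ^ 2) v := by
  have hne : 1 + c * v ^ (-α) ≠ 0 := by
    have := mul_nonneg hc (Real.rpow_nonneg hv.le (-α)); linarith
  have h := (((Real.hasDerivAt_rpow_const (p := -α) (.inl hv.ne')).const_mul c).const_add 1).fun_inv hne
  simp only [one_div]
  refine h.congr_deriv ?_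
  field_simp

lemma image_substitution (hα : 0 < α) (hc : 0 < c) (hρ : 0 < ρ) :
    (fun v => 1 / (1 + c * v ^ (-α))) '' Set.Ioi ρ = Set.Ioo (1 / (1 + c * ρ ^ (-α))) 1 := by
  ext τ
  constructor
  · rintro ⟨v, hv, rfl⟩
    have hv0 : 0 < v := hρ.trans hv
    have h1 : v ^ (-α) < ρ ^ (-α) := Real.rpow_lt_rpow_of_neg hρ hv (by linarith)
    have h2 := Real.rpow_pos_of_pos hv0 (-α)
    refine ⟨?_, (one_div_one_add_mem (by positivity)).2⟩
    exact one_div_lt_one_div_of_lt (by positivity) (by nlinarith)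
  · rintro ⟨h1, h2⟩
    have hw := (one_div_one_add_mem (x := c * ρ ^ (-α)) (by positivity)).1
    have hτ : 0 < τ := hw.trans h1
    -- The solution of $\tau=1/(1+cy)$, where $y=v^{-\alpha}$.
    set y := (1 - τ) / (τ * c) with hy
    have hy0 : 0 < y := div_pos (by linarith) (by positivity)
    have hyα : (y ^ (-(1 / α))) ^ (-α) = y := by
      rw [← Real.rpow_mul hy0.le, show -(1 / α) * -α = 1 by field_simp, Real.rpow_one]
    have hcy : 1 + c * y = 1 / τ := by rw [hy]; field_simp; ring
    refine ⟨y ^ (-(1 / α)), ?_, ?_⟩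
    · rw [Set.mem_Ioi, ← Real.rpow_lt_rpow_iff_of_neg (Real.rpow_pos_of_pos hy0 _) hρ
        (neg_lt_zero.2 hα), hyα]
      have h3 : 1 / τ < 1 + c * ρ ^ (-α) := by
        rw [div_lt_comm₀ (by positivity) hτ] at h1
        exact h1
      have : c * y < c * ρ ^ (-α) := by linarith
      exact lt_of_mul_lt_mul_left this hc.le
    · simp only
      rw [hyα, hcy, one_div_one_div]

lemma injOn_substitution (hα : 0 < α) (hc : 0 < c) (hρ : 0 < ρ) :
    Set.InjOn (fun v => 1 / (1 + c * v ^ (-α))) (Set.Ioi ρ) := by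
  intro v hv v' hv' h
  have hv0 : 0 < v := hρ.trans hv
  have hv0' : 0 < v' := hρ.trans hv'
  simp only [one_div, inv_inj, add_right_inj] at h
  have h1 := mul_left_cancel₀ hc.ne' h
  exact (Real.rpow_left_inj hv0.le hv0'.le (neg_ne_zero.2 hα.ne')).1 h1

/-- From $cv^{-\alpha}=(1-t)/t$ one gets $v^2=c^{2/\alpha}(t/(1-t))^{2/\alpha}$, while $dt=\alpha
cv^{-\alpha-1}t^2\,dv$ turns $v\,dv$ into $v^2\,dt/(\alpha t(1-t))$. `F` is arbitrary, as the change
of variables asks for no integrability. -/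
lemma integral_substitution (hα : 0 < α) (hc : 0 < c) (hρ : 0 < ρ) (F : ℝ → ℝ) :
    ∫ v in Set.Ioi ρ, v * F (1 / (1 + c * v ^ (-α))) =
      1 / α * c ^ (2 / α) * ∫ t in Set.Ioo (1 / (1 + c * ρ ^ (-α))) 1,
        F t * (t ^ (2 / α - 1) * (1 - t) ^ (-(2 / α) - 1)) := by
  rw [← integral_const_mul, ← image_substitution hα hc hρ,
    integral_image_eq_integral_abs_deriv_smul measurableSet_Ioi
      (fun v hv => (hasDerivAt_substitution (α := α) hc.le (hρ.trans hv)).hasDerivWithinAt)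
      (injOn_substitution hα hc hρ)]
  refine setIntegral_congr_fun measurableSet_Ioi fun v hv => ?_
  have hv0 : 0 < v := hρ.trans hv
  have hy0 : 0 < v ^ (-α) := Real.rpow_pos_of_pos hv0 _
  set y := c * v ^ (-α) with hy
  have hyp : 0 < y := by positivity
  set t := 1 / (1 + y) with ht
  have htpos : 0 < t := by positivity
  have h1t : 1 - t = y * t := by rw [ht]; field_simp; ring
  have hyr : y ^ (-(2 / α)) = c ^ (-(2 / α)) * v ^ 2 := by
    rw [hy, Real.mul_rpow hc.le hy0.le, ← Real.rpow_mul hv0.le, show -α * -(2 / α) = 2 by field_simp]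
    norm_cast
  have e1 : t ^ (2 / α - 1) * (1 - t) ^ (-(2 / α) - 1) = (t ^ 2)⁻¹ * (y ^ (-(2 / α)) / y) := by
    rw [h1t, Real.mul_rpow hyp.le htpos.le, mul_left_comm, ← Real.rpow_add htpos,
      show 2 / α - 1 + (-(2 / α) - 1) = -(2 : ℕ) by push_cast; ring, Real.rpow_neg htpos.le,
      Real.rpow_natCast, Real.rpow_sub_one hyp.ne', mul_comm]
  have e2 : c * v ^ (-α - 1) = y / v := by
    rw [Real.rpow_sub_one hv0.ne', hy]; ring
  have e3 : c ^ (2 / α) * c ^ (-(2 / α)) = 1 := by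
    rw [← Real.rpow_add hc]; simp
  simp only [smul_eq_mul]
  rw [e1, mul_assoc α c, e2, hyr, abs_of_pos (by positivity)]
  calc v * F t = (c ^ (2 / α) * c ^ (-(2 / α))) * (v * F t) := by rw [e3, one_mul]
    _ = _ := by field_simp

end Substitution

/-! ### Incomplete Beta integrals and the derivatives of the exponent -/

lemma compIncBeta_eq {p q x : ℝ} (hx : x ≤ 1) :
    compIncBeta p q x = ∫ t in Set.Ioo x 1, t ^ (p - 1) * (1 - t) ^ (q - 1) := by
  rw [compIncBeta, intervalIntegral.integral_of_le hx, integral_Ioc_eq_integral_Ioo]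

/-- The only possible singularity is at $t=1$, and $q>0$ controls it; `0 < x` keeps the other power
continuous. -/
lemma integrableOn_compIncBeta {p q x : ℝ} (hq : 0 < q) (hx : 0 < x) (hx1 : x ≤ 1) :
    IntegrableOn (fun t => t ^ (p - 1) * (1 - t) ^ (q - 1)) (Set.Ioo x 1) := by
  have h1 : IntervalIntegrable (fun t : ℝ => (1 - t) ^ (q - 1)) volume x 1 := by
    have := (intervalIntegral.intervalIntegrable_rpow' (a := 1 - x) (b := 0) (r := q - 1)
      (by linarith)).comp_sub_left 1
    simpa using this
  have h2 : ContinuousOn (fun t : ℝ => t ^ (p - 1)) (Set.uIcc x 1) := fun t ht => by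
    rw [Set.uIcc_of_le hx1] at ht
    exact (Real.continuousAt_rpow_const _ _ (.inl (hx.trans_le ht.1).ne')).continuousWithinAt
  have h3 := h1.continuousOn_mul h2
  rw [intervalIntegrable_iff_integrableOn_Ioo_of_le hx1] at h3
  exact h3

/-- The binomial expansion of $((1-t)+t)^n$ without its term $t^n$. Each summand keeps a factor
$1-t$, so that after multiplication by $(1-t)^{-2/\alpha-1}$ every term is integrable on its own. -/
lemma one_sub_pow_eq_sum (n : ℕ) (t : ℝ) :
    1 - t ^ n = ∑ i ∈ Finset.Icc 1 n, (n.choose i : ℝ) * (t ^ (n - i) * (1 - t) ^ i) := by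
  have h := add_pow (1 - t) t n
  rw [sub_add_cancel, one_pow, Finset.range_eq_Ico, Finset.sum_eq_sum_Ico_succ_bot (Nat.succ_pos n)] at h
  simp only [pow_zero, Nat.sub_zero, one_mul, Nat.choose_zero_right, Nat.cast_one, mul_one] at h
  rw [sub_eq_iff_eq_add']
  refine h.trans (congrArg _ ?_)
  exact Finset.sum_congr rfl fun i _ => by ring

namespace NetParams

variable {q : NetParams}

lemma α_pos : 0 < q.α := by linarith [q.two_lt_α]

lemma two_div_α_lt_one : 2 / q.α < 1 := (div_lt_one α_pos).2 q.two_lt_α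

/-- The `n`-th derivative of `s ↦ fade l s v`. -/
noncomputable def fadeDeriv (q : NetParams) (l : Tier) (n : ℕ) (s v : ℝ) : ℝ :=
  (-1) ^ n * ((q.users l + n - 1).factorial / (q.users l - 1).factorial : ℝ) *
    (q.power l * v ^ (-q.α)) ^ n * ((1 + s * q.power l * v ^ (-q.α)) ^ (q.users l + n))⁻¹

lemma fadeDeriv_zero (l : Tier) (s v : ℝ) : q.fadeDeriv l 0 s v = q.fade l s v := by
  have : ((q.users l - 1).factorial : ℝ) ≠ 0 := by positivity
  simp [fadeDeriv, fade, this]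

lemma hasDerivAt_fadeDeriv (l : Tier) (n : ℕ) {s v : ℝ} (hs : 0 ≤ s) (hv : 0 ≤ v) :
    HasDerivAt (fun s => q.fadeDeriv l n s v) (q.fadeDeriv l (n + 1) s v) s := by
  have hne : 1 + s * q.power l * v ^ (-q.α) ≠ 0 := by
    have := gain_nonneg (q := q) l hs hv; linarith
  have h0 : HasDerivAt (fun s => 1 + s * q.power l * v ^ (-q.α)) (q.power l * v ^ (-q.α)) s := by
    simpa using (((hasDerivAt_id s).mul_const (q.power l)).mul_const (v ^ (-q.α))).const_add 1
  have h1 := ((h0.fun_pow (q.users l + n)).fun_inv (pow_ne_zero _ hne)).const_mul ((-1) ^ n *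
    ((q.users l + n - 1).factorial / (q.users l - 1).factorial : ℝ) *
    (q.power l * v ^ (-q.α)) ^ n)
  refine h1.congr_deriv ?_
  have hu := q.users_pos l
  obtain ⟨m, hm⟩ : ∃ m, q.users l + n = m + 1 := ⟨q.users l + n - 1, by omega⟩
  rw [fadeDeriv, ← add_assoc, hm]
  simp only [Nat.add_sub_cancel, Nat.factorial_succ]
  generalize 1 + s * q.power l * v ^ (-q.α) = X at hne ⊢
  generalize q.power l * v ^ (-q.α) = y
  have e : X ^ m / (X ^ (m + 1)) ^ 2 = (X ^ (m + 1 + 1))⁻¹ := by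
    field_simp
    ring
  rw [← e]
  push_cast
  ring

lemma continuous_fadeDeriv_aux (l : Tier) (n : ℕ) (s : ℝ) : Measurable (q.fadeDeriv l n s) := by
  unfold fadeDeriv; fun_prop

/-- One factor $v^{-\alpha}$ is kept for integrability, the others are bounded by $\rho^{-\alpha}$.
The majorant does not involve $s$, which allows differentiation under the integral sign. -/
lemma abs_mul_fadeDeriv_succ_le (l : Tier) (n : ℕ) {ρ s v : ℝ} (hs : 0 ≤ s) (hρ : 0 < ρ)
    (hv : ρ < v) :
    |v * q.fadeDeriv l (n + 1) s v| ≤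
      ((q.users l + (n + 1) - 1).factorial / (q.users l - 1).factorial : ℝ) *
        q.power l ^ (n + 1) * (ρ ^ (-q.α)) ^ n * v ^ (1 - q.α) := by
  have hv0 : 0 < v := hρ.trans hv
  have hg := gain_nonneg (q := q) l hs hv0.le
  have hy := Real.rpow_pos_of_pos hv0 (-q.α)
  have hp := q.power_pos l
  have h1 : v ^ (-q.α) ≤ ρ ^ (-q.α) :=
    Real.rpow_le_rpow_of_nonpos hρ hv.le (by linarith [q.two_lt_α])
  have h2 : ((1 + s * q.power l * v ^ (-q.α)) ^ (q.users l + (n + 1)))⁻¹ ≤ 1 :=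
    inv_le_one_of_one_le₀ (one_le_pow₀ (by linarith))
  have h3 : 0 ≤ ((1 + s * q.power l * v ^ (-q.α)) ^ (q.users l + (n + 1)))⁻¹ := by positivity
  rw [fadeDeriv]
  simp only [abs_mul, abs_pow, abs_neg, abs_one, one_pow, one_mul, abs_of_pos hv0, abs_of_pos hy,
    abs_of_pos hp, abs_of_nonneg h3, abs_div, Nat.abs_cast]
  calc v * (((q.users l + (n + 1) - 1).factorial / (q.users l - 1).factorial : ℝ) *
        (q.power l * v ^ (-q.α)) ^ (n + 1) *
        ((1 + s * q.power l * v ^ (-q.α)) ^ (q.users l + (n + 1)))⁻¹)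
      ≤ v * (((q.users l + (n + 1) - 1).factorial / (q.users l - 1).factorial : ℝ) *
        (q.power l ^ (n + 1) * ((ρ ^ (-q.α)) ^ n * v ^ (-q.α))) * 1) := by
        rw [mul_pow, pow_succ (v ^ (-q.α))]
        gcongr
    _ = _ := by
        rw [sub_eq_add_neg, Real.rpow_add hv0, Real.rpow_one]; ring

/-- The `n`-th derivative in `s` of the integral in `exponent`. -/
noncomputable def exponentDeriv (q : NetParams) (l : Tier) (ρ : ℝ) (n : ℕ) (s : ℝ) : ℝ :=
  ∫ v in Set.Ioi ρ, v * ((if n = 0 then 1 else 0) - q.fadeDeriv l n s v)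

lemma exponent_eq_exponentDeriv (l : Tier) (ρ s : ℝ) :
    q.exponent l ρ s = 2 * Real.pi * q.exponentDeriv l ρ 0 s := by
  simp [exponent, exponentDeriv, fadeDeriv_zero]

lemma integrableOn_exponentDeriv (l : Tier) (n : ℕ) {ρ s : ℝ} (hρ : 0 < ρ) (hs : 0 ≤ s) :
    IntegrableOn (fun v => v * ((if n = 0 then 1 else 0) - q.fadeDeriv l n s v)) (Set.Ioi ρ) := by
  cases n with
  | zero => simpa [fadeDeriv_zero] using integrableOn_one_sub_fade l hρ hs
  | succ n =>
    refine Integrable.mono' ((integrableOn_rpow_Ioi (q := q) hρ).const_mul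
      (((q.users l + (n + 1) - 1).factorial / (q.users l - 1).factorial : ℝ) *
        q.power l ^ (n + 1) * (ρ ^ (-q.α)) ^ n)) ?_ ?_
    · exact (measurable_id.mul (measurable_const.sub
        (continuous_fadeDeriv_aux l (n + 1) s))).aestronglyMeasurable
    · filter_upwards [ae_restrict_mem measurableSet_Ioi] with v hv
      simpa using abs_mul_fadeDeriv_succ_le l n hs hρ hv

lemma hasDerivAt_exponentDeriv (l : Tier) (n : ℕ) {ρ s : ℝ} (hρ : 0 < ρ) (hs : 0 < s) :
    HasDerivAt (q.exponentDeriv l ρ n) (q.exponentDeriv l ρ (n + 1) s) s := by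
  have hmeas : ∀ n s, AEStronglyMeasurable
      (fun v => v * ((if n = 0 then 1 else 0) - q.fadeDeriv l n s v)) (volume.restrict (Set.Ioi ρ)) :=
    fun n s => (measurable_id.mul (measurable_const.sub
      (continuous_fadeDeriv_aux l n s))).aestronglyMeasurable
  refine (hasDerivAt_integral_of_dominated_loc_of_deriv_le
    (F := fun s v => v * ((if n = 0 then 1 else 0) - q.fadeDeriv l n s v))
    (F' := fun s v => v * ((if n + 1 = 0 then 1 else 0) - q.fadeDeriv l (n + 1) s v))
    (bound := fun v => ((q.users l + (n + 1) - 1).factorial / (q.users l - 1).factorial : ℝ) *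
        q.power l ^ (n + 1) * (ρ ^ (-q.α)) ^ n * v ^ (1 - q.α))
    (Ioi_mem_nhds hs) (.of_forall fun s => hmeas n s) (integrableOn_exponentDeriv l n hρ hs.le)
    (hmeas (n + 1) s) ?_ ((integrableOn_rpow_Ioi hρ).const_mul _) ?_).2
  · filter_upwards [ae_restrict_mem measurableSet_Ioi] with v hv t ht
    simpa using abs_mul_fadeDeriv_succ_le l n (le_of_lt ht) hρ hv
  · filter_upwards [ae_restrict_mem measurableSet_Ioi] with v hv t ht
    refine (((hasDerivAt_fadeDeriv l n (le_of_lt ht) (hρ.trans hv).le).const_sub _).const_mul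
      v).congr_deriv ?_
    simp

/-- Since `fade` is $t^{\Psi}$ in the new variable, the substitution is applied to $1-t^\Psi$ and
expanded by `one_sub_pow_eq_sum`. -/
lemma exponent_eq_laplaceC (l : Tier) {ρ s : ℝ} (hρ : 0 < ρ) (hs : 0 < s) :
    q.exponent l ρ s = s ^ (2 / q.α) * (q.power l ^ (2 / q.α) *
      q.laplaceC (q.users l) (1 / (1 + s * q.power l * ρ ^ (-q.α)))) := by
  have hp := q.power_pos l
  have hw := one_div_one_add_mem (x := s * q.power l * ρ ^ (-q.α)) (by positivity)
  have h1 : ∀ v ∈ Set.Ioi ρ, v * (1 - q.fade l s v) =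
      v * (fun t : ℝ => 1 - t ^ q.users l) (1 / (1 + s * q.power l * v ^ (-q.α))) := fun v _ => by
    simp [fade]
  rw [exponent, setIntegral_congr_fun measurableSet_Ioi h1,
    integral_substitution (F := fun t : ℝ => 1 - t ^ q.users l) α_pos (by positivity) hρ,
    Real.mul_rpow hs.le hp.le]
  have h2 : ∀ t ∈ Set.Ioo (1 / (1 + s * q.power l * ρ ^ (-q.α))) 1,
      (1 - t ^ q.users l) * (t ^ (2 / q.α - 1) * (1 - t) ^ (-(2 / q.α) - 1)) =
      ∑ i ∈ Finset.Icc 1 (q.users l), ((q.users l).choose i : ℝ) *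
        (t ^ ((q.users l : ℝ) - i + 2 / q.α - 1) * (1 - t) ^ ((i : ℝ) - 2 / q.α - 1)) := fun t ht => by
    have ht0 : 0 < t := hw.1.trans ht.1
    have ht1 : 0 < 1 - t := by linarith [ht.2]
    rw [one_sub_pow_eq_sum, Finset.sum_mul]
    refine Finset.sum_congr rfl fun i hi => ?_
    have hi' := (Finset.mem_Icc.1 hi).2
    rw [show (q.users l : ℝ) - i + 2 / q.α - 1 = ((q.users l - i : ℕ) : ℝ) + (2 / q.α - 1) by
        push_cast [hi']; ring, show (i : ℝ) - 2 / q.α - 1 = (i : ℝ) + (-(2 / q.α) - 1) by ring,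
      Real.rpow_add ht0, Real.rpow_add ht1, Real.rpow_natCast, Real.rpow_natCast]
    ring
  rw [setIntegral_congr_fun measurableSet_Ioo h2, integral_finsetSum _ fun i hi =>
    (integrableOn_compIncBeta (by
      have : (1 : ℝ) ≤ i := by exact_mod_cast (Finset.mem_Icc.1 hi).1
      linarith [two_div_α_lt_one (q := q)]) hw.1 hw.2.le).const_mul _, laplaceC]
  simp_rw [integral_const_mul, compIncBeta_eq hw.2.le]
  ring

/-- In the new variable the $n$-th derivative of `fade` is a constant times $s^{-n}(1-t)^nt^\Psi$.
For $n\ge1$ the factor $(1-t)^n$ already tames the singularity, so a single Beta integral results.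
-/
lemma exponentDeriv_succ_eq (l : Tier) {n : ℕ} (hn : n ≠ 0) {ρ s : ℝ} (hρ : 0 < ρ) (hs : 0 < s) :
    -q.exponentDeriv l ρ n s = 1 / q.α * (-1) ^ n *
      ((q.users l + n - 1).factorial / (q.users l - 1).factorial : ℝ) *
      compIncBeta ((q.users l : ℝ) + 2 / q.α) ((n : ℝ) - 2 / q.α)
        (1 / (1 + s * q.power l * ρ ^ (-q.α))) *
      q.power l ^ n * (s * q.power l) ^ (2 / q.α - n) := by
  have hp := q.power_pos l
  have hw := one_div_one_add_mem (x := s * q.power l * ρ ^ (-q.α)) (by positivity)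
  set C : ℝ := (-1) ^ n * ((q.users l + n - 1).factorial / (q.users l - 1).factorial : ℝ) with hC
  have h1 : ∀ v ∈ Set.Ioi ρ, v * ((if n = 0 then 1 else 0) - q.fadeDeriv l n s v) =
      -C * (s⁻¹) ^ n * (v * (fun t : ℝ => (1 - t) ^ n * t ^ q.users l)
        (1 / (1 + s * q.power l * v ^ (-q.α)))) := fun v hv => by
    have hv0 : 0 < v := hρ.trans hv
    have hy0 : 0 < v ^ (-q.α) := Real.rpow_pos_of_pos hv0 _
    have hpos : 0 < 1 + s * q.power l * v ^ (-q.α) := by positivity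
    have e : 1 - 1 / (1 + s * q.power l * v ^ (-q.α)) =
        s * (q.power l * v ^ (-q.α)) * (1 + s * q.power l * v ^ (-q.α))⁻¹ := by
      field_simp; ring
    simp only [if_neg hn, fadeDeriv]
    rw [e, mul_pow, mul_pow, one_div, ← inv_pow, pow_add, hC, inv_pow s]
    field_simp
    ring
  rw [exponentDeriv, setIntegral_congr_fun measurableSet_Ioi h1, integral_const_mul,
    integral_substitution (F := fun t : ℝ => (1 - t) ^ n * t ^ q.users l) α_pos (by positivity) hρ,
    compIncBeta_eq hw.2.le]
  have h2 : ∀ t ∈ Set.Ioo (1 / (1 + s * q.power l * ρ ^ (-q.α))) 1,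
      (1 - t) ^ n * t ^ q.users l * (t ^ (2 / q.α - 1) * (1 - t) ^ (-(2 / q.α) - 1)) =
      t ^ ((q.users l : ℝ) + 2 / q.α - 1) * (1 - t) ^ ((n : ℝ) - 2 / q.α - 1) := fun t ht => by
    have ht0 : 0 < t := hw.1.trans ht.1
    have ht1 : 0 < 1 - t := by linarith [ht.2]
    rw [show (q.users l : ℝ) + 2 / q.α - 1 = (q.users l : ℝ) + (2 / q.α - 1) by ring,
      show (n : ℝ) - 2 / q.α - 1 = (n : ℝ) + (-(2 / q.α) - 1) by ring,
      Real.rpow_add ht0, Real.rpow_add ht1, Real.rpow_natCast, Real.rpow_natCast]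
    ring
  rw [setIntegral_congr_fun measurableSet_Ioo h2, Real.rpow_sub (by positivity), Real.rpow_natCast,
    mul_pow, inv_pow, hC]
  field_simp

lemma β_pos : 0 < q.β := by
  have := q.power_pos; have := q.bias_pos
  unfold β
  have h : ∀ j, (0 : ℝ) < q.Δ j := fun j => by unfold Δ; positivity
  have := h .mbs; have := h .sbs
  have := q.power_pos .mbs; have := q.power_pos .sbs
  have := q.bias_pos .mbs; have := q.bias_pos .sbs
  positivity

lemma exclusionRadius_pos (j l : Tier) {r : ℝ} (hr : 0 < r) : 0 < q.exclusionRadius j l r := by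
  have := β_pos (q := q)
  cases j <;> cases l <;> simp only [exclusionRadius] <;> positivity

/-- The exponent of `e^{-sN} L(s)`. -/
noncomputable def logLaplace (q : NetParams) (ρ : Tier → ℝ) (s : ℝ) : ℝ :=
  -s * q.noise - ∑ l, q.lam l * q.exponent l (ρ l) s

lemma laplaceFormula_eq (j : Tier) {r s : ℝ} (hr : 0 < r) (hs : 0 < s) :
    q.laplaceFormula j r s =
      Real.exp (-∑ l, q.lam l * q.exponent l (q.exclusionRadius j l r) s) := by
  rw [laplaceFormula, neg_mul, Finset.mul_sum]
  congr 2
  refine Finset.sum_congr rfl fun l _ => ?_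
  rw [exponent_eq_laplaceC l (exclusionRadius_pos j l hr) hs, w]
  ring

lemma iteratedDeriv_logLaplace {ρ : Tier → ℝ} (hρ : ∀ l, 0 < ρ l) (n : ℕ) {s : ℝ} (hs : 0 < s) :
    iteratedDeriv n (q.logLaplace ρ) s = iteratedDeriv n (fun s => -s * q.noise) s -
      ∑ l, q.lam l * (2 * Real.pi * q.exponentDeriv l (ρ l) n s) := by
  induction n generalizing s with
  | zero => simp [logLaplace, exponent_eq_exponentDeriv]
  | succ n ih =>
    rw [iteratedDeriv_succ, iteratedDeriv_succ]
    have he : iteratedDeriv n (q.logLaplace ρ) =ᶠ[𝓝 s] fun s =>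
        iteratedDeriv n (fun s => -s * q.noise) s -
          ∑ l, q.lam l * (2 * Real.pi * q.exponentDeriv l (ρ l) n s) := by
      filter_upwards [Ioi_mem_nhds hs] with t ht using ih ht
    rw [he.deriv_eq]
    have hd : DifferentiableAt ℝ (iteratedDeriv n (fun s => -s * q.noise)) s := by
      have : ContDiff ℝ (n + 1 : ℕ) (fun s : ℝ => -s * q.noise) := by fun_prop
      exact (this.differentiable_iteratedDeriv n (by exact_mod_cast Nat.lt_succ_self n)) s
    exact (hd.hasDerivAt.sub (HasDerivAt.fun_sum fun l _ =>
      ((hasDerivAt_exponentDeriv l n (hρ l) hs).const_mul _).const_mul _)).deriv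

lemma iteratedDeriv_linear (N s : ℝ) {n : ℕ} (hn : 1 ≤ n) :
    iteratedDeriv n (fun s => -s * N) s = -(if n = 1 then N else 0) := by
  obtain ⟨n, rfl⟩ := Nat.exists_eq_add_of_le' hn
  have : deriv (fun s => -s * N) = fun _ => -N := by
    ext s; simp
  rw [iteratedDeriv_succ', this, iteratedDeriv_const]
  simp only [Nat.add_eq_right]
  split_ifs <;> simp

lemma iteratedDeriv_logLaplace_eq_derivE (j : Tier) {r s : ℝ} (hr : 0 < r) (hs : 0 < s) {n : ℕ}
    (hn : 1 ≤ n) :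
    iteratedDeriv n (q.logLaplace fun l => q.exclusionRadius j l r) s = q.derivE j r s n := by
  rw [iteratedDeriv_logLaplace (fun l => exclusionRadius_pos j l hr) n hs, iteratedDeriv_linear _ _ hn,
    derivE, sub_eq_add_neg, Finset.mul_sum, ← Finset.sum_neg_distrib]
  congr 1
  refine Finset.sum_congr rfl fun l _ => ?_
  have := exponentDeriv_succ_eq (q := q) l (by omega : n ≠ 0) (exclusionRadius_pos (q := q) j l hr) hs
  rw [derivD, w]
  linear_combination q.lam l * (2 * Real.pi) * this

end NetParams

/-! ### Moments of nonpositive random variables -/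

section Moments

variable {Ω : Type*} [MeasurableSpace Ω] {ν : Measure Ω} [IsFiniteMeasure ν] {Y : Ω → ℝ}

/-- For $Y\le0$ and $t>0$ the variable $e^{tY}$ is at most 1; this puts all of $(0,\infty)$ in the
domain of analyticity of the moment generating function. -/
lemma mem_interior_integrableExpSet (hY : Measurable Y) (hY0 : ∀ ω, Y ω ≤ 0) {s : ℝ} (hs : 0 < s) :
    s ∈ interior (integrableExpSet Y ν) := by
  refine mem_interior.2 ⟨Set.Ioi 0, fun t ht => ?_, isOpen_Ioi, hs⟩
  refine Integrable.of_bound (hY.const_mul t).exp.aestronglyMeasurable 1 (.of_forall fun ω => ?_)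
  rw [Real.norm_of_nonneg (Real.exp_pos _).le, Real.exp_le_one_iff]
  exact mul_nonpos_of_nonneg_of_nonpos (le_of_lt ht) (hY0 ω)

/-- With $x=-sY$ one has $x^ie^{-x}=(-s)^iY^ie^{sY}$, whose mean is $(-s)^i$ times the $i$-th
derivative of the moment generating function. -/
lemma integral_gammaTail (hY : Measurable Y) (hY0 : ∀ ω, Y ω ≤ 0) {s : ℝ} (hs : 0 < s) (k : ℕ) :
    ∫ ω, gammaTail k (s * -Y ω) ∂ν =
      ∑ i ∈ Finset.range k, 1 / (i.factorial : ℝ) * (-s) ^ i * iteratedDeriv i (mgf Y ν) s := by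
  have hint := mem_interior_integrableExpSet (ν := ν) hY hY0 hs
  have h1 : ∀ ω, gammaTail k (s * -Y ω) = ∑ i ∈ Finset.range k,
      1 / (i.factorial : ℝ) * (-s) ^ i * (Y ω ^ i * Real.exp (s * Y ω)) := fun ω => by
    rw [gammaTail, Finset.mul_sum, mul_neg, neg_neg]
    refine Finset.sum_congr rfl fun i _ => ?_
    rw [← neg_mul, mul_pow]
    ring
  simp_rw [h1]
  rw [integral_finsetSum _ fun i _ =>
    (integrable_pow_mul_exp_of_mem_interior_integrableExpSet hint i).const_mul _]
  refine Finset.sum_congr rfl fun i _ => ?_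
  rw [integral_const_mul, iteratedDeriv_mgf hint]

end Moments

/-! ### Exclusion radii, association probabilities and the serving density -/

namespace NetParams

variable {q : NetParams}

/-- The biased average power received from tier `j` at unit distance. -/
noncomputable def biasGain (q : NetParams) (j : Tier) : ℝ := q.bias j * q.Δ j * q.power j

lemma biasGain_pos (j : Tier) : 0 < q.biasGain j := by
  have := q.power_pos j; have := q.bias_pos j
  have h : (0 : ℝ) < q.Δ j := by unfold Δ; positivity
  unfold biasGain; positivity

/-- The ratio of the exclusion radius of tier `l` to the distance of the serving station. -/
noncomputable def radiusRatio (q : NetParams) (j l : Tier) : ℝ :=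
  (q.biasGain l / q.biasGain j) ^ (1 / q.α)

lemma radiusRatio_pos (j l : Tier) : 0 < q.radiusRatio j l :=
  Real.rpow_pos_of_pos (div_pos (biasGain_pos l) (biasGain_pos j)) _

lemma radiusRatio_self (j : Tier) : q.radiusRatio j j = 1 := by
  rw [radiusRatio, div_self (biasGain_pos j).ne', Real.one_rpow]

lemma radiusRatio_mul (j l : Tier) : q.radiusRatio j l * q.radiusRatio l j = 1 := by
  have h1 := biasGain_pos (q := q) j
  have h2 := biasGain_pos (q := q) l
  rw [radiusRatio, radiusRatio, ← Real.mul_rpow (by positivity) (by positivity)]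
  field_simp
  simp

lemma β_eq : q.β = q.biasGain .mbs / q.biasGain .sbs := by
  rw [β, ← inv_div (q.biasGain .sbs), biasGain, biasGain]
  congr 1
  ring

/-- Replaces the four cases by a single ratio, linear in $r$, so that both tiers can be treated
alike. -/
lemma exclusionRadius_eq (j l : Tier) (r : ℝ) :
    q.exclusionRadius j l r = q.radiusRatio j l * r := by
  by_cases h : j = l
  · subst h
    rw [radiusRatio_self, one_mul]
    cases j <;> rfl
  · cases j <;> cases l <;> first | exact (h rfl).elim | simp only [exclusionRadius, radiusRatio, β_eq, inv_div]

lemma radiusRatio_sq (j l : Tier) :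
    q.radiusRatio j l ^ 2 = (q.biasGain l / q.biasGain j) ^ (2 / q.α) := by
  rw [radiusRatio, ← Real.rpow_natCast, ← Real.rpow_mul
    (div_pos (biasGain_pos l) (biasGain_pos j)).le]
  congr 1; push_cast; ring

/-- Comparison of biased average powers. -/
lemma biasGain_mul_le_iff (j l : Tier) {x y : ℝ} (hx : 0 < x) (hy : 0 < y) :
    q.biasGain l * y ^ (-q.α) ≤ q.biasGain j * x ^ (-q.α) ↔ q.exclusionRadius j l x ≤ y := by
  have h1 := biasGain_pos (q := q) j
  have h2 := biasGain_pos (q := q) l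
  have hα := α_pos (q := q)
  rw [exclusionRadius_eq, ← Real.rpow_le_rpow_iff (by have := radiusRatio_pos (q := q) j l; positivity)
    hy.le hα, Real.mul_rpow (radiusRatio_pos j l).le hx.le, radiusRatio, ← Real.rpow_mul (by positivity),
    one_div_mul_cancel hα.ne', Real.rpow_one, Real.rpow_neg hx.le, Real.rpow_neg hy.le]
  have hx' := Real.rpow_pos_of_pos hx q.α
  have hy' := Real.rpow_pos_of_pos hy q.α
  rw [← div_eq_mul_inv, ← div_eq_mul_inv, div_le_div_iff₀ hy' hx', div_mul_eq_mul_div,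
    div_le_iff₀ h1, mul_comm (y ^ q.α)]

/-- The density of the point process of tier `j`, in units of the cell of a tier-`j` station. -/
noncomputable def effectiveDensity (q : NetParams) (j : Tier) : ℝ :=
  ∑ l, q.lam l * q.radiusRatio j l ^ 2

lemma sum_tier (f : Tier → ℝ) : ∑ l, f l = f .mbs + f .sbs := by
  have : (Finset.univ : Finset Tier) = {Tier.mbs, Tier.sbs} := rfl
  rw [this, Finset.sum_pair (by simp)]

lemma effectiveDensity_pos (j : Tier) : 0 < q.effectiveDensity j :=
  Finset.sum_pos (fun l _ => mul_pos (q.lam_pos l) (pow_pos (radiusRatio_pos j l) 2)) ⟨j, by simp⟩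

/-- The probability of association with tier `j`. -/
noncomputable def assoc (q : NetParams) (j : Tier) : ℝ := q.lam j / q.effectiveDensity j

lemma assoc_pos (j : Tier) : 0 < q.assoc j := div_pos (q.lam_pos j) (effectiveDensity_pos j)

lemma assoc_sbs : q.assoc .sbs = q.assocSBS := by
  have h1 := q.lam_pos .mbs
  have h2 := q.lam_pos .sbs
  have hβ := β_pos (q := q)
  have e : (q.power .sbs / q.power .mbs) * ((q.Δ .sbs : ℝ) / (q.Δ .mbs : ℝ)) *
      (q.bias .sbs / q.bias .mbs) = q.β⁻¹ := by rw [β, inv_inv]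
  rw [assoc, effectiveDensity, sum_tier, radiusRatio_self, radiusRatio_sq, ← β_eq, assocSBS, e,
    Real.inv_rpow hβ.le]
  have := Real.rpow_pos_of_pos hβ (2 / q.α)
  field_simp
  ring

/-- The two radius ratios are reciprocal. That the sum is 1 is also what excludes ties between the
tiers in `ae_exists_serves`. -/
lemma assoc_add : q.assoc .mbs + q.assoc .sbs = 1 := by
  have h1 := q.lam_pos .mbs
  have h2 := q.lam_pos .sbs
  have h3 := radiusRatio_pos (q := q) .sbs .mbs
  have h4 := radiusRatio_pos (q := q) .mbs .sbs
  have h5 := radiusRatio_mul (q := q) .sbs .mbs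
  have h6 : q.radiusRatio .sbs .mbs = (q.radiusRatio .mbs .sbs)⁻¹ := eq_inv_of_mul_eq_one_left h5
  simp only [assoc, effectiveDensity, sum_tier, radiusRatio_self, h6]
  field_simp

lemma assoc_mbs : q.assoc .mbs = 1 - q.assocSBS := by
  rw [← assoc_sbs, ← assoc_add]; ring

/-- The joint density of the serving tier `j` and the serving distance. -/
noncomputable def servingDensity (q : NetParams) (j : Tier) (r : ℝ) : ℝ :=
  q.assoc j * (2 * (Real.pi * q.effectiveDensity j) * r *
    Real.exp (-(Real.pi * q.effectiveDensity j * r ^ 2)))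

lemma servingPdf_eq (j : Tier) (r : ℝ) : q.servingPdf j r = (q.assoc j)⁻¹ * q.servingDensity j r := by
  have hβ := β_pos (q := q)
  have hS := effectiveDensity_pos (q := q) j
  have hA := assoc_pos (q := q) j
  have key : q.servingPdf j r = 2 * Real.pi * q.lam j * r *
      Real.exp (-Real.pi * r ^ 2 * q.effectiveDensity j) / q.assoc j := by
    cases j
    · rw [servingPdf, assoc_mbs, effectiveDensity, sum_tier, radiusRatio_self, radiusRatio_sq,
        ← inv_div (q.biasGain .mbs), ← β_eq, Real.inv_rpow hβ.le, Real.rpow_neg hβ.le]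
      ring_nf
    · rw [servingPdf, assoc_sbs, effectiveDensity, sum_tier, radiusRatio_self, radiusRatio_sq, ← β_eq]
      ring_nf
  rw [key, servingDensity, inv_mul_cancel_left₀ hA.ne', assoc]
  have := q.lam_pos j
  rw [show -Real.pi * r ^ 2 * q.effectiveDensity j = -(Real.pi * q.effectiveDensity j * r ^ 2) by ring]
  field_simp

lemma integrableOn_servingDensity (j : Tier) {a : ℝ} (ha : 0 ≤ a) :
    IntegrableOn (q.servingDensity j) (Set.Ioi a) :=
  (integrableOn_mul_exp_neg_mul_sq (mul_pos Real.pi_pos (effectiveDensity_pos j)) ha).const_mul _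

lemma integral_servingDensity (j : Tier) :
    ∫ r in Set.Ioi 0, q.servingDensity j r = q.assoc j := by
  unfold servingDensity
  rw [integral_const_mul, integral_Ioi_mul_exp_neg_mul_sq
    (mul_pos Real.pi_pos (effectiveDensity_pos j)) le_rfl]
  simp

end NetParams

namespace TwoTierNetwork

variable {q : NetParams} {Ω : Type*} [MeasurableSpace Ω] {μ : Measure Ω}
  (net : TwoTierNetwork q μ)

/-! ### The nearest base stations -/

/-- The distance of the nearest base station of tier `j`. -/
noncomputable def nearest (j : Tier) (ω : Ω) : ℝ := ⨅ i, ‖net.pos j i ω‖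

lemma measurable_nearest (j : Tier) : Measurable (net.nearest j) :=
  Measurable.iInf fun i => net.measurable_norm_pos j i

lemma nearest_le (j : Tier) (i : ℕ) (ω : Ω) : net.nearest j ω ≤ ‖net.pos j i ω‖ :=
  ciInf_le ⟨0, by rintro _ ⟨i, rfl⟩; exact norm_nonneg _⟩ i

/-- The configuration is locally finite without multiple distances, and the interference from
outside discs of positive radii is finite. -/
structure IsRegular (ω : Ω) : Prop where
  pos_norm : ∀ l i, 0 < ‖net.pos l i ω‖
  finite_ball : ∀ (l : Tier) (M : ℝ), {i | ‖net.pos l i ω‖ ≤ M}.Finite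
  outside_ne_top : ∀ ρ : Tier → ℝ, (∀ l, 0 < ρ l) → net.outside ρ ω ≠ ∞
  norm_ne : ∀ l i k, i ≠ k → ‖net.pos l i ω‖ ≠ ‖net.pos l k ω‖

lemma ae_isRegular [IsProbabilityMeasure μ] : ∀ᵐ ω ∂μ, net.IsRegular ω := by
  have h := ae_all_iff.2 fun l => (net.isPPP l).ae_norm_ne (q.lam_pos l).le
  filter_upwards [net.ae_pos_norm, net.ae_finite_ball, net.ae_outside_ne_top, h] with ω h1 h2 h3 h4
  exact ⟨h1, h2, h3, h4⟩

variable {net} in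
-- By local finiteness the infimum is a minimum over the finitely many stations no farther than
-- station 0.
lemma IsRegular.exists_nearest {ω : Ω} (h : net.IsRegular ω) (j : Tier) :
    ∃ i, ‖net.pos j i ω‖ = net.nearest j ω := by
  obtain ⟨i, _, hi⟩ := Set.exists_min_image _ (fun i => ‖net.pos j i ω‖)
    (h.finite_ball j ‖net.pos j 0 ω‖) ⟨0, le_refl ‖net.pos j 0 ω‖⟩
  refine ⟨i, le_antisymm (le_ciInf fun k => ?_) (net.nearest_le j i ω)⟩
  by_cases hk : ‖net.pos j k ω‖ ≤ ‖net.pos j 0 ω‖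
  · exact hi k hk
  · exact (hi 0 (le_refl ‖net.pos j 0 ω‖)).trans (not_le.1 hk).le

variable {net} in
lemma IsRegular.nearest_pos {ω : Ω} (h : net.IsRegular ω) (j : Tier) : 0 < net.nearest j ω := by
  obtain ⟨i, hi⟩ := h.exists_nearest j
  exact hi ▸ h.pos_norm j i

variable {net} in
lemma IsRegular.lt_nearest_iff {ω : Ω} (h : net.IsRegular ω) (j : Tier) (a : ℝ) :
    a < net.nearest j ω ↔ ∀ i, a < ‖net.pos j i ω‖ := by
  constructor
  · exact fun h i => h.trans_le (net.nearest_le j i ω)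
  · intro ha
    obtain ⟨i, hi⟩ := h.exists_nearest j
    exact hi ▸ ha i

variable {net} in
lemma IsRegular.mem_voidEvent_iff {ω : Ω} (h : net.IsRegular ω) (a : Tier → ℝ) :
    ω ∈ net.voidEvent a ↔ ∀ l, a l < net.nearest l ω := by
  simp_rw [h.lt_nearest_iff]
  rfl

variable {net} in
-- The inequalities are not strict: ties between the tiers are still possible here.
lemma IsRegular.isServing_iff {ω : Ω} (h : net.IsRegular ω) (j : Tier) (i : ℕ) :
    net.IsServing j i ω ↔ ‖net.pos j i ω‖ = net.nearest j ω ∧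
      ∀ l, q.exclusionRadius j l (net.nearest j ω) ≤ net.nearest l ω := by
  have h1 : net.IsServing j i ω ↔
      ∀ l k, q.exclusionRadius j l ‖net.pos j i ω‖ ≤ ‖net.pos l k ω‖ :=
    forall_congr' fun l => forall_congr' fun k =>
      NetParams.biasGain_mul_le_iff j l (h.pos_norm j i) (h.pos_norm l k)
  rw [h1]
  constructor
  · intro h2
    have h3 : ‖net.pos j i ω‖ = net.nearest j ω := by
      refine le_antisymm (le_ciInf fun k => ?_) (net.nearest_le j i ω)
      simpa [NetParams.exclusionRadius_eq, NetParams.radiusRatio_self] using h2 j k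
    refine ⟨h3, fun l => ?_⟩
    obtain ⟨k, hk⟩ := h.exists_nearest l
    rw [← h3, ← hk]
    exact h2 l k
  · rintro ⟨h2, h3⟩ l k
    rw [h2]
    exact (h3 l).trans (net.nearest_le l k ω)

/-! ### Association -/

/-- The base stations of the other tier are outside the exclusion disc for the serving tier `j` and
the serving distance `r`. -/
def farEvent (j : Tier) (r : ℝ) : Set Ω :=
  net.voidEvent (Function.update (fun l => q.exclusionRadius j l r) j 0)

lemma measurableSet_farEvent (j : Tier) (r : ℝ) : MeasurableSet (net.farEvent j r) :=
  net.measurableSet_voidEvent _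

variable {net} in
-- The radius 0 given to tier `j` imposes nothing, because all distances are positive.
lemma IsRegular.mem_farEvent_iff {ω : Ω} (h : net.IsRegular ω) (j : Tier) (r : ℝ) :
    ω ∈ net.farEvent j r ↔ ∀ l, l ≠ j → q.exclusionRadius j l r < net.nearest l ω := by
  rw [farEvent, h.mem_voidEvent_iff]
  constructor
  · intro h1 l hl
    simpa [hl] using h1 l
  · intro h1 l
    by_cases hl : l = j
    · subst hl
      simpa using h.nearest_pos l
    · simpa [hl] using h1 l hl

/-- The weights `e^{-λ_l π a_l²}` of the void events. -/
noncomputable def voidProb (q : NetParams) (a : Tier → ℝ) : ℝ :=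
  ∏ l, Real.exp (-(q.lam l * (Real.pi * a l ^ 2)))

/-- Isolates $e^{-\pi\lambda_ja^2}$, the probability that the nearest station of tier `j` is farther
than `a`. -/
lemma voidProb_update (ρ : Tier → ℝ) (j : Tier) (a : ℝ) :
    voidProb q (Function.update ρ j a) =
      Real.exp (-(Real.pi * q.lam j * a ^ 2)) * voidProb q (Function.update ρ j 0) := by
  have h : ∀ b : ℝ, voidProb q (Function.update ρ j b) =
      Real.exp (-(q.lam j * (Real.pi * b ^ 2))) *
        ∏ l ∈ Finset.univ.erase j, Real.exp (-(q.lam l * (Real.pi * ρ l ^ 2))) := fun b => by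
    rw [voidProb, ← Finset.mul_prod_erase _ _ (Finset.mem_univ j), Function.update_self]
    congr 1
    exact Finset.prod_congr rfl fun l hl => by
      rw [Function.update_of_ne (Finset.ne_of_mem_erase hl)]
  rw [h a, h 0]
  simp only [ne_eq, OfNat.ofNat_ne_zero, not_false_eq_true, zero_pow, mul_zero, neg_zero,
    Real.exp_zero, one_mul]
  congr 3; ring

/-- The joint density is the density of the nearest distance in tier `j` times the probability that
the other tier is far enough; the Gaussian exponents add up to $\pi r^2$ times `effectiveDensity`.
-/
lemma servingDensity_eq (j : Tier) (r : ℝ) :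
    q.servingDensity j r = 2 * (Real.pi * q.lam j) * r * Real.exp (-(Real.pi * q.lam j * r ^ 2)) *
      voidProb q (Function.update (fun l => q.exclusionRadius j l r) j 0) := by
  have h := voidProb_update (q := q) (fun l => q.exclusionRadius j l r) j r
  have h2 : Function.update (fun l => q.exclusionRadius j l r) j r =
      fun l => q.radiusRatio j l * r := by
    ext l
    by_cases hl : l = j
    · subst hl; simp [NetParams.radiusRatio_self]
    · simp [hl, NetParams.exclusionRadius_eq]
  rw [mul_assoc _ (Real.exp _), ← h, h2, voidProb, ← Real.exp_sum, NetParams.servingDensity,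
    NetParams.assoc]
  have hS := NetParams.effectiveDensity_pos (q := q) j
  have e : ∑ l, -(q.lam l * (Real.pi * (q.radiusRatio j l * r) ^ 2)) =
      -(Real.pi * q.effectiveDensity j * r ^ 2) := by
    rw [NetParams.effectiveDensity, Finset.sum_neg_distrib, Finset.mul_sum, Finset.sum_mul]
    congr 1
    exact Finset.sum_congr rfl fun l _ => by ring
  rw [e]
  field_simp

variable {net} in
-- A strict inequality at $r$ persists slightly to the right, and a violated one stays violated
-- there because the exclusion radius increases.
lemma IsRegular.continuousWithinAt_indicator {ω : Ω} (h : net.IsRegular ω) (j : Tier)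
    {H : ℝ → Ω → ℝ} {r : ℝ} (hH : ContinuousWithinAt (fun r => H r ω) (Set.Ici r) r) :
    ContinuousWithinAt (fun r => (net.farEvent j r).indicator (H r) ω) (Set.Ici r) r := by
  by_cases hr : ω ∈ net.farEvent j r
  · refine hH.congr_of_eventuallyEq ?_ (Set.indicator_of_mem hr _)
    have h1 : ∀ᶠ t in 𝓝[≥] r, ω ∈ net.farEvent j t := by
      simp only [h.mem_farEvent_iff] at hr ⊢
      refine eventually_all.2 fun l => eventually_imp_distrib_left.2 fun hl => ?_
      have hc : Continuous fun t => q.exclusionRadius j l t := by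
        simp only [NetParams.exclusionRadius_eq]; fun_prop
      exact mem_nhdsWithin_of_mem_nhds (hc.continuousAt.eventually_lt_const (hr l hl))
    filter_upwards [h1] with t ht
    exact Set.indicator_of_mem ht _
  · refine (continuousWithinAt_const (b := (0 : ℝ))).congr_of_eventuallyEq ?_
      (Set.indicator_of_notMem hr _)
    filter_upwards [self_mem_nhdsWithin] with t ht
    refine Set.indicator_of_notMem (fun h' => hr ?_) _
    rw [h.mem_farEvent_iff] at h' ⊢
    refine fun l hl => lt_of_le_of_lt ?_ (h' l hl)
    rw [NetParams.exclusionRadius_eq, NetParams.exclusionRadius_eq]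
    exact mul_le_mul_of_nonneg_left ht (NetParams.radiusRatio_pos j l).le

/-- Functionals of the network outside the exclusion discs are averaged over the serving distance. -/
theorem integral_farEvent_nearest [IsProbabilityMeasure μ] (j : Tier) {H : ℝ → Ω → ℝ}
    (hH : ∀ r, Measurable (H r)) (hH1 : ∀ r ω, |H r ω| ≤ 1)
    (hHc : ∀ᵐ ω ∂μ, ∀ r, 0 < r → ContinuousWithinAt (fun r => H r ω) (Set.Ici r) r)
    (hHv : ∀ r, 0 < r → ∀ a : Tier → ℝ, (∀ l, 0 ≤ a l) → (∀ l, a l ≤ q.exclusionRadius j l r) →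
      ∫ ω in net.voidEvent a, H r ω ∂μ = voidProb q a * ∫ ω, H r ω ∂μ) :
    IntegrableOn (fun r => q.servingDensity j r * ∫ ω, H r ω ∂μ) (Set.Ioi 0) ∧
    Integrable (fun ω => (net.farEvent j (net.nearest j ω)).indicator (H (net.nearest j ω)) ω) μ ∧
    ∫ ω, (net.farEvent j (net.nearest j ω)).indicator (H (net.nearest j ω)) ω ∂μ =
      ∫ r in Set.Ioi 0, q.servingDensity j r * ∫ ω, H r ω ∂μ := by
  have hupd : ∀ r, 0 < r → ∀ a, 0 ≤ a → a ≤ r → ∫ ω in net.voidEvent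
      (Function.update (fun l => q.exclusionRadius j l r) j a), H r ω ∂μ =
      voidProb q (Function.update (fun l => q.exclusionRadius j l r) j a) * ∫ ω, H r ω ∂μ := by
    intro r hr a ha har
    have hself : q.exclusionRadius j j r = r := by
      rw [NetParams.exclusionRadius_eq, NetParams.radiusRatio_self, one_mul]
    refine hHv r hr _ (fun l => ?_) (fun l => ?_)
    · by_cases hl : l = j
      · subst hl; simpa using ha
      · simpa [hl] using (NetParams.exclusionRadius_pos j l hr).le
    · by_cases hl : l = j
      · subst hl; simpa [hself] using har
      · simp [hl]
  have hκ : ∀ r, 0 < r → ∫ ω, (net.farEvent j r).indicator (H r) ω ∂μ =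
      voidProb q (Function.update (fun l => q.exclusionRadius j l r) j 0) * ∫ ω, H r ω ∂μ :=
    fun r hr => by
      rw [integral_indicator (net.measurableSet_farEvent j r), farEvent, hupd r hr 0 le_rfl hr.le]
  -- The random radius is the nearest distance in tier `j`; the process vanishes unless the other
  -- tier is outside its exclusion disc.
  have key := integral_eval_randomRadius (μ := μ) (R := net.nearest j) (c := Real.pi * q.lam j)
    (K := fun r => (net.farEvent j r).indicator (H r)) (net.measurable_nearest j)
    (net.ae_isRegular.mono fun ω h => h.nearest_pos j) (mul_pos Real.pi_pos (q.lam_pos j))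
    (fun r => (hH r).indicator (net.measurableSet_farEvent j r))
    (fun r ω => by
      by_cases h : ω ∈ net.farEvent j r
      · rw [Set.indicator_of_mem h]; exact hH1 r ω
      · rw [Set.indicator_of_notMem h]; simp)
    (by
      filter_upwards [net.ae_isRegular, hHc] with ω h hc r hr
      exact h.continuousWithinAt_indicator j (hc r hr))
    (by
      intro a r ha har hr
      -- The event that tier `j` starts beyond `a` while the other tier is far is itself a void
      -- event, with radius `a` in tier `j`; so `hHv` applies.
      rw [hκ r hr, ← mul_assoc, ← voidProb_update, ← hupd r hr a ha har,
        setIntegral_indicator (net.measurableSet_farEvent j r)]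
      refine setIntegral_congr_set ?_
      filter_upwards [net.ae_isRegular] with ω h
      refine propext ?_
      change (a < net.nearest j ω ∧ ω ∈ net.farEvent j r) ↔ ω ∈ net.voidEvent _
      rw [h.mem_farEvent_iff, h.mem_voidEvent_iff]
      constructor
      · rintro ⟨h1, h2⟩ l
        by_cases hl : l = j
        · subst hl; simpa using h1
        · simpa [hl] using h2 l hl
      · intro h1
        exact ⟨by simpa using h1 j, fun l hl => by simpa [hl] using h1 l⟩)
  have hcongr : ∀ r ∈ Set.Ioi (0 : ℝ), 2 * (Real.pi * q.lam j) * r *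
      Real.exp (-(Real.pi * q.lam j * r ^ 2)) * ∫ ω, (net.farEvent j r).indicator (H r) ω ∂μ =
      q.servingDensity j r * ∫ ω, H r ω ∂μ := fun r hr => by
    rw [hκ r hr, servingDensity_eq]; ring
  refine ⟨?_, key.2.1, key.2.2.trans (setIntegral_congr_fun measurableSet_Ioi hcongr)⟩
  refine IntegrableOn.congr_fun (Integrable.mul_bdd (c := 1) (integrableOn_mul_exp_neg_mul_sq
    (mul_pos Real.pi_pos (q.lam_pos j)) le_rfl) key.1 (.of_forall fun r => ?_)) hcongr measurableSet_Ioi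
  have := norm_integral_le_of_norm_le_const (μ := μ) (f := (net.farEvent j r).indicator (H r)) (C := 1)
    (.of_forall fun ω => ?_)
  · simpa using this
  · by_cases h : ω ∈ net.farEvent j r
    · rw [Set.indicator_of_mem h]; exact hH1 r ω
    · rw [Set.indicator_of_notMem h]; simp

end TwoTierNetwork

/-! ### The serving tier: absence of ties, association probabilities, serving distance -/

namespace TwoTierNetwork

variable {q : NetParams} {Ω : Type*} [MeasurableSpace Ω] {μ : Measure Ω}
  (net : TwoTierNetwork q μ)

/-- The serving tier is `j`, without ties. -/
structure Serves (j : Tier) (ω : Ω) : Prop where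
  mem_farEvent : ω ∈ net.farEvent j (net.nearest j ω)

lemma measurableSet_serves (j : Tier) : MeasurableSet {ω | net.Serves j ω} := by
  have : {ω | net.Serves j ω} = ⋂ l, ⋂ i, {ω |
      Function.update (fun l => q.exclusionRadius j l (net.nearest j ω)) j 0 l < ‖net.pos l i ω‖} := by
    ext ω
    rw [Set.mem_ofPred_eq]
    simp only [Set.mem_iInter]
    exact ⟨fun h => h.1, fun h => ⟨h⟩⟩
  rw [this]
  refine MeasurableSet.iInter fun l => MeasurableSet.iInter fun i =>
    measurableSet_lt ?_ (net.measurable_norm_pos l i)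
  by_cases hl : l = j
  · subst hl
    simp
  · simp only [Function.update_of_ne hl, NetParams.exclusionRadius_eq]
    exact (net.measurable_nearest j).const_mul _

/-- The probability that tier `j` serves from a distance of at least `a`. -/
lemma measureReal_serves_le [IsProbabilityMeasure μ] (j : Tier) {a : ℝ} (ha : 0 ≤ a) :
    μ.real {ω | net.Serves j ω ∧ a ≤ net.nearest j ω} =
      ∫ r in Set.Ioi a, q.servingDensity j r := by
  have hms : MeasurableSet {ω | net.Serves j ω ∧ a ≤ net.nearest j ω} := by
    exact (net.measurableSet_serves j).inter
      (measurableSet_le measurable_const (net.measurable_nearest j))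
  -- The functional $1_{a\le r}$ is deterministic. The weak inequality matters: $1_{a<r}$ would not
  -- be right-continuous at $r=a$.
  have key := net.integral_farEvent_nearest (μ := μ) j (H := fun r _ => if a ≤ r then 1 else 0)
    (fun r => measurable_const) (fun r ω => by split_ifs <;> simp)
    (.of_forall fun ω r hr => by
      by_cases h : a ≤ r
      · refine (continuousWithinAt_const (b := (1 : ℝ))).congr_of_eventuallyEq ?_ (if_pos h)
        filter_upwards [self_mem_nhdsWithin] with t ht
        exact if_pos (h.trans ht)
      · refine (continuousWithinAt_const (b := (0 : ℝ))).congr_of_eventuallyEq ?_ (if_neg h)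
        filter_upwards [mem_nhdsWithin_of_mem_nhds (Iio_mem_nhds (not_le.1 h))] with t ht
        exact if_neg (not_le.2 ht))
    (fun r hr b hb hbρ => by
      rw [setIntegral_const, measureReal_def, net.measure_voidEvent hb,
        ← ENNReal.ofReal_prod_of_nonneg (fun l _ => (Real.exp_pos _).le),
        ENNReal.toReal_ofReal (Finset.prod_nonneg fun l _ => (Real.exp_pos _).le)]
      simp [voidProb])
  rw [← integral_indicator_one hms]
  have h1 : ∀ ω, {ω | net.Serves j ω ∧ a ≤ net.nearest j ω}.indicator
      (1 : Ω → ℝ) ω = (net.farEvent j (net.nearest j ω)).indicator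
        (fun _ => if a ≤ net.nearest j ω then 1 else 0) ω := fun ω => by
    have hiff : net.Serves j ω ↔ ω ∈ net.farEvent j (net.nearest j ω) := ⟨fun h => h.1, fun h => ⟨h⟩⟩
    by_cases hω : ω ∈ net.farEvent j (net.nearest j ω) <;>
      by_cases hω2 : a ≤ net.nearest j ω <;> simp [hω, hω2, hiff]
  rw [integral_congr_ae (.of_forall h1), key.2.2, ← integral_Ici_eq_integral_Ioi (x := a)]
  have h2 : ∀ r, q.servingDensity j r * ∫ _ : Ω, (if a ≤ r then (1 : ℝ) else 0) ∂μ =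
      (Set.Ici a).indicator (q.servingDensity j) r := fun r => by
    simp [Set.indicator_apply]
  simp_rw [h2]
  rw [← integral_Ici_eq_integral_Ioi, setIntegral_indicator measurableSet_Ici,
    Set.inter_eq_right.2 (Set.Ici_subset_Ici.2 ha)]

lemma measureReal_serves [IsProbabilityMeasure μ] (j : Tier) :
    μ.real {ω | net.Serves j ω} = q.assoc j := by
  rw [← NetParams.integral_servingDensity, ← net.measureReal_serves_le (μ := μ) j le_rfl]
  refine measureReal_congr (eventuallyEq_set.2 ?_)
  filter_upwards [net.ae_isRegular] with ω h
  exact ⟨fun h' => ⟨h', (h.nearest_pos j).le⟩, fun h' => h'.1⟩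

/-- A circle has area 0, hence almost surely carries no station. This bridges `a ≤` and `a <` for
the serving distance. -/
lemma ae_nearest_ne [IsProbabilityMeasure μ] (j : Tier) (a : ℝ) :
    ∀ᵐ ω ∂μ, net.nearest j ω ≠ a := by
  have hvol : volume (Metric.sphere (0 : Plane) a) = 0 := Measure.addHaar_sphere _ _ _
  have h := (net.isPPP j).counts_fintype (fun _ : Unit => Metric.sphere (0 : Plane) a)
    (fun _ => Metric.isClosed_sphere.measurableSet) (fun _ => by simp [hvol])
    (fun i k h => (h rfl).elim) (fun _ => 0)
  rw [Measure.pi_singleton] at h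
  simp only [hvol, Finset.univ_unique, Finset.prod_singleton, poissonMeasure_singleton] at h
  have hae : ∀ᵐ ω ∂μ, count (fun n => net.pos j n ω) (Metric.sphere (0 : Plane) a) = 0 := by
    have hm : MeasurableSet {ω | count (fun n => net.pos j n ω) (Metric.sphere (0 : Plane) a) = 0} :=
      measurable_count (net.measurable_pos j) Metric.isClosed_sphere.measurableSet
        (measurableSet_singleton 0)
    refine (mem_ae_iff_prob_eq_one hm).2 ?_
    simpa using h
  filter_upwards [hae, net.ae_isRegular] with ω h0 hr hω
  obtain ⟨i, hi⟩ := hr.exists_nearest j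
  have := ENNReal.tsum_eq_zero.1 h0 i
  rw [Set.indicator_of_mem (by simp [hi, hω])] at this
  exact one_ne_zero this

variable {net} in
-- Each tier would be strictly beyond the exclusion radius set by the other, which reciprocal ratios
-- forbid.
lemma IsRegular.eq_of_serves {ω : Ω} (h : net.IsRegular ω) {j l : Tier} (hj : net.Serves j ω)
    (hl : net.Serves l ω) : j = l := by
  by_contra hjl
  have h1 := (h.mem_farEvent_iff _ _).1 hj.1 l (Ne.symm hjl)
  have h2 := (h.mem_farEvent_iff _ _).1 hl.1 j hjl
  rw [NetParams.exclusionRadius_eq] at h1 h2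
  have h3 := mul_lt_mul_of_pos_left h1 (NetParams.radiusRatio_pos (q := q) l j)
  rw [← mul_assoc, NetParams.radiusRatio_mul, one_mul] at h3
  exact lt_asymm h2 h3

/-- Almost surely, some tier serves without ties. -/
lemma ae_exists_serves [IsProbabilityMeasure μ] :
    ∀ᵐ ω ∂μ, ∃ j, net.Serves j ω := by
  have hd : AEDisjoint μ {ω | net.Serves .mbs ω}
      {ω | net.Serves .sbs ω} := by
    refine measure_mono_null ?_ (ae_iff.1 net.ae_isRegular)
    intro ω hω
    rw [Set.mem_inter_iff, Set.mem_ofPred_eq, Set.mem_ofPred_eq] at hω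
    rw [Set.mem_ofPred_eq]
    exact fun h => by simpa using h.eq_of_serves hω.1 hω.2
  -- Cross-tier ties need no separate estimate: the two disjoint strict events already have total
  -- mass 1.
  have hu : μ.real ({ω | net.Serves .mbs ω} ∪
      {ω | net.Serves .sbs ω}) = 1 := by
    rw [measureReal_union₀ (net.measurableSet_serves _).nullMeasurableSet hd,
      net.measureReal_serves, net.measureReal_serves, NetParams.assoc_add]
  have hu' := (mem_ae_iff_prob_eq_one ((net.measurableSet_serves _).union
    (net.measurableSet_serves _))).2 ((ENNReal.toReal_eq_one_iff _).1 hu)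
  filter_upwards [hu'] with ω hω
  rw [Set.mem_union, Set.mem_ofPred_eq, Set.mem_ofPred_eq] at hω
  exact hω.elim (fun h => ⟨.mbs, h⟩) fun h => ⟨.sbs, h⟩

/-- Almost surely, the serving base station has no ties with other base stations. -/
lemma ae_isServing_iff [IsProbabilityMeasure μ] : ∀ᵐ ω ∂μ, net.IsRegular ω ∧ ∀ j i,
    net.IsServing j i ω ↔ ‖net.pos j i ω‖ = net.nearest j ω ∧ net.Serves j ω := by
  filter_upwards [net.ae_isRegular, net.ae_exists_serves] with ω h ⟨m, hm⟩
  refine ⟨h, fun j i => ?_⟩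
  rw [h.isServing_iff]
  refine and_congr_right fun _ => ⟨fun hj => ?_, fun hj l => ?_⟩
  · by_cases hmj : m = j
    · exact hmj ▸ hm
    -- Tier `m` wins strictly, which contradicts the weak inequality in favour of `j`.
    · have h1 := (h.mem_farEvent_iff _ _).1 hm.1 j (Ne.symm hmj)
      have h2 := hj m
      rw [NetParams.exclusionRadius_eq] at h1 h2
      have h3 := mul_lt_mul_of_pos_left h1 (NetParams.radiusRatio_pos (q := q) j m)
      rw [← mul_assoc, NetParams.radiusRatio_mul, one_mul] at h3
      exact (not_lt.2 h2 h3).elim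
  · by_cases hl : l = j
    · subst hl
      rw [NetParams.exclusionRadius_eq, NetParams.radiusRatio_self, one_mul]
    · exact ((h.mem_farEvent_iff _ _).1 hj.1 l hl).le

lemma assocEvent_ae_eq [IsProbabilityMeasure μ] (j : Tier) :
    net.assocEvent j =ᵐ[μ] {ω | net.Serves j ω} := by
  refine eventuallyEq_set.2 ?_
  filter_upwards [net.ae_isServing_iff] with ω ⟨hr, h⟩
  simp only [assocEvent, Set.mem_ofPred_eq]
  refine ⟨fun ⟨i, hi⟩ => ((h j i).1 hi).2, fun hω => ?_⟩
  obtain ⟨i, hi⟩ := hr.exists_nearest j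
  exact ⟨i, (h j i).2 ⟨hi, hω⟩⟩

lemma measureReal_assocEvent [IsProbabilityMeasure μ] (j : Tier) :
    μ.real (net.assocEvent j) = q.assoc j := by
  rw [measureReal_congr (net.assocEvent_ae_eq j), net.measureReal_serves]

lemma measureReal_assocEvent_inter_servedBeyond [IsProbabilityMeasure μ] (j : Tier) {a : ℝ}
    (ha : 0 ≤ a) :
    μ.real (net.assocEvent j ∩ net.servedBeyond j a) = ∫ r in Set.Ioi a, q.servingDensity j r := by
  rw [← net.measureReal_serves_le (μ := μ) j ha]
  refine measureReal_congr (eventuallyEq_set.2 ?_)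
  filter_upwards [net.ae_isServing_iff, net.ae_nearest_ne j a] with ω ⟨hr, h⟩ hne
  simp only [Set.mem_inter_iff, assocEvent, servedBeyond, Set.mem_ofPred_eq]
  refine ⟨fun ⟨_, i, hi, hai⟩ => ?_, fun ⟨h1, h2⟩ => ?_⟩
  · obtain ⟨h1, h2⟩ := (h j i).1 hi
    exact ⟨h2, h1 ▸ hai.le⟩
  · obtain ⟨i, hi⟩ := hr.exists_nearest j
    have hs := (h j i).2 ⟨hi, h1⟩
    refine ⟨⟨i, hs⟩, i, hs, ?_⟩
    rw [hi]
    exact lt_of_le_of_ne h2 hne.symm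

end TwoTierNetwork

namespace TwoTierNetwork

variable {q : NetParams} {Ω : Type*} [MeasurableSpace Ω] {μ : Measure Ω}
  (net : TwoTierNetwork q μ)

/-! ### The Laplace transform of the interference -/

/-- Minus the interference from outside the discs of radii `ρ l` plus noise. -/
noncomputable def negIN (ρ : Tier → ℝ) (ω : Ω) : ℝ := -((net.outside ρ ω).toReal + q.noise)

lemma measurable_negIN (ρ : Tier → ℝ) : Measurable (net.negIN ρ) :=
  ((net.measurable_outside ρ).ennreal_toReal.add_const _).neg

lemma negIN_nonpos (ρ : Tier → ℝ) (ω : Ω) : net.negIN ρ ω ≤ 0 :=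
  neg_nonpos.2 (add_nonneg ENNReal.toReal_nonneg q.noise_nonneg)

lemma mgf_negIN (ν : Measure Ω) (ρ : Tier → ℝ) (s : ℝ) :
    mgf (net.negIN ρ) ν s =
      Real.exp (-s * q.noise) * ∫ ω, Real.exp (-s * (net.outside ρ ω).toReal) ∂ν := by
  rw [mgf, ← integral_const_mul]
  refine integral_congr_ae (.of_forall fun ω => ?_)
  simp only [negIN]
  rw [← Real.exp_add]
  congr 1; ring

lemma laplaceIN_eq_mgf (j : Tier) (r : ℝ) :
    net.laplaceIN j r = mgf (net.negIN fun l => q.exclusionRadius j l r) μ := by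
  ext s
  rw [mgf_negIN]
  rfl

/-- The real-valued form, valid because the interference is almost surely finite. The second factor
is free of `a`: the interference is independent of the void event. -/
lemma setIntegral_exp_outside [IsProbabilityMeasure μ] {ρ a : Tier → ℝ} (ha : ∀ l, 0 ≤ a l)
    (haρ : ∀ l, a l ≤ ρ l) (hρ : ∀ l, 0 < ρ l) {s : ℝ} (hs : 0 ≤ s) :
    ∫ ω in net.voidEvent a, Real.exp (-s * (net.outside ρ ω).toReal) ∂μ =
      voidProb q a * Real.exp (-∑ l, q.lam l * q.exponent l (ρ l) s) := by
  have hm : Measurable fun ω => Real.exp (-s * (net.outside ρ ω).toReal) :=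
    ((net.measurable_outside ρ).ennreal_toReal.const_mul _).exp
  have h1 : ∀ᵐ ω ∂μ.restrict (net.voidEvent a),
      ENNReal.ofReal (Real.exp (-s * (net.outside ρ ω).toReal)) =
        expNeg (ENNReal.ofReal s * net.outside ρ ω) := by
    filter_upwards [ae_restrict_of_ae net.ae_isRegular] with ω h
    rw [expNeg_of_ne_top (ENNReal.mul_ne_top ENNReal.ofReal_ne_top (h.outside_ne_top ρ hρ)),
      ENNReal.toReal_mul, ENNReal.toReal_ofReal hs, neg_mul]
  rw [integral_eq_lintegral_of_nonneg_ae (.of_forall fun ω => (Real.exp_pos _).le)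
    hm.aestronglyMeasurable, lintegral_congr_ae h1, net.setLIntegral_voidEvent ha haρ hρ hs,
    ← ENNReal.ofReal_prod_of_nonneg (fun l _ => (Real.exp_pos _).le),
    ENNReal.toReal_ofReal (Finset.prod_nonneg fun l _ => (Real.exp_pos _).le), voidProb,
    ← Finset.sum_neg_distrib, Real.exp_sum, ← Finset.prod_mul_distrib]
  refine Finset.prod_congr rfl fun l _ => ?_
  rw [← Real.exp_add]
  congr 1; ring

lemma voidProb_zero : voidProb q (fun _ => 0) = 1 := by simp [voidProb]

lemma ae_voidEvent_zero [IsProbabilityMeasure μ] : net.voidEvent (fun _ => 0) =ᵐ[μ] Set.univ := by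
  refine eventuallyEq_univ.2 ?_
  filter_upwards [net.ae_isRegular] with ω h
  exact fun l i => h.pos_norm l i

lemma integral_exp_outside [IsProbabilityMeasure μ] {ρ : Tier → ℝ}
    (hρ : ∀ l, 0 < ρ l) {s : ℝ} (hs : 0 ≤ s) :
    ∫ ω, Real.exp (-s * (net.outside ρ ω).toReal) ∂μ =
      Real.exp (-∑ l, q.lam l * q.exponent l (ρ l) s) := by
  rw [← setIntegral_univ, ← setIntegral_congr_set net.ae_voidEvent_zero,
    net.setIntegral_exp_outside (fun _ => le_rfl) (fun l => (hρ l).le) hρ hs, voidProb_zero, one_mul]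

theorem laplace_eq_laplaceFormula [IsProbabilityMeasure μ] (j : Tier) {r s : ℝ} (hr : 0 < r)
    (hs : 0 < s) : net.laplace j r s = q.laplaceFormula j r s := by
  rw [NetParams.laplaceFormula_eq j hr hs,
    ← net.integral_exp_outside (fun l => NetParams.exclusionRadius_pos j l hr) hs.le]
  rfl

lemma laplaceIN_eq_exp_logLaplace [IsProbabilityMeasure μ] (j : Tier) {r s : ℝ} (hr : 0 < r)
    (hs : 0 ≤ s) :
    net.laplaceIN j r s = Real.exp (q.logLaplace (fun l => q.exclusionRadius j l r) s) := by
  rw [laplaceIN_eq_mgf, mgf_negIN,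
    net.integral_exp_outside (fun l => NetParams.exclusionRadius_pos j l hr) hs, ← Real.exp_add,
    NetParams.logLaplace, sub_eq_add_neg]

/-- Analyticity of a moment generating function; since the variable is nonpositive, `r` need not be
restricted. -/
lemma analyticOnNhd_laplaceIN [IsProbabilityMeasure μ] (j : Tier) (r : ℝ) :
    AnalyticOnNhd ℝ (net.laplaceIN j r) (Set.Ioi 0) := by
  rw [laplaceIN_eq_mgf]
  exact analyticOnNhd_mgf.mono fun s hs =>
    mem_interior_integrableExpSet (net.measurable_negIN _) (net.negIN_nonpos _) hs

theorem contDiffOn_laplaceIN [IsProbabilityMeasure μ] (j : Tier) (r : ℝ) :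
    ContDiffOn ℝ (⊤ : ℕ∞) (net.laplaceIN j r) (Set.Ioi 0) :=
  (net.analyticOnNhd_laplaceIN j r).contDiffOn (uniqueDiffOn_Ioi 0)

theorem iteratedDeriv_laplaceIN [IsProbabilityMeasure μ] (j : Tier) {r s : ℝ} (hr : 0 < r)
    (hs : 0 < s) (k : ℕ) :
    iteratedDeriv k (net.laplaceIN j r) s = net.laplaceIN j r s * q.faaDiBrunoSum j r s k := by
  set u := q.logLaplace fun l => q.exclusionRadius j l r
  have he : net.laplaceIN j r =ᶠ[𝓝 s] fun t => Real.exp (u t) := by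
    filter_upwards [Ioi_mem_nhds hs] with t ht
    exact net.laplaceIN_eq_exp_logLaplace j hr (le_of_lt ht)
  have hL : ContDiffAt ℝ (⊤ : ℕ∞) (net.laplaceIN j r) s :=
    (net.contDiffOn_laplaceIN j r).contDiffAt (Ioi_mem_nhds hs)
  -- Smoothness of the exponent is read off from that of the transform by taking logarithms.
  have hu : ContDiffAt ℝ (⊤ : ℕ∞) u s := by
    refine (hL.log ?_).congr_of_eventuallyEq ?_
    · rw [he.self_of_nhds]; exact (Real.exp_pos _).ne'
    · filter_upwards [he] with t ht
      rw [ht, Real.log_exp]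
  rw [iteratedDeriv_of_eventuallyEq_exp hu he, bell_congr (E' := q.derivE j r s) fun n hn =>
    NetParams.iteratedDeriv_logLaplace_eq_derivE j hr hs hn]
  rfl

/-! ### The conditional coverage probability -/

/-- The conditional probability of coverage, given the positions and the interfering channels, when
tier `j` serves from distance `r`. -/
noncomputable def coverTail (j : Tier) (T r : ℝ) (ω : Ω) : ℝ :=
  gammaTail (q.Δ j) ((q.power j)⁻¹ * T * |r| ^ q.α *
    -net.negIN (fun l => q.exclusionRadius j l r) ω)

/-- The absolute value in `coverTail` makes this true for every real `r`; the theorem on random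
radii asks for a bound at all radii. -/
lemma coverTail_arg_nonneg (j : Tier) {T : ℝ} (hT : 0 < T) (r : ℝ) (ω : Ω) :
    0 ≤ (q.power j)⁻¹ * T * |r| ^ q.α * -net.negIN (fun l => q.exclusionRadius j l r) ω := by
  have := q.power_pos j
  have h := neg_nonneg.2 (net.negIN_nonpos (fun l => q.exclusionRadius j l r) ω)
  positivity

lemma measurable_coverTail (j : Tier) (T r : ℝ) : Measurable (net.coverTail j T r) :=
  (continuous_gammaTail _).measurable.comp ((net.measurable_negIN _).neg.const_mul _)

lemma abs_coverTail_le (j : Tier) {T : ℝ} (hT : 0 < T) (r : ℝ) (ω : Ω) :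
    |net.coverTail j T r ω| ≤ 1 := by
  have h := net.coverTail_arg_nonneg j hT r ω
  rw [coverTail, abs_of_nonneg (gammaTail_nonneg _ h)]
  exact gammaTail_le_one _ h

/-- Restricting the measure to the void event multiplies the moment generating function near $s$ by
a constant, hence also all its derivatives. -/
lemma setIntegral_coverTail [IsProbabilityMeasure μ] (j : Tier) {T r : ℝ} (hT : 0 < T) (hr : 0 < r)
    {a : Tier → ℝ} (ha : ∀ l, 0 ≤ a l) (haρ : ∀ l, a l ≤ q.exclusionRadius j l r) :
    ∫ ω in net.voidEvent a, net.coverTail j T r ω ∂μ =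
      voidProb q a * net.conditionalCoverage j T r := by
  have hs : 0 < (q.power j)⁻¹ * T * r ^ q.α := by
    have := q.power_pos j; positivity
  set s := (q.power j)⁻¹ * T * r ^ q.α with hsdef
  have hρ : ∀ l, 0 < q.exclusionRadius j l r := fun l => NetParams.exclusionRadius_pos j l hr
  have hmgf : mgf (net.negIN fun l => q.exclusionRadius j l r) (μ.restrict (net.voidEvent a)) =ᶠ[𝓝 s]
      fun t => voidProb q a * net.laplaceIN j r t := by
    filter_upwards [Ioi_mem_nhds hs] with t ht
    rw [laplaceIN_eq_mgf, mgf_negIN, mgf_negIN, net.setIntegral_exp_outside ha haρ hρ (le_of_lt ht),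
      net.integral_exp_outside hρ (le_of_lt ht)]
    ring
  have h1 : ∀ ω, net.coverTail j T r ω =
      gammaTail (q.Δ j) (s * -net.negIN (fun l => q.exclusionRadius j l r) ω) := fun ω => by
    rw [coverTail, abs_of_pos hr]
  simp_rw [h1]
  rw [integral_gammaTail (net.measurable_negIN _) (net.negIN_nonpos _) hs, conditionalCoverage,
    Finset.mul_sum]
  refine Finset.sum_congr rfl fun i _ => ?_
  have hc : ContDiffAt ℝ i (net.laplaceIN j r) s :=
    ((net.contDiffOn_laplaceIN j r).contDiffAt (Ioi_mem_nhds hs)).of_le (by exact_mod_cast le_top)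
  rw [hmgf.iteratedDeriv_eq, iteratedDeriv_const_mul_field]
  ring

lemma integral_coverTail [IsProbabilityMeasure μ] (j : Tier) {T r : ℝ} (hT : 0 < T) (hr : 0 < r) :
    ∫ ω, net.coverTail j T r ω ∂μ = net.conditionalCoverage j T r := by
  rw [← setIntegral_univ, ← setIntegral_congr_set net.ae_voidEvent_zero,
    net.setIntegral_coverTail j hT hr (fun _ => le_rfl)
      (fun l => (NetParams.exclusionRadius_pos j l hr).le), voidProb_zero, one_mul]

variable {net} in
-- Each term is constant just to the right of $r$, because exclusion discs are closed, and the terms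
-- at $r$ form a summable majorant since larger discs leave less interference.
lemma IsRegular.continuousWithinAt_outside {ω : Ω} (h : net.IsRegular ω) (j : Tier) {r : ℝ}
    (hr : 0 < r) :
    ContinuousWithinAt (fun r => (net.outside (fun l => q.exclusionRadius j l r) ω).toReal)
      (Set.Ici r) r := by
  set f : ℝ → Tier × ℕ → ℝ≥0∞ := fun r b => if q.exclusionRadius j b.1 r < ‖net.pos b.1 b.2 ω‖ then
    net.interferingPower b.1 b.2 ω else 0 with hf
  have hne : ∀ r b, f r b ≠ ∞ := fun r b => by
    simp only [hf]
    split_ifs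
    · exact ENNReal.ofReal_ne_top
    · exact ENNReal.zero_ne_top
  have hsum : ∀ r, (net.outside (fun l => q.exclusionRadius j l r) ω).toReal = ∑' b, (f r b).toReal :=
    fun r => ENNReal.tsum_toReal_eq (hne r)
  have hexcl : ∀ l, Continuous fun t => q.exclusionRadius j l t := fun l => by
    simp only [NetParams.exclusionRadius_eq]; fun_prop
  have hmono : ∀ l t, r ≤ t → q.exclusionRadius j l r ≤ q.exclusionRadius j l t := fun l t ht => by
    rw [NetParams.exclusionRadius_eq, NetParams.exclusionRadius_eq]
    exact mul_le_mul_of_nonneg_left ht (NetParams.radiusRatio_pos j l).le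
  simp_rw [hsum]
  refine tendsto_tsum_of_dominated_convergence (bound := fun b => (f r b).toReal)
    (ENNReal.summable_toReal (h.outside_ne_top _ fun l => NetParams.exclusionRadius_pos j l hr))
    (fun b => ?_) ?_
  · refine tendsto_nhds_of_eventually_eq ?_
    by_cases hb : q.exclusionRadius j b.1 r < ‖net.pos b.1 b.2 ω‖
    · filter_upwards [mem_nhdsWithin_of_mem_nhds
        ((hexcl b.1).continuousAt.eventually_lt_const hb)] with t ht
      simp only [hf, if_pos hb, if_pos ht]
    · filter_upwards [self_mem_nhdsWithin] with t ht
      simp only [hf, if_neg hb, if_neg fun h' => hb ((hmono b.1 t ht).trans_lt h')]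
  · filter_upwards [self_mem_nhdsWithin] with t ht b
    rw [Real.norm_of_nonneg ENNReal.toReal_nonneg]
    refine ENNReal.toReal_mono (hne r b) ?_
    simp only [hf]
    by_cases hb : q.exclusionRadius j b.1 t < ‖net.pos b.1 b.2 ω‖
    · rw [if_pos hb, if_pos ((hmono b.1 t ht).trans_lt hb)]
    · rw [if_neg hb]; exact zero_le

variable {net} in
lemma IsRegular.continuousWithinAt_coverTail {ω : Ω} (h : net.IsRegular ω) (j : Tier) (T : ℝ) {r : ℝ}
    (hr : 0 < r) :
    ContinuousWithinAt (fun r => net.coverTail j T r ω) (Set.Ici r) r := by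
  refine (continuous_gammaTail _).continuousAt.comp_continuousWithinAt ?_
  refine ContinuousWithinAt.mul ?_ ((h.continuousWithinAt_outside j hr).add_const _).neg.neg
  refine ContinuousAt.continuousWithinAt ?_
  refine ContinuousAt.mul continuousAt_const ?_
  exact (Real.continuousAt_rpow_const _ _ (.inl (abs_pos.2 hr.ne').ne')).comp
    continuous_abs.continuousAt

/-- The coverage given the positions and the interfering channels, averaged over the network. -/
theorem integral_coverTail_nearest [IsProbabilityMeasure μ] (j : Tier) {T : ℝ} (hT : 0 < T) :
    IntegrableOn (fun r => q.servingDensity j r * net.conditionalCoverage j T r) (Set.Ioi 0) ∧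
    ∫ ω in {ω | net.Serves j ω}, net.coverTail j T (net.nearest j ω) ω ∂μ =
      ∫ r in Set.Ioi 0, q.servingDensity j r * net.conditionalCoverage j T r := by
  have key := net.integral_farEvent_nearest (μ := μ) j (H := net.coverTail j T)
    (net.measurable_coverTail j T) (net.abs_coverTail_le j hT)
    (by
      filter_upwards [net.ae_isRegular] with ω h r hr
      exact h.continuousWithinAt_coverTail j T hr)
    (fun r hr a ha haρ => by
      rw [net.setIntegral_coverTail j hT hr ha haρ, net.integral_coverTail j hT hr])
  have hcongr : ∀ r ∈ Set.Ioi (0 : ℝ), q.servingDensity j r * ∫ ω, net.coverTail j T r ω ∂μ =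
      q.servingDensity j r * net.conditionalCoverage j T r := fun r hr => by
    rw [net.integral_coverTail j hT hr]
  refine ⟨key.1.congr_fun hcongr measurableSet_Ioi, ?_⟩
  rw [← integral_indicator (net.measurableSet_serves j),
    ← setIntegral_congr_fun measurableSet_Ioi hcongr, ← key.2.2]
  refine integral_congr_ae (.of_forall fun ω => ?_)
  have hiff : net.Serves j ω ↔ ω ∈ net.farEvent j (net.nearest j ω) := ⟨fun h => h.1, fun h => ⟨h⟩⟩
  by_cases hω : ω ∈ net.farEvent j (net.nearest j ω)
  · exact (Set.indicator_of_mem (s := {ω | net.Serves j ω}) (hiff.2 hω) _).trans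
      (Set.indicator_of_mem hω _).symm
  · exact (Set.indicator_of_notMem (s := {ω | net.Serves j ω}) (fun h => hω (hiff.1 h)) _).trans
      (Set.indicator_of_notMem hω _).symm

end TwoTierNetwork

/-! ### The coverage event -/

/-- The index set may be infinite, so the independence is taken from the $\sigma$-algebras generated
by disjoint blocks. -/
lemma ProbabilityTheory.iIndepFun.indepFun_compl_singleton {Ω ι α : Type*} [MeasurableSpace Ω]
    [MeasurableSpace α] {μ : Measure Ω} {f : ι → Ω → α} (h : iIndepFun f μ)
    (hf : ∀ i, Measurable (f i)) (i : ι) :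
    IndepFun (f i) (fun ω (b : {b // b ≠ i}) => f b ω) μ := by
  have hd : Disjoint ({i} : Set ι) {b | b ≠ i} := by simp
  have h1 := indep_iSup_of_disjoint (fun b => (hf b).comap_le) h.iIndep hd
  refine (IndepFun_iff_Indep _ _ _).2 (indep_of_indep_of_le_left (indep_of_indep_of_le_right h1 ?_) ?_)
  · rw [MeasurableSpace.pi, MeasurableSpace.comap_iSup]
    refine iSup_le fun b => ?_
    rw [MeasurableSpace.comap_comp]
    exact le_iSup₂_of_le (f := fun i (_ : i ∈ _) => MeasurableSpace.comap (f i) _) b.1 b.2 le_rfl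
  · exact le_iSup₂_of_le (f := fun i (_ : i ∈ _) => MeasurableSpace.comap (f i) _) i
      (Set.mem_singleton i) le_rfl

/-- With `Y` frozen, the probability that `X` exceeds `c (Y ω)` is a gamma tail. -/
lemma ProbabilityTheory.IndepFun.measure_lt_gamma {Ω β : Type*} [MeasurableSpace Ω]
    [MeasurableSpace β] {μ : Measure Ω} [IsProbabilityMeasure μ] {X : Ω → ℝ} {Y : Ω → β}
    (h : IndepFun X Y μ) (hX : Measurable X) (hY : Measurable Y) {k : ℕ} (hk : 0 < k)
    (hlaw : μ.map X = gammaMeasure k 1) {B : Set β} (hB : MeasurableSet B) {c : β → ℝ}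
    (hc : Measurable c) (hc0 : ∀ y, 0 ≤ c y) :
    μ {ω | Y ω ∈ B ∧ c (Y ω) < X ω} = ∫⁻ ω in Y ⁻¹' B, ENNReal.ofReal (gammaTail k (c (Y ω))) ∂μ := by
  set D : Set (β × ℝ) := (Prod.fst ⁻¹' B) ∩ {p | c p.1 < p.2} with hD
  have hDm : MeasurableSet D := (measurable_fst hB).inter
    (measurableSet_lt (hc.comp measurable_fst) measurable_snd)
  have h1 := h.symm.lintegral_comp hY hX (Φ := fun y x => D.indicator 1 (y, x))
    ((measurable_one.indicator hDm))
  have hset : MeasurableSet {ω | Y ω ∈ B ∧ c (Y ω) < X ω} := (hY.prodMk hX) hDm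
  rw [← lintegral_indicator_one hset, ← lintegral_indicator (hY hB)]
  refine Eq.trans ?_ (h1.trans (lintegral_congr fun ω => ?_))
  · rfl
  · by_cases hω : Y ω ∈ B
    · have h2 : ∀ ω', D.indicator (1 : β × ℝ → ℝ≥0∞) (Y ω, X ω') =
          (X ⁻¹' Set.Ioi (c (Y ω))).indicator 1 ω' := fun ω' => by
        by_cases h3 : c (Y ω) < X ω'
        · rw [Set.indicator_of_mem (by exact ⟨hω, h3⟩), Set.indicator_of_mem (by exact h3)]
          rfl
        · rw [Set.indicator_of_notMem (fun h4 => h3 h4.2), Set.indicator_of_notMem (by exact h3)]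
      simp_rw [h2]
      rw [lintegral_indicator_one (hX measurableSet_Ioi), ← Measure.map_apply hX measurableSet_Ioi,
        hlaw, gammaMeasure_Ioi hk (hc0 _), Set.indicator_of_mem (by exact hω)]
    · have h2 : ∀ ω', D.indicator (1 : β × ℝ → ℝ≥0∞) (Y ω, X ω') = 0 := fun ω' =>
        Set.indicator_of_notMem (fun h4 => hω h4.1) _
      simp_rw [h2]
      rw [lintegral_zero, Set.indicator_of_notMem (by exact hω)]

namespace TwoTierNetwork

variable {q : NetParams} {Ω : Type*} [MeasurableSpace Ω] {μ : Measure Ω}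
  (net : TwoTierNetwork q μ)

/-- The positions of all base stations and the interfering channels of all but one. -/
def environment (b₀ : Tier × ℕ) (ω : Ω) : (Tier × ℕ → Plane) × ({b // b ≠ b₀} → ℝ) :=
  (fun b => net.pos b.1 b.2 ω, fun b => net.g b.1.1 b.1.2 ω)

lemma measurable_environment (b₀ : Tier × ℕ) : Measurable (net.environment b₀) :=
  (measurable_pi_lambda _ fun _ => net.measurable_pos _ _).prodMk
    (measurable_pi_lambda _ fun _ => net.measurable_g _ _)

/-- The interfering channel of `b₀` itself is left out of the environment, since it may depend on
the serving channel of `b₀`. -/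
lemma indepFun_environment [IsProbabilityMeasure μ] (b₀ : Tier × ℕ) :
    IndepFun (net.h b₀.1 b₀.2) (net.environment b₀) μ := by
  have hpm : Measurable fun ω (b : Tier × ℕ) => net.pos b.1 b.2 ω :=
    measurable_pi_lambda _ fun _ => net.measurable_pos _ _
  have hgm : Measurable fun ω (b : {b // b ≠ b₀}) => net.g b.1.1 b.1.2 ω :=
    measurable_pi_lambda _ fun _ => net.measurable_g _ _
  refine IndepFun.prodMk_of_indepFun hpm (net.measurable_h _ _) hgm ?_ ?_
  · exact net.indep_pos_fading.comp measurable_id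
      (ψ := fun z : Tier × ℕ → ℝ × ℝ => ((z b₀).1, fun b : {b // b ≠ b₀} => (z b).2))
      (by fun_prop)
  · exact (net.indep_fading.indepFun_compl_singleton
      (fun b => (net.measurable_h _ _).prodMk (net.measurable_g _ _)) b₀).comp measurable_fst
      (ψ := fun z : {b // b ≠ b₀} → ℝ × ℝ => fun b => (z b).2) (by fun_prop)

/-- The interference if base station `i` of tier `j` serves. -/
noncomputable def interferenceExcept (j : Tier) (i : ℕ) (ω : Ω) : ℝ≥0∞ :=
  ∑' b : {b : Tier × ℕ // b ≠ (j, i)}, net.interferingPower b.1.1 b.1.2 ω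

/-- The smallest channel power with which base station `i` of tier `j` covers the user. -/
noncomputable def requiredFading (j : Tier) (T : ℝ) (i : ℕ) (ω : Ω) : ℝ :=
  (q.power j)⁻¹ * T * ‖net.pos j i ω‖ ^ q.α * ((net.interferenceExcept j i ω).toReal + q.noise)

lemma measurableSet_isServing (j : Tier) (i : ℕ) : MeasurableSet {ω | net.IsServing j i ω} := by
  have hm : ∀ l k, Measurable (net.biasedPower l k) := fun l k => by
    have := net.measurable_norm_pos l k
    unfold biasedPower
    fun_prop
  simp only [IsServing, Set.ofPred_forall]
  exact MeasurableSet.iInter fun l => MeasurableSet.iInter fun k => measurableSet_le (hm l k) (hm j i)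

lemma measurableSet_assocEvent (j : Tier) : MeasurableSet (net.assocEvent j) := by
  simp only [assocEvent, Set.ofPred_exists]
  exact MeasurableSet.iUnion fun i => net.measurableSet_isServing j i

/-- Being the server and the required fading are both functions of the environment, which is
independent of the serving channel. -/
lemma measure_isServing_inter_requiredFading_lt [IsProbabilityMeasure μ] (j : Tier) {T : ℝ}
    (hT : 0 < T) (i : ℕ) :
    μ {ω | net.IsServing j i ω ∧ net.requiredFading j T i ω < net.h j i ω} =
      ∫⁻ ω in {ω | net.IsServing j i ω},
        ENNReal.ofReal (gammaTail (q.Δ j) (net.requiredFading j T i ω)) ∂μ := by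
  have hp := q.power_pos j
  have hN := q.noise_nonneg
  have hm : ∀ l k, Measurable fun y : (Tier × ℕ → Plane) × ({b // b ≠ (j, i)} → ℝ) =>
      q.bias l * q.Δ l * q.power l * ‖y.1 (l, k)‖ ^ (-q.α) := fun l k => by
    have : Measurable fun y : (Tier × ℕ → Plane) × ({b // b ≠ (j, i)} → ℝ) => ‖y.1 (l, k)‖ :=
      ((measurable_pi_apply _).comp measurable_fst).norm
    fun_prop
  refine (net.indepFun_environment (j, i)).measure_lt_gamma (net.measurable_h _ _)
    (net.measurable_environment _) (k := q.Δ j) (Nat.succ_pos _) (net.h_law j i)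
    (B := {y | ∀ l k, q.bias l * q.Δ l * q.power l * ‖y.1 (l, k)‖ ^ (-q.α) ≤
      q.bias j * q.Δ j * q.power j * ‖y.1 (j, i)‖ ^ (-q.α)})
    (c := fun y => (q.power j)⁻¹ * T * ‖y.1 (j, i)‖ ^ q.α * ((∑' b : {b : Tier × ℕ // b ≠ (j, i)},
      ENNReal.ofReal (q.power b.1.1 * y.2 b * ‖y.1 b.1‖ ^ (-q.α))).toReal + q.noise))
    ?_ ?_ fun y => by positivity
  · simp only [Set.ofPred_forall]
    exact MeasurableSet.iInter fun l => MeasurableSet.iInter fun k => measurableSet_le (hm l k) (hm j i)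
  · have hnorm : ∀ b, Measurable fun y : (Tier × ℕ → Plane) × ({b // b ≠ (j, i)} → ℝ) => ‖y.1 b‖ :=
      fun b => ((measurable_pi_apply _).comp measurable_fst).norm
    have h1 := hnorm (j, i)
    refine Measurable.mul (by fun_prop) (Measurable.add_const (Measurable.ennreal_toReal
      (Measurable.tsum fun b => ?_)) _)
    have h2 := hnorm b.1
    fun_prop

variable {net} in
-- The serving station lies exactly on the boundary of its exclusion disc and so does not count;
-- without ties, every other station is strictly outside.
lemma IsRegular.interferenceExcept_eq {ω : Ω} (h : net.IsRegular ω) {j : Tier} {i : ℕ}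
    (hi : ‖net.pos j i ω‖ = net.nearest j ω) (hj : net.Serves j ω) :
    net.interferenceExcept j i ω = net.outside (fun l => q.exclusionRadius j l (net.nearest j ω)) ω := by
  refine (tsum_subtype {b : Tier × ℕ | b ≠ (j, i)} fun b => net.interferingPower b.1 b.2 ω).trans
    (tsum_congr fun ⟨l, k⟩ => ?_)
  by_cases hb : (l, k) = (j, i)
  · obtain ⟨rfl, rfl⟩ := Prod.mk.inj hb
    rw [Set.indicator_of_notMem (by simp), if_neg]
    simp [NetParams.exclusionRadius_eq, NetParams.radiusRatio_self, hi]
  · rw [Set.indicator_of_mem (by exact hb), if_pos]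
    by_cases hl : l = j
    · subst hl
      have hki : i ≠ k := fun hki => hb (by rw [hki])
      simp only [NetParams.exclusionRadius_eq, NetParams.radiusRatio_self, one_mul]
      exact lt_of_le_of_ne (net.nearest_le l k ω) (hi ▸ h.norm_ne l i k hki)
    · exact ((h.mem_farEvent_iff _ _).1 hj.1 l hl).trans_le (net.nearest_le l k ω)

variable {net} in
lemma IsRegular.gammaTail_requiredFading {ω : Ω} (h : net.IsRegular ω) {j : Tier} {i : ℕ}
    (hi : ‖net.pos j i ω‖ = net.nearest j ω) (hj : net.Serves j ω) (T : ℝ) :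
    gammaTail (q.Δ j) (net.requiredFading j T i ω) = net.coverTail j T (net.nearest j ω) ω := by
  rw [coverTail, requiredFading, h.interferenceExcept_eq hi hj, hi, abs_of_pos (h.nearest_pos j),
    negIN, neg_neg]

variable {net} in
-- Finite interference allows clearing the denominator. A zero denominator is covered too: the
-- quotient is then $\infty$ for positive received power and 0 otherwise.
lemma IsRegular.lt_sinr_iff {ω : Ω} (h : net.IsRegular ω) {j : Tier} {i : ℕ}
    (hi : ‖net.pos j i ω‖ = net.nearest j ω) (hj : net.Serves j ω) {T : ℝ} (hT : 0 < T) :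
    ENNReal.ofReal T < net.sinr j i ω ↔ net.requiredFading j T i ω < net.h j i ω := by
  have htop : net.interferenceExcept j i ω ≠ ∞ := by
    rw [h.interferenceExcept_eq hi hj]
    exact h.outside_ne_top _ fun l => NetParams.exclusionRadius_pos j l (h.nearest_pos j)
  have hd := Real.rpow_pos_of_pos (h.pos_norm j i) q.α
  have hp := q.power_pos j
  have hJ : 0 ≤ (net.interferenceExcept j i ω).toReal := ENNReal.toReal_nonneg
  have h1 : net.sinr j i ω = ENNReal.ofReal (q.power j * net.h j i ω * ‖net.pos j i ω‖ ^ (-q.α)) /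
      ENNReal.ofReal ((net.interferenceExcept j i ω).toReal + q.noise) := by
    rw [ENNReal.ofReal_add hJ q.noise_nonneg, ENNReal.ofReal_toReal htop]
    rfl
  have hTJ : 0 ≤ T * ((net.interferenceExcept j i ω).toReal + q.noise) :=
    mul_nonneg hT.le (add_nonneg hJ q.noise_nonneg)
  rw [h1, ENNReal.lt_div_iff_mul_lt (.inr ENNReal.ofReal_ne_top)
    (.inl ENNReal.ofReal_ne_top), ← ENNReal.ofReal_mul hT.le,
    ENNReal.ofReal_lt_ofReal_iff_of_nonneg hTJ, requiredFading, Real.rpow_neg (norm_nonneg _),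
    ← div_eq_mul_inv, lt_div_iff₀ hd]
  rw [show (q.power j)⁻¹ * T * ‖net.pos j i ω‖ ^ q.α *
    ((net.interferenceExcept j i ω).toReal + q.noise) = (q.power j)⁻¹ *
      (T * ((net.interferenceExcept j i ω).toReal + q.noise) * ‖net.pos j i ω‖ ^ q.α) by ring,
    inv_mul_lt_iff₀ hp]

lemma measurable_coverTail_nearest (j : Tier) (T : ℝ) :
    Measurable fun ω => net.coverTail j T (net.nearest j ω) ω := by
  have hn := net.measurable_nearest j
  have ho : Measurable fun ω =>
      net.outside (fun l => q.exclusionRadius j l (net.nearest j ω)) ω := by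
    refine Measurable.tsum fun b => Measurable.ite (measurableSet_lt ?_ (net.measurable_norm_pos _ _))
      (net.measurable_interferingPower _ _) measurable_const
    simp only [NetParams.exclusionRadius_eq]
    exact hn.const_mul _
  refine (continuous_gammaTail _).measurable.comp (Measurable.mul ?_
    (ho.ennreal_toReal.add_const _).neg.neg)
  have := hn.norm
  simp only [Real.norm_eq_abs] at this
  fun_prop

/-- The event splits according to which station serves. Each piece is integrated over its serving
channel, and the pieces reassemble because the resulting integrand depends only on the nearest
distance, not on the index. -/
theorem measureReal_coverEvent [IsProbabilityMeasure μ] (j : Tier) {T : ℝ} (hT : 0 < T) :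
    μ.real (net.coverEvent j T) =
      ∫ r in Set.Ioi 0, q.servingDensity j r * net.conditionalCoverage j T r := by
  have hassoc : net.assocEvent j = ⋃ i, {ω | net.IsServing j i ω} := by
    ext ω; simp [assocEvent]
  have hcover : net.coverEvent j T =ᵐ[μ]
      ⋃ i, {ω | net.IsServing j i ω ∧ net.requiredFading j T i ω < net.h j i ω} := by
    refine eventuallyEq_set.2 ?_
    filter_upwards [net.ae_isServing_iff] with ω ⟨hr, h⟩
    simp only [coverEvent, Set.mem_ofPred_eq, Set.mem_iUnion]
    refine exists_congr fun i => and_congr_right fun hi => ?_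
    obtain ⟨h1, h2⟩ := (h j i).1 hi
    exact hr.lt_sinr_iff h1 h2 hT
  -- Two servers of the same tier would be equally far away, which is a null event.
  have hdisj : Pairwise (Function.onFun (AEDisjoint μ) fun i => {ω | net.IsServing j i ω}) := by
    intro i k hik
    refine measure_mono_null ?_ (ae_iff.1 net.ae_isServing_iff)
    intro ω hω
    simp only [Set.mem_inter_iff, Set.mem_ofPred_eq] at hω ⊢
    rintro ⟨hr, h⟩
    exact hr.norm_ne j i k hik (((h j i).1 hω.1).1.trans ((h j k).1 hω.2).1.symm)
  have hfm : ∀ i, Measurable (net.requiredFading j T i) := fun i => by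
    have := net.measurable_norm_pos j i
    refine Measurable.mul (by fun_prop) (Measurable.add_const (Measurable.ennreal_toReal
      (Measurable.tsum fun b => net.measurable_interferingPower _ _)) _)
  have hms : ∀ i, MeasurableSet
      {ω | net.IsServing j i ω ∧ net.requiredFading j T i ω < net.h j i ω} := fun i =>
    (net.measurableSet_isServing j i).inter (measurableSet_lt (hfm i) (net.measurable_h j i))
  have hpiece : ∀ i, μ {ω | net.IsServing j i ω ∧ net.requiredFading j T i ω < net.h j i ω} =
      ∫⁻ ω in {ω | net.IsServing j i ω},
        ENNReal.ofReal (net.coverTail j T (net.nearest j ω) ω) ∂μ := fun i => by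
    rw [net.measure_isServing_inter_requiredFading_lt j hT i]
    refine setLIntegral_congr_fun_ae (net.measurableSet_isServing j i) ?_
    filter_upwards [net.ae_isServing_iff] with ω ⟨hr, h⟩ hi
    obtain ⟨h1, h2⟩ := (h j i).1 hi
    rw [hr.gammaTail_requiredFading h1 h2]
  have hmeas : μ (net.coverEvent j T) = ∫⁻ ω in {ω | net.Serves j ω},
      ENNReal.ofReal (net.coverTail j T (net.nearest j ω) ω) ∂μ := by
    rw [measure_congr hcover, measure_iUnion₀
      (fun i k hik => (hdisj hik).mono (fun ω h => h.1) (fun ω h => h.1))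
      fun i => (hms i).nullMeasurableSet, tsum_congr hpiece,
      ← lintegral_iUnion₀ (fun i => (net.measurableSet_isServing j i).nullMeasurableSet) hdisj,
      ← hassoc]
    exact setLIntegral_congr (net.assocEvent_ae_eq j)
  rw [measureReal_def, hmeas, ← (net.integral_coverTail_nearest (μ := μ) j hT).2,
    integral_eq_lintegral_of_nonneg_ae (f := fun ω => net.coverTail j T (net.nearest j ω) ω)
      (.of_forall fun ω => gammaTail_nonneg _ (net.coverTail_arg_nonneg j hT _ ω))
      (net.measurable_coverTail_nearest j T).aestronglyMeasurable]

lemma coverageProb_eq [IsProbabilityMeasure μ] (j : Tier) (T : ℝ) :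
    net.coverageProb j T = (q.assoc j)⁻¹ * μ.real (net.coverEvent j T) := by
  have hsub : net.coverEvent j T ⊆ net.assocEvent j := fun ω ⟨i, hi⟩ => ⟨i, hi.1⟩
  rw [coverageProb, measureReal_def, cond_apply (net.measurableSet_assocEvent j),
    Set.inter_eq_right.2 hsub, ENNReal.toReal_mul, ENNReal.toReal_inv, ← measureReal_def,
    ← measureReal_def, net.measureReal_assocEvent]

lemma cond_servedBeyond [IsProbabilityMeasure μ] (j : Tier) {a : ℝ} (ha : 0 ≤ a) :
    (μ[|net.assocEvent j]).real (net.servedBeyond j a) =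
      (q.assoc j)⁻¹ * ∫ r in Set.Ioi a, q.servingDensity j r := by
  rw [measureReal_def, cond_apply (net.measurableSet_assocEvent j), ENNReal.toReal_mul,
    ENNReal.toReal_inv, ← measureReal_def, ← measureReal_def, net.measureReal_assocEvent,
    net.measureReal_assocEvent_inter_servedBeyond j ha]

/-- The event is split along association with the macro tier; almost surely the two tiers do not
both serve. -/
lemma overallCoverageProb_eq [IsProbabilityMeasure μ] (T : ℝ) :
    net.overallCoverageProb T =
      μ.real (net.coverEvent .mbs T) + μ.real (net.coverEvent .sbs T) := by
  rw [overallCoverageProb,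
    ← measureReal_inter_add_sdiff (net.measurableSet_assocEvent .mbs)]
  have hiff : ∀ᵐ ω ∂μ, ∀ i, net.IsServing .sbs i ω → ω ∉ net.assocEvent .mbs := by
    filter_upwards [net.ae_isServing_iff] with ω ⟨hr, h⟩ i hi ⟨k, hk⟩
    simpa using hr.eq_of_serves ((h _ _).1 hi).2 ((h _ _).1 hk).2
  congr 1 <;> refine measureReal_congr (eventuallyEq_set.2 ?_)
  · filter_upwards [hiff] with ω h
    simp only [coverEvent, Set.mem_inter_iff, Set.mem_ofPred_eq]
    constructor
    · rintro ⟨⟨j, i, hi⟩, hA⟩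
      cases j with
      | mbs => exact ⟨i, hi⟩
      | sbs => exact (h i hi.1 hA).elim
    · rintro ⟨i, hi⟩
      exact ⟨⟨.mbs, i, hi⟩, i, hi.1⟩
  · filter_upwards [hiff] with ω h
    simp only [coverEvent, Set.mem_sdiff, Set.mem_ofPred_eq]
    constructor
    · rintro ⟨⟨j, i, hi⟩, hA⟩
      cases j with
      | mbs => exact (hA ⟨i, hi.1⟩).elim
      | sbs => exact ⟨i, hi⟩
    · rintro ⟨i, hi⟩
      exact ⟨⟨.sbs, i, hi⟩, h i hi.1⟩

end TwoTierNetwork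

/-! ### The main theorem: dividing the joint quantities by the association probabilities -/

theorem theorem1 {Ω : Type*} [MeasurableSpace Ω] (μ : Measure Ω) [IsProbabilityMeasure μ]
    (q : NetParams) (net : TwoTierNetwork q μ) (T : ℝ) (hT : 0 < T) :
    -- coverage probability given the serving tier
    (∀ j : Tier,
      IntegrableOn (fun r => net.conditionalCoverage j T r * q.servingPdf j r) (Set.Ioi 0) ∧
      net.coverageProb j T =
        ∫ r in Set.Ioi (0 : ℝ), net.conditionalCoverage j T r * q.servingPdf j r) ∧
    -- overall coverage probability
    net.overallCoverageProb T =
      (1 - q.assocSBS) * net.coverageProb .mbs T + q.assocSBS * net.coverageProb .sbs T ∧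
    -- association probabilities
    μ.real (net.assocEvent .mbs) = 1 - q.assocSBS ∧
    μ.real (net.assocEvent .sbs) = q.assocSBS ∧
    -- law of the serving distance given the serving tier
    (∀ (j : Tier) (r : ℝ), 0 ≤ r →
      IntegrableOn (q.servingPdf j) (Set.Ioi r) ∧
      (μ[|net.assocEvent j]).real (net.servedBeyond j r) =
        ∫ x in Set.Ioi r, q.servingPdf j x) ∧
    -- Laplace transform of the interference
    (∀ (j : Tier) (r s : ℝ), 0 < r → 0 < s → net.laplace j r s = q.laplaceFormula j r s) ∧
    -- derivatives of the Laplace transform of interference plus noise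
    (∀ (j : Tier) (r : ℝ), 0 < r → ContDiffOn ℝ (⊤ : ℕ∞) (net.laplaceIN j r) (Set.Ioi 0)) ∧
    (∀ (j : Tier) (r s : ℝ) (k : ℕ), 0 < r → 0 < s →
      iteratedDeriv k (net.laplaceIN j r) s =
        net.laplaceIN j r s * q.faaDiBrunoSum j r s k) := by
  have hne : ∀ j, q.assoc j ≠ 0 := fun j => (NetParams.assoc_pos j).ne'
  have hfun : ∀ j r, net.conditionalCoverage j T r * q.servingPdf j r =
      (q.assoc j)⁻¹ * (q.servingDensity j r * net.conditionalCoverage j T r) := fun j r => by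
    rw [NetParams.servingPdf_eq]; ring
  have hcov : ∀ j, μ.real (net.coverEvent j T) = q.assoc j * net.coverageProb j T := fun j => by
    rw [net.coverageProb_eq, mul_inv_cancel_left₀ (hne j)]
  refine ⟨fun j => ⟨?_, ?_⟩, ?_, ?_, ?_, fun j r hr => ⟨?_, ?_⟩,
    fun j r s hr hs => net.laplace_eq_laplaceFormula j hr hs,
    fun j r _ => net.contDiffOn_laplaceIN j r,
    fun j r s k hr hs => net.iteratedDeriv_laplaceIN j hr hs k⟩
  · simp_rw [hfun]
    exact (net.integral_coverTail_nearest (μ := μ) j hT).1.const_mul _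
  · simp_rw [hfun]
    rw [integral_const_mul, net.coverageProb_eq, net.measureReal_coverEvent j hT]
  · rw [net.overallCoverageProb_eq, hcov, hcov, NetParams.assoc_mbs, NetParams.assoc_sbs]
  · rw [net.measureReal_assocEvent, NetParams.assoc_mbs]
  · rw [net.measureReal_assocEvent, NetParams.assoc_sbs]
  · rw [funext fun r => NetParams.servingPdf_eq (q := q) j r]
    exact (NetParams.integrableOn_servingDensity j hr).const_mul _
  · simp_rw [NetParams.servingPdf_eq]
    rw [integral_const_mul, net.cond_servedBeyond j hr]
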